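/- Let $\xi:\mathbb R\to\mathbb R$ be differentiable, convex and even with $\xi(0)=0$, and put $\theta(x)=x\xi'(x)-\xi(x)$. For each $N$ let $(H_N(\sigma))_{\sigma\in\mathbb R^N}$ be a centered (jointly measurable) Gaussian process. Let $S_N\subset\mathbb R^N$ be the sphere of radius $\sqrt N$, let $\lambda_N$ be the uniform probability measure on $S_N$, and let $R(\sigma,\rho)=N^{-1}\sum_{i\le N}\sigma_i\rho_i$ be the overlap. Assume that for all $\sigma,\rho\in S_N$ $$\Big|\tfrac1N\mathbb E H_N(\sigma)H_N(\rho)-\xi(R(\sigma,\rho))\Big|\le c_N,\qquad c_N\to0 .$$ Let $\beta_1,\dots,\beta_n>0$ and $h_1,\dots,h_n\in\mathbb R$, and let $Q=(q_{j,j'})$ be a symmetric nonnegative definite $n\times n$ matrix with $q_{j,j}=1$. For $\varepsilon>0$ let $Q_\varepsilon$ be the set of $(\sigma^1,\dots,\sigma^n)\in S_N^n$ with $|R(\sigma^j,\sigma^{j'})-q_{j,j'}|\le\varepsilon$ for all $j,j'\le n$. Let $k\ge1$ and $0=m_0<m_1<\dots<m_k=1$, and let $Q^l=(q^l_{j,j'})$,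 $0\le l\le k+1$, be symmetric real $n\times n$ matrices with $Q^0=0$ such that the matrices $\Delta_l=\big(\beta_j\beta_{j'}(\xi'(q^{l+1}_{j,j'})-\xi'(q^l_{j,j'}))\big)_{j,j'}$ are nonnegative definite for $0\le l\le k$. Let $z_{l,i}=(z^1_{l,i},\dots,z^n_{l,i})$, $0\le l\le k$, $i\le N$, be independent centered Gaussian vectors, independent of $H_N$, where $z_{l,i}$ has covariance $\Delta_l$. For $0\le t\le1$ let $$H_t(\sigma^1,\dots,\sigma^n)=\sqrt t\sum_{j\le n}\beta_jH_N(\sigma^j)+\sum_{j\le n}\sum_{i\le N}\sigma^j_i\Big(\sqrt{1-t}\sum_{0\le l\le k}z^j_{l,i}+h_j\Big),$$ $$X_{k+1,t}=\log\int_{Q_\varepsilon}\exp H_t\,d\lambda_N^n,\qquad X_{l,t}=\frac1{m_l}\log\mathbb E_l\exp\big(m_lX_{l+1,t}\big)\quad(1\le l\le k),$$ where $\mathbb E_l$ is the expectation in the variables $z_{p,i}$ with $p\ge l$, and let $\varphi(t)=\varphi_{N,\varepsilon}(t)=\frac1N\mathbb E X_{1,t}$. Define the remainder as follows. Let $W_l=\exp\big(m_l(X_{l+1,t}-X_{l,t})\big)$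 for $1\le l\le k$. For $\sigma\in Q_\varepsilon$ let $D_{k+1}(\sigma)=\exp H_t(\sigma)\big/\int_{Q_\varepsilon}\exp H_t\,d\lambda_N^n$ and $D_l(\sigma)=\mathbb E_l\big[W_lD_{l+1}(\sigma)\big]$ for $1\le l\le k$. For functions $f$ on $Q_\varepsilon\times Q_\varepsilon$ let $$\mu_l(f)=\mathbb E\Big[W_1\cdots W_{l-1}\int_{Q_\varepsilon}\int_{Q_\varepsilon}f(\sigma,\rho)\,D_l(\sigma)D_l(\rho)\,d\lambda_N^n(\rho)\,d\lambda_N^n(\sigma)\Big],$$ and, with $R^{j,j'}=R(\sigma^j,\rho^{j'})$, let $$R(t)=R_{N,\varepsilon}(t)=\frac12\sum_{1\le l\le k}(m_l-m_{l-1})\,\mu_l\Big(\sum_{j,j'\le n}\beta_j\beta_{j'}\big(\xi(R^{j,j'})-R^{j,j'}\xi'(q^l_{j,j'})+\theta(q^l_{j,j'})\big)\Big).$$ Then for all $\varepsilon>0$ and $N\ge n$ the function $\varphi$ is differentiable on $[0,1]$ (one-sidedly at the endpoints), and for all $t\in[0,1]$ we have $R(t)\ge0$ and $$\varphi'(t)=\frac12\sum_{j,j'\le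 n}\beta_j\beta_{j'}\big(\xi(q_{j,j'})-q_{j,j'}\xi'(q^{k+1}_{j,j'})+\theta(q^{k+1}_{j,j'})\big)-\frac12\sum_{1\le l\le k}m_l\sum_{j,j'\le n}\beta_j\beta_{j'}\big(\theta(q^{l+1}_{j,j'})-\theta(q^l_{j,j'})\big)-R(t)+\mathcal R,$$ where the error $\mathcal R=\mathcal R(\varepsilon,N,t)$ satisfies $\limsup_{\varepsilon\to0}\limsup_{N\to\infty}\sup_{0\le t\le1}|\mathcal R|=0$. -/

import Mathlib

open MeasureTheory ProbabilityTheory Filter Topology Set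
open scoped ENNReal

noncomputable section

/-- `θ(x) = x ξ'(x) - ξ(x)`. -/
def theta (ξ : ℝ → ℝ) (x : ℝ) : ℝ := x * deriv ξ x - ξ x

/-- The overlap `N⁻¹ ∑ i, σ i * τ i` of two configurations in `ℝ^N`. -/
def overlap {N : ℕ} (σ τ : EuclideanSpace ℝ (Fin N)) : ℝ := (1 / (N : ℝ)) * ∑ i, σ i * τ i

/-- The uniform probability measure on the sphere of radius `√N` in `ℝ^N`, as a measure on `ℝ^N`:
the image under `x ↦ √N • x` of the normalized surface measure of the unit sphere. -/
def uniformSphere (N : ℕ) : Measure (EuclideanSpace ℝ (Fin N)) :=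
  Measure.map
    (fun x : Metric.sphere (0 : EuclideanSpace ℝ (Fin N)) 1 =>
      Real.sqrt N • (x : EuclideanSpace ℝ (Fin N)))
    (((volume : Measure (EuclideanSpace ℝ (Fin N))).toSphere univ)⁻¹ •
      (volume : Measure (EuclideanSpace ℝ (Fin N))).toSphere)

/-- The product measure `λ_N^n` on `n`-tuples of configurations. -/
def uniformSpheres (n N : ℕ) : Measure (Fin n → EuclideanSpace ℝ (Fin N)) :=
  Measure.pi fun _ => uniformSphere N

/-- A quantity `r ε N t` that vanishes in the limit `N → ∞` followed by `ε → 0⁺`,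
uniformly in `t ∈ [0, 1]`:
`limsup_{ε → 0⁺} limsup_{N → ∞} sup_{0 ≤ t ≤ 1} |r ε N t| = 0`. -/
def IsVanishing (r : ℝ → ℕ → ℝ → ℝ) : Prop :=
  limsup (fun ε : ℝ => limsup (fun N : ℕ => ⨆ t ∈ Icc (0 : ℝ) 1, ENNReal.ofReal |r ε N t|) atTop)
    (𝓝[>] (0 : ℝ)) = 0

/-- The data of `n` coupled copies of a spherical model together with the parameters of a
`k`-step interpolation: the covariance function `ξ`, the Gaussian Hamiltonians `H N` on `ℝ^N`, the
inverse temperatures `β`, the external fields `h`, the overlap constraint `Q`, the numbers `m l`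
(`0 ≤ l ≤ k`) and the matrices `Qs l` (`0 ≤ l ≤ k + 1`). Values of `m` and `Qs` at larger indices
are not used. -/
structure CoupledSystem (n k : ℕ) (Ω : Type*) where
  ξ : ℝ → ℝ
  H : (N : ℕ) → EuclideanSpace ℝ (Fin N) → Ω → ℝ
  β : Fin n → ℝ
  h : Fin n → ℝ
  Q : Matrix (Fin n) (Fin n) ℝ
  m : ℕ → ℝ
  Qs : ℕ → Matrix (Fin n) (Fin n) ℝ

/-- The values of all the Gaussian vectors `z_{l,i} = (z_{l,i}^1, …, z_{l,i}^n)`,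
`0 ≤ l ≤ k`, `i ≤ N`; the coordinate `z_{l,i}^j` is `z l i j`. -/
abbrev Fields (n k N : ℕ) : Type := Fin (k + 1) → Fin N → EuclideanSpace ℝ (Fin n)

namespace CoupledSystem

variable {n k : ℕ} {Ω : Type*} (S : CoupledSystem n k Ω)

/-- The matrix with entries `β_j β_{j'} ξ'(q^l_{j,j'})`. -/
def Qhat (l : ℕ) : Matrix (Fin n) (Fin n) ℝ :=
  Matrix.of fun j j' => S.β j * S.β j' * deriv S.ξ (S.Qs l j j')

/-- The covariance matrix `Δ_l` of the vectors `z_{l,i}`. -/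
def Delta (l : ℕ) : Matrix (Fin n) (Fin n) ℝ := S.Qhat (l + 1) - S.Qhat l

/-- The joint law of the Gaussian vectors `z_{l,i}`: they are independent, and `z_{l,i}` is centered
with covariance `Δ_l`. -/
def fieldLaw (N : ℕ) : Measure (Fields n k N) :=
  Measure.pi fun l => Measure.pi fun _ => multivariateGaussian 0 (S.Delta l)

/-- The set `Q_ε` of `n`-tuples of configurations on the sphere with overlaps within `ε` of `Q`. -/
def constraintSet (N : ℕ) (ε : ℝ) : Set (Fin n → EuclideanSpace ℝ (Fin N)) :=
  {σ | (∀ j, σ j ∈ Metric.sphere (0 : EuclideanSpace ℝ (Fin N)) (Real.sqrt N)) ∧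
    ∀ j j', overlap (σ j) (σ j') ∈ Icc (S.Q j j' - ε) (S.Q j j' + ε)}

/-- The interpolating Hamiltonian `H_t`. -/
def hamiltonian (N : ℕ) (t : ℝ) (ω : Ω) (z : Fields n k N)
    (σ : Fin n → EuclideanSpace ℝ (Fin N)) : ℝ :=
  Real.sqrt t * ∑ j, S.β j * S.H N (σ j) ω +
    ∑ j, ∑ i, σ j i * (Real.sqrt (1 - t) * ∑ l, z l i j + S.h j)

/-- The expectation `E_l` in the `z_{p,i}` with `p ≥ l`, those with `p < l` being kept fixed. -/
def expect (N l : ℕ) (f : Fields n k N → ℝ) (z : Fields n k N) : ℝ :=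
  ∫ z', f (fun p => if (p : ℕ) < l then z p else z' p) ∂(S.fieldLaw N)

/-- `X_{l,t}(Q_ε)`: it is `log ∫_{Q_ε} exp H_t dλ_N^n` for `l = k + 1`, and
`m_l⁻¹ log E_l exp (m_l X_{l+1,t})` for `1 ≤ l ≤ k`. -/
def X (N : ℕ) (ε t : ℝ) (l : ℕ) (ω : Ω) (z : Fields n k N) : ℝ :=
  if l ≤ k then
    (1 / S.m l) *
      Real.log (S.expect N l (fun z' => Real.exp (S.m l * X N ε t (l + 1) ω z')) z)
  else
    Real.log (∫ σ in S.constraintSet N ε, Real.exp (S.hamiltonian N t ω z σ) ∂(uniformSpheres n N))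
termination_by k + 1 - l

/-- The constrained interpolated free energy `φ(t) = N⁻¹ E X_{1,t}(Q_ε)`. -/
def phi [MeasurableSpace Ω] (P : Measure Ω) (N : ℕ) (ε t : ℝ) : ℝ :=
  (1 / (N : ℝ)) * ∫ p, S.X N ε t 1 p.1 p.2 ∂(P.prod (S.fieldLaw N))

/-- `W_l = exp (m_l (X_{l+1,t} - X_{l,t}))`, the density of the change of measure made at level
`l`; it satisfies `E_l W_l = 1`. -/
def W (N : ℕ) (ε t : ℝ) (l : ℕ) (ω : Ω) (z : Fields n k N) : ℝ :=
  Real.exp (S.m l * (S.X N ε t (l + 1) ω z - S.X N ε t l ω z))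

/-- The density with respect to `λ_N^n` on `Q_ε` of the random measure obtained by averaging the
Gibbs measure over the levels `≥ l`: it is the Gibbs density
`exp H_t / ∫_{Q_ε} exp H_t dλ_N^n` for `l = k + 1`, and `D_l = E_l (W_l D_{l+1})` for
`1 ≤ l ≤ k`. -/
def D (N : ℕ) (ε t : ℝ) (σ : Fin n → EuclideanSpace ℝ (Fin N)) (l : ℕ) (ω : Ω)
    (z : Fields n k N) : ℝ :=
  if l ≤ k then
    S.expect N l (fun z' => S.W N ε t l ω z' * D N ε t σ (l + 1) ω z') z
  else
    Real.exp (S.hamiltonian N t ω z σ) /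
      ∫ τ in S.constraintSet N ε, Real.exp (S.hamiltonian N t ω z τ) ∂(uniformSpheres n N)
termination_by k + 1 - l

/-- The average of a function of two systems `(σ, ρ)` of `n` configurations in `Q_ε`, drawn
independently with density `D_l`: both systems share the randomness below level `l`, which has the
density `W_1 ⋯ W_{l-1}`, and are independent above it. -/
def pairAverage [MeasurableSpace Ω] (P : Measure Ω) (N : ℕ) (ε t : ℝ) (l : ℕ)
    (f : (Fin n → EuclideanSpace ℝ (Fin N)) → (Fin n → EuclideanSpace ℝ (Fin N)) → ℝ) : ℝ :=
  ∫ p, (∏ i ∈ Finset.Ico 1 l, S.W N ε t i p.1 p.2) *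
      ∫ σ in S.constraintSet N ε, (∫ ρ in S.constraintSet N ε,
        f σ ρ * S.D N ε t σ l p.1 p.2 * S.D N ε t ρ l p.1 p.2
          ∂(uniformSpheres n N)) ∂(uniformSpheres n N)
    ∂(P.prod (S.fieldLaw N))

/-- The remainder `R(t)`: half the sum over `1 ≤ l ≤ k` of `(m_l - m_{l-1})` times the level-`l`
average of `∑_{j,j'} β_j β_{j'} (ξ(R^{j,j'}) - R^{j,j'} ξ'(q^l_{j,j'}) + θ(q^l_{j,j'}))`, where
`R^{j,j'}` is the overlap of `σ^j` and `ρ^{j'}`. -/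
def remainder [MeasurableSpace Ω] (P : Measure Ω) (N : ℕ) (ε t : ℝ) : ℝ :=
  (1 / 2) * ∑ l ∈ Finset.Icc 1 k, (S.m l - S.m (l - 1)) *
    S.pairAverage P N ε t l fun σ ρ => ∑ j, ∑ j', S.β j * S.β j' *
      (S.ξ (overlap (σ j) (ρ j')) - overlap (σ j) (ρ j') * deriv S.ξ (S.Qs l j j') +
        theta S.ξ (S.Qs l j j'))

end CoupledSystem

end

set_option linter.unusedSectionVars false

/-! The derivative comes from Gaussian interpolation carried through the recursion. Write `Y` for
the Hamiltonian `H_t`. Unrolling the definitions of `W` and `D` and summing by parts with `m 0 = 0`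
and `m k = 1` gives (`prodW_mul_D_top`) W_1 ⋯ W_k D_{k+1}(σ) = exp (Y(σ) - ∑_{1 ≤ l ≤ k} (m_l -
m_{l-1}) X_l). The derivative of `E X_1` is the integral of `∂_t Y(σ)` against this density
(`hasDerivAt_X`, `integral_fieldAvg`). Since `∂_t Y(σ)` is a Gaussian variable, integration by parts
(`integral_dual_mul_of_isGaussian`) trades it for the derivative of the density along the covariance
of `∂_t Y(σ)`. Let the kernel of level `l` be the covariance of the energy minus the covariance of
the fields of level below `l`. The term `Y(σ)` contributes half the kernel of level `k + 1` at `(σ,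
σ)`. The term `X_l` depends only on the fields below level `l`, and contributes half the
`D_l`-average over `ρ` of the kernel of level `l` at `(σ, ρ)`. By consistency of the densities
(`integral_pairDensity_eq`), `σ` may then be drawn with `D_l` as well. The factors `√t` and `√(1 -
t)` cancel against their derivatives (`shift_integral`), so the resulting expression `pathDeriv` is
not singular at the endpoints.

For the coupled system the covariances `Δ_p` telescope, and `ξ'(0) = 0` because `ξ` is even. Hence
the kernel of level `l`, divided by `N`, is within a multiple of `c N` of the weighted sum of `ξ(R)
- R ξ'(q^l)` (`abs_kernel_sub_le`). On the diagonal the constraint keeps `R` within `ε` of `Q`,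
which yields the terms of the main expression containing `Q`. In the pair averages `θ(q^l)` is added
and subtracted. With the added part they form the remainder, nonnegative because a convex function
lies above its tangents (`ConvexOn.zero_le_sub_add_theta`). The subtracted part becomes, by Abel
summation, the `θ` terms of the main expression.

The analytic difficulty is that the energy is only a jointly measurable process over a continuum of
configurations. If only finitely many energies occur, the process consists of linear forms on a
finite-dimensional Gaussian space, and the computation above applies (`hasDerivAt_pathEnergy_form`,
`hasDerivAt_pathEnergy_simple`). In general, the map sending a configuration to its energy in `L²`
is strongly measurable, so its range is separable, and simple maps `r_j` exist for which the energy
of `r_j(σ)` tends in `L²` to that of `σ` (`exists_simpleFunc_tendsto_integral_sq`). The free energy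
and `pathDeriv` both converge along a subsequence (`tendsto_path`): all estimates depend on the
Hamiltonian only through its rate of variation in the fields, which is the same for all `t` and all
processes, and through the partition function at zero fields. The limit is taken in the integrated
identity. As `pathDeriv` is continuous on `[0, 1]`, the fundamental theorem of calculus gives the
derivative back, endpoints included (`hasDerivWithinAt_pathEnergy`). -/

noncomputable section

/-! ### The abstract recursion: dependence on the levels, measurability, tower property. -/

section

/-- The measures and the parameters of a multi-level recursion of exponential averages: the measure
`ν` on configurations, the laws `γ p` of the fields of level `p ≤ k`, and the numbers `m l`. -/
structure Cascade (k : ℕ) (E T : Type*) [MeasurableSpace E] [MeasurableSpace T] where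
  ν : Measure T
  γ : Fin (k + 1) → Measure E
  m : ℕ → ℝ

namespace Cascade

variable {k : ℕ} {E T A : Type*}

/-- The family that agrees with `z` below level `l` and with `z'` from level `l` on. -/
def merge (l : ℕ) (z z' : Fin (k + 1) → E) : Fin (k + 1) → E :=
  fun p => if (p : ℕ) < l then z p else z' p

lemma merge_merge_of_le {l j : ℕ} (h : l ≤ j) (z z' z'' : Fin (k + 1) → E) :
    merge l (merge j z z') z'' = merge l z z'' := by
  ext p
  simp only [merge]
  split_ifs <;> first | rfl | omega

lemma merge_eq_left {l : ℕ} (h : k + 1 ≤ l) (z z' : Fin (k + 1) → E) : merge l z z' = z := by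
  ext p
  simp [merge, p.2.trans_le h]

lemma norm_merge_le [SeminormedAddCommGroup E] (l : ℕ) (z z' : Fin (k + 1) → E) :
    ‖merge l z z'‖ ≤ ‖z‖ + ‖z'‖ := by
  refine (pi_norm_le_iff_of_nonneg (by positivity)).2 fun p => ?_
  simp only [merge]
  split_ifs
  · exact (norm_le_pi_norm z p).trans (by linarith [norm_nonneg z'])
  · exact (norm_le_pi_norm z' p).trans (by linarith [norm_nonneg z])

lemma measurable_merge [MeasurableSpace E] (l : ℕ) :
    Measurable fun q : (Fin (k + 1) → E) × (Fin (k + 1) → E) => merge l q.1 q.2 := by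
  refine measurable_pi_lambda _ fun p => ?_
  simp only [merge]
  split_ifs
  · exact (measurable_pi_apply p).comp measurable_fst
  · exact (measurable_pi_apply p).comp measurable_snd

variable [MeasurableSpace E] [MeasurableSpace T] [MeasurableSpace A]

lemma measurable_integral_snd {B : Type*} [MeasurableSpace B] {μ : Measure B} [SFinite μ]
    {f : A → B → ℝ} (hf : Measurable fun q : A × B => f q.1 q.2) :
    Measurable fun a => ∫ b, f a b ∂μ :=
  (StronglyMeasurable.integral_prod_right' (f := fun q : A × B => f q.1 q.2)
    hf.stronglyMeasurable).measurable

variable (K : Cascade k E T)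

/-- The joint law of the fields. -/
def law : Measure (Fin (k + 1) → E) := Measure.pi K.γ

/-- The expectation in the fields of level at least `l`. -/
def levelExp (l : ℕ) (f : (Fin (k + 1) → E) → ℝ) (z : Fin (k + 1) → E) : ℝ :=
  ∫ z', f (merge l z z') ∂K.law

/-- The recursion of exponential averages started at `log ∫ exp Y dν`. -/
def X (Y : T → (Fin (k + 1) → E) → ℝ) (l : ℕ) (z : Fin (k + 1) → E) : ℝ :=
  if l ≤ k then
    (1 / K.m l) * Real.log (K.levelExp l (fun z' => Real.exp (K.m l * X Y (l + 1) z')) z)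
  else
    Real.log (∫ σ, Real.exp (Y σ z) ∂K.ν)
termination_by k + 1 - l

/-- The density of the change of measure made at level `l`. -/
def W (Y : T → (Fin (k + 1) → E) → ℝ) (l : ℕ) (z : Fin (k + 1) → E) : ℝ :=
  Real.exp (K.m l * (K.X Y (l + 1) z - K.X Y l z))

/-- The Gibbs density averaged over the levels `≥ l`. -/
def D (Y : T → (Fin (k + 1) → E) → ℝ) (σ : T) (l : ℕ) (z : Fin (k + 1) → E) : ℝ :=
  if l ≤ k then
    K.levelExp l (fun z' => K.W Y l z' * D Y σ (l + 1) z') z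
  else
    Real.exp (Y σ z) / ∫ τ, Real.exp (Y τ z) ∂K.ν
termination_by k + 1 - l

/-- The product of the changes of measure made below level `l`. -/
def prodW (Y : T → (Fin (k + 1) → E) → ℝ) (l : ℕ) (z : Fin (k + 1) → E) : ℝ :=
  ∏ i ∈ Finset.Ico 1 l, K.W Y i z

/-- The Gibbs average, averaged over the levels `≥ l`, of a function of a configuration. -/
def avg (Y : T → (Fin (k + 1) → E) → ℝ) (l : ℕ) (u : T → ℝ) (z : Fin (k + 1) → E) : ℝ :=
  ∫ σ, u σ * K.D Y σ l z ∂K.ν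

variable {K} {Y : T → (Fin (k + 1) → E) → ℝ}

lemma X_of_le {l : ℕ} (h : l ≤ k) (z : Fin (k + 1) → E) :
    K.X Y l z =
      (1 / K.m l) * Real.log (K.levelExp l (fun z' => Real.exp (K.m l * K.X Y (l + 1) z')) z) := by
  rw [X, if_pos h]

lemma X_top {l : ℕ} (h : k < l) (z : Fin (k + 1) → E) :
    K.X Y l z = Real.log (∫ σ, Real.exp (Y σ z) ∂K.ν) := by
  rw [X, if_neg (not_le.2 h)]

lemma D_of_le {l : ℕ} (h : l ≤ k) (σ : T) (z : Fin (k + 1) → E) :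
    K.D Y σ l z = K.levelExp l (fun z' => K.W Y l z' * K.D Y σ (l + 1) z') z := by
  rw [D, if_pos h]

lemma D_top {l : ℕ} (h : k < l) (σ : T) (z : Fin (k + 1) → E) :
    K.D Y σ l z = Real.exp (Y σ z) / ∫ τ, Real.exp (Y τ z) ∂K.ν := by
  rw [D, if_neg (not_le.2 h)]

lemma levelExp_merge {l j : ℕ} (h : l ≤ j) (f : (Fin (k + 1) → E) → ℝ) (z z' : Fin (k + 1) → E) :
    K.levelExp l f (merge j z z') = K.levelExp l f z := by
  simp only [levelExp, merge_merge_of_le h]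

/-- The fields of level at least `l` have been integrated out, so only those below `l` remain; above
the top level nothing is replaced. Translations of the fields can be cut off at level `l` for this
reason. -/
lemma X_merge {l j : ℕ} (h : l ≤ j) (z z' : Fin (k + 1) → E) :
    K.X Y l (merge j z z') = K.X Y l z := by
  rcases le_or_gt l k with hl | hl
  · rw [X_of_le hl, X_of_le hl, levelExp_merge h]
  · rw [merge_eq_left (by omega)]

lemma D_merge {l j : ℕ} (h : l ≤ j) (σ : T) (z z' : Fin (k + 1) → E) :
    K.D Y σ l (merge j z z') = K.D Y σ l z := by
  rcases le_or_gt l k with hl | hl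
  · rw [D_of_le hl, D_of_le hl, levelExp_merge h]
  · rw [merge_eq_left (by omega)]

/-- The inequality is strict because `W` at level `l` contains `X` at level `l + 1`, which still
sees the field of level `l`. -/
lemma W_merge {l j : ℕ} (h : l < j) (z z' : Fin (k + 1) → E) :
    K.W Y l (merge j z z') = K.W Y l z := by
  simp only [W, X_merge h, X_merge h.le]

lemma prodW_merge {l j : ℕ} (h : l ≤ j) (z z' : Fin (k + 1) → E) :
    K.prodW Y l (merge j z z') = K.prodW Y l z := by
  refine Finset.prod_congr rfl fun i hi => W_merge ?_ z z'
  have := Finset.mem_Ico.1 hi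
  omega

lemma avg_merge {l j : ℕ} (h : l ≤ j) (u : T → ℝ) (z z' : Fin (k + 1) → E) :
    K.avg Y l u (merge j z z') = K.avg Y l u z := by
  simp only [avg, D_merge h]

lemma prodW_succ {l : ℕ} (h : 1 ≤ l) (z : Fin (k + 1) → E) :
    K.prodW Y (l + 1) z = K.prodW Y l z * K.W Y l z :=
  Finset.prod_Ico_succ_top h _

lemma W_pos (l : ℕ) (z : Fin (k + 1) → E) : 0 < K.W Y l z := Real.exp_pos _

lemma prodW_pos (l : ℕ) (z : Fin (k + 1) → E) : 0 < K.prodW Y l z :=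
  Finset.prod_pos fun _ _ => W_pos _ _

/-- Induction from the top level down. -/
lemma level_induction {p : ℕ → Prop} (top : ∀ l, k < l → p l)
    (step : ∀ l, 1 ≤ l → l ≤ k → p (l + 1) → p l) (l : ℕ) (hl : 1 ≤ l) : p l := by
  suffices ∀ d l, 1 ≤ l → k + 1 - l ≤ d → p l from this _ l hl le_rfl
  intro d
  induction d with
  | zero => exact fun l _ h => top l (by omega)
  | succ d ih =>
    intro l h1 h
    rcases le_or_gt l k with hk | hk
    · exact step l h1 hk (ih (l + 1) (by omega) (by omega))
    · exact top l hk

lemma D_nonneg (σ : T) (l : ℕ) (hl : 1 ≤ l) (z : Fin (k + 1) → E) : 0 ≤ K.D Y σ l z := by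
  revert z
  refine level_induction (k := k) (p := fun l => ∀ z, 0 ≤ K.D Y σ l z) ?_ ?_ l hl
  · intro l h z
    rw [D_top h]
    exact div_nonneg (Real.exp_pos _).le (integral_nonneg fun _ => (Real.exp_pos _).le)
  · intro l _ h ih z
    rw [D_of_le h]
    exact integral_nonneg fun z' => mul_nonneg (W_pos _ _).le (ih _)

section Measurability

variable {Y : A → T → (Fin (k + 1) → E) → ℝ}

lemma measurable_levelExp [SFinite K.law] (l : ℕ) {f : A → (Fin (k + 1) → E) → ℝ}
    (hf : Measurable fun q : A × (Fin (k + 1) → E) => f q.1 q.2) :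
    Measurable fun q : A × (Fin (k + 1) → E) => K.levelExp l (f q.1) q.2 :=
  measurable_integral_snd (f := fun (q : A × (Fin (k + 1) → E)) z' => f q.1 (merge l q.2 z'))
    (hf.comp (measurable_fst.fst.prodMk
      ((measurable_merge l).comp (measurable_fst.snd.prodMk measurable_snd))))

lemma measurable_X [SFinite K.law] [SFinite K.ν]
    (hY : Measurable fun q : A × T × (Fin (k + 1) → E) => Y q.1 q.2.1 q.2.2)
    (l : ℕ) (hl : 1 ≤ l) :
    Measurable fun q : A × (Fin (k + 1) → E) => K.X (Y q.1) l q.2 := by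
  refine level_induction (k := k)
    (p := fun l => Measurable fun q : A × (Fin (k + 1) → E) => K.X (Y q.1) l q.2) ?_ ?_ l hl
  · intro l h
    simp only [X_top h]
    refine Real.measurable_log.comp (measurable_integral_snd
      (f := fun (q : A × (Fin (k + 1) → E)) σ => Real.exp (Y q.1 σ q.2)) ?_)
    exact Real.measurable_exp.comp (hY.comp
      (measurable_fst.fst.prodMk (measurable_snd.prodMk measurable_fst.snd)))
  · intro l _ h ih
    simp only [X_of_le h]
    exact (Real.measurable_log.comp (measurable_levelExp l
      (f := fun a z => Real.exp (K.m l * K.X (Y a) (l + 1) z)) (Real.measurable_exp.comp (ih.const_mul _)))).const_mul _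

lemma measurable_W [SFinite K.law] [SFinite K.ν]
    (hY : Measurable fun q : A × T × (Fin (k + 1) → E) => Y q.1 q.2.1 q.2.2)
    (l : ℕ) (hl : 1 ≤ l) :
    Measurable fun q : A × (Fin (k + 1) → E) => K.W (Y q.1) l q.2 :=
  Real.measurable_exp.comp
    (((measurable_X hY (l + 1) (by omega)).sub (measurable_X hY l hl)).const_mul _)

lemma measurable_prodW [SFinite K.law] [SFinite K.ν]
    (hY : Measurable fun q : A × T × (Fin (k + 1) → E) => Y q.1 q.2.1 q.2.2) (l : ℕ) :
    Measurable fun q : A × (Fin (k + 1) → E) => K.prodW (Y q.1) l q.2 :=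
  Finset.measurable_prod _ fun i hi => measurable_W hY i (Finset.mem_Ico.1 hi).1

lemma measurable_D [SFinite K.law] [SFinite K.ν]
    (hY : Measurable fun q : A × T × (Fin (k + 1) → E) => Y q.1 q.2.1 q.2.2)
    (l : ℕ) (hl : 1 ≤ l) :
    Measurable fun q : (A × T) × (Fin (k + 1) → E) => K.D (Y q.1.1) q.1.2 l q.2 := by
  have hY' : Measurable fun q : (A × T) × (Fin (k + 1) → E) => Y q.1.1 q.1.2 q.2 :=
    hY.comp (measurable_fst.fst.prodMk (measurable_fst.snd.prodMk measurable_snd))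
  refine level_induction (k := k) (p := fun l => Measurable fun q : (A × T) × (Fin (k + 1) → E) =>
    K.D (Y q.1.1) q.1.2 l q.2) ?_ ?_ l hl
  · intro l h
    simp only [D_top h]
    refine (Real.measurable_exp.comp hY').div (measurable_integral_snd
      (f := fun (q : (A × T) × (Fin (k + 1) → E)) σ => Real.exp (Y q.1.1 σ q.2)) ?_)
    exact Real.measurable_exp.comp (hY.comp
      (measurable_fst.fst.fst.prodMk (measurable_snd.prodMk measurable_fst.snd)))
  · intro l h1 h ih
    simp only [D_of_le h]
    refine measurable_levelExp (A := A × T) l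
      (f := fun a z => K.W (Y a.1) l z * K.D (Y a.1) a.2 (l + 1) z) (Measurable.mul ?_ ih)
    exact (measurable_W hY l h1).comp (measurable_fst.fst.prodMk measurable_snd)

lemma measurable_avg [SFinite K.law] [SFinite K.ν]
    (hY : Measurable fun q : A × T × (Fin (k + 1) → E) => Y q.1 q.2.1 q.2.2)
    (l : ℕ) (hl : 1 ≤ l) {u : A → T → ℝ} (hu : Measurable fun q : A × T => u q.1 q.2) :
    Measurable fun q : A × (Fin (k + 1) → E) => K.avg (Y q.1) l (u q.1) q.2 := by
  refine measurable_integral_snd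
    (f := fun (q : A × (Fin (k + 1) → E)) σ => u q.1 σ * K.D (Y q.1) σ l q.2) (Measurable.mul ?_ ?_)
  · exact hu.comp (measurable_fst.fst.prodMk measurable_snd)
  · exact (measurable_D hY l hl).comp
      ((measurable_fst.fst.prodMk measurable_snd).prodMk measurable_fst.snd)

end Measurability

instance [∀ p, IsProbabilityMeasure (K.γ p)] : IsProbabilityMeasure K.law := by
  unfold law; infer_instance

/-- Recombining coordinates of two independent copies of a product law gives that law again. On
boxes this is visible: the preimage is a product of two boxes, and each coordinate is constrained in
exactly one of them. -/
lemma measurePreserving_merge [∀ p, IsProbabilityMeasure (K.γ p)] (l : ℕ) :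
    MeasurePreserving (fun q : (Fin (k + 1) → E) × (Fin (k + 1) → E) => merge l q.1 q.2)
      (K.law.prod K.law) K.law := by
  refine ⟨measurable_merge l, (Measure.pi_eq fun s hs => ?_).symm⟩
  rw [Measure.map_apply (measurable_merge l) (MeasurableSet.univ_pi hs)]
  have : (fun q : (Fin (k + 1) → E) × (Fin (k + 1) → E) => merge l q.1 q.2) ⁻¹' Set.pi univ s =
      (Set.pi univ fun p : Fin (k + 1) => if (p : ℕ) < l then s p else univ) ×ˢ
        (Set.pi univ fun p : Fin (k + 1) => if (p : ℕ) < l then univ else s p) := by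
    ext q
    simp only [merge, mem_preimage, Set.mem_pi, mem_univ, true_implies, mem_prod]
    constructor
    · intro h
      refine ⟨fun p => ?_, fun p => ?_⟩ <;> have := h p <;> split_ifs at * <;> simp_all
    · rintro ⟨h1, h2⟩ p
      have := h1 p
      have := h2 p
      split_ifs at * <;> simp_all
  rw [this, Measure.prod_prod, law, Measure.pi_pi, Measure.pi_pi, ← Finset.prod_mul_distrib]
  refine Finset.prod_congr rfl fun p _ => ?_
  split_ifs <;> simp

/-- The tower property, by Fubini and the invariance of the law under merging. -/
lemma integral_levelExp [∀ p, IsProbabilityMeasure (K.γ p)] (l : ℕ) {f : (Fin (k + 1) → E) → ℝ}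
    (hf : Integrable f K.law) : ∫ z, K.levelExp l f z ∂K.law = ∫ z, f z ∂K.law := by
  have hm := measurePreserving_merge (K := K) l
  have hi : Integrable (fun q : (Fin (k + 1) → E) × (Fin (k + 1) → E) => f (merge l q.1 q.2))
      (K.law.prod K.law) := (hm.integrable_comp hf.aestronglyMeasurable).2 hf
  calc ∫ z, K.levelExp l f z ∂K.law = ∫ q, f (merge l q.1 q.2) ∂(K.law.prod K.law) :=
        (integral_prod _ hi).symm
    _ = ∫ z, f z ∂((K.law.prod K.law).map fun q => merge l q.1 q.2) :=
        (integral_map hm.measurable.aemeasurable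
          (by rw [hm.map_eq]; exact hf.aestronglyMeasurable)).symm
    _ = ∫ z, f z ∂K.law := by rw [hm.map_eq]

end Cascade

end

/-! ### Growth estimates that are uniform over Hamiltonians with a given rate of variation. -/

section

lemma abs_integral_le_of_forall_abs_le {α : Type*} [MeasurableSpace α] {μ : Measure α} {f g : α → ℝ}
    (hg : Integrable g μ) (h : ∀ x, |f x| ≤ g x) : |∫ x, f x ∂μ| ≤ ∫ x, g x ∂μ := by
  rw [← Real.norm_eq_abs]
  exact norm_integral_le_of_norm_le hg (ae_of_all _ h)

namespace Cascade

variable {k : ℕ} {E T : Type*} [NormedAddCommGroup E] [MeasurableSpace E] [BorelSpace E]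
  [SecondCountableTopology E] [MeasurableSpace T]

/-- The fields have exponential moments of all orders, and `m l > 0` for `1 ≤ l ≤ k`. -/
structure Regular (K : Cascade k E T) : Prop where
  exp_int : ∀ c : ℝ, Integrable (fun z => Real.exp (c * ‖z‖)) K.law
  m_pos : ∀ l, 1 ≤ l → l ≤ k → 0 < K.m l

/-- The Hamiltonian `Y` is measurable, has a finite partition function at the origin, and varies
with the fields at a linear rate `C`, uniformly in the configuration. -/
structure Nice (K : Cascade k E T) (C : ℝ) (Y : T → (Fin (k + 1) → E) → ℝ) : Prop where
  meas : Measurable fun q : T × (Fin (k + 1) → E) => Y q.1 q.2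
  int : Integrable (fun σ => Real.exp (Y σ 0)) K.ν
  bound : ∀ σ z, |Y σ z - Y σ 0| ≤ C * ‖z‖

/-- Measurable functions of the fields of at most exponential growth. -/
def ExpBdd (f : (Fin (k + 1) → E) → ℝ) : Prop :=
  Measurable f ∧ ∃ C, 0 ≤ C ∧ ∀ z, |f z| ≤ Real.exp (C * (1 + ‖z‖))

lemma ExpBdd.mul {f g : (Fin (k + 1) → E) → ℝ} (hf : ExpBdd f) (hg : ExpBdd g) :
    ExpBdd fun z => f z * g z := by
  obtain ⟨hf, C, hC, hfC⟩ := hf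
  obtain ⟨hg, C', hC', hgC⟩ := hg
  refine ⟨hf.mul hg, C + C', by positivity, fun z => ?_⟩
  rw [abs_mul, add_mul, Real.exp_add]
  exact mul_le_mul (hfC z) (hgC z) (abs_nonneg _) (Real.exp_pos _).le

lemma ExpBdd.of_bounded {f : (Fin (k + 1) → E) → ℝ} (hf : Measurable f) {B : ℝ}
    (hB : ∀ z, |f z| ≤ B) : ExpBdd f := by
  have h0 : 0 ≤ B := (abs_nonneg _).trans (hB 0)
  refine ⟨hf, B, h0, fun z => (hB z).trans ?_⟩
  have := Real.add_one_le_exp (B * (1 + ‖z‖))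
  nlinarith [mul_nonneg h0 (norm_nonneg z)]

lemma exp_norm_merge_le {C : ℝ} (hC : 0 ≤ C) (l : ℕ) (z z' : Fin (k + 1) → E) :
    Real.exp (C * (1 + ‖merge l z z'‖)) ≤ Real.exp (C * (1 + ‖z‖)) * Real.exp (C * ‖z'‖) := by
  rw [← Real.exp_add, ← mul_add]
  exact Real.exp_le_exp.2 (mul_le_mul_of_nonneg_left (by linarith [norm_merge_le l z z']) hC)

lemma measurable_merge_left (l : ℕ) (z : Fin (k + 1) → E) :
    Measurable fun z' : Fin (k + 1) → E => merge l z z' :=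
  (measurable_merge l).comp measurable_prodMk_left

variable {K : Cascade k E T} {Y : T → (Fin (k + 1) → E) → ℝ}

namespace Regular

variable (hK : K.Regular)

include hK

lemma integrable_exp_one_add (C : ℝ) :
    Integrable (fun z : Fin (k + 1) → E => Real.exp (C * (1 + ‖z‖))) K.law := by
  simp only [mul_add, Real.exp_add]
  exact (hK.exp_int C).const_mul _

lemma integrable {f : (Fin (k + 1) → E) → ℝ} (hf : ExpBdd f) : Integrable f K.law := by
  obtain ⟨hf, C, hC, hfC⟩ := hf
  exact (hK.integrable_exp_one_add C).mono' hf.aestronglyMeasurable (ae_of_all _ hfC)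

lemma integrable_merge {f : (Fin (k + 1) → E) → ℝ} (hf : ExpBdd f) (l : ℕ)
    (z : Fin (k + 1) → E) : Integrable (fun z' => f (merge l z z')) K.law := by
  obtain ⟨hf, C, hC, hfC⟩ := hf
  refine ((hK.exp_int C).const_mul (Real.exp (C * (1 + ‖z‖)))).mono'
    (hf.comp (measurable_merge_left l z)).aestronglyMeasurable (ae_of_all _ fun z' => ?_)
  exact (hfC _).trans (exp_norm_merge_le hC l z z')

lemma integral_exp_pos [IsProbabilityMeasure K.law] (C : ℝ) :
    0 < ∫ z, Real.exp (C * ‖z‖) ∂K.law :=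
  _root_.MeasureTheory.integral_exp_pos (hK.exp_int C)

lemma one_le_integral_exp [IsProbabilityMeasure K.law] {C : ℝ} (hC : 0 ≤ C) :
    1 ≤ ∫ z, Real.exp (C * ‖z‖) ∂K.law := by
  have : ∫ _, (1 : ℝ) ∂K.law ≤ ∫ z, Real.exp (C * ‖z‖) ∂K.law :=
    integral_mono (integrable_const _) (hK.exp_int C) fun z => Real.one_le_exp (by positivity)
  simpa using this

/-- The norm of a merged family is at most the sum of the two norms, so the integrated copy
contributes only an exponential moment. That moment is at least `1`, so it can be absorbed in the
exponent through its nonnegative logarithm. -/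
lemma abs_levelExp_le [IsProbabilityMeasure K.law] {C B : ℝ} (hC : 0 ≤ C) (hB : 0 ≤ B)
    {f : (Fin (k + 1) → E) → ℝ}
    (hf : ∀ z, |f z| ≤ B * Real.exp (C * (1 + ‖z‖))) (l : ℕ) (z : Fin (k + 1) → E) :
    |K.levelExp l f z| ≤
      B * Real.exp ((C + Real.log (∫ z, Real.exp (C * ‖z‖) ∂K.law)) * (1 + ‖z‖)) := by
  have h1 := hK.one_le_integral_exp hC
  set M := ∫ z, Real.exp (C * ‖z‖) ∂K.law
  calc |K.levelExp l f z| ≤ ∫ z', B * (Real.exp (C * (1 + ‖z‖)) * Real.exp (C * ‖z'‖)) ∂K.law := by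
        refine abs_integral_le_of_forall_abs_le (((hK.exp_int C).const_mul _).const_mul _)
          fun z' => (hf (merge l z z')).trans ?_
        exact mul_le_mul_of_nonneg_left (exp_norm_merge_le hC l z z') hB
    _ = B * (Real.exp (C * (1 + ‖z‖)) * M) := by rw [integral_const_mul, integral_const_mul]
    _ ≤ _ := by
        refine mul_le_mul_of_nonneg_left ?_ hB
        rw [add_mul, Real.exp_add]
        refine mul_le_mul_of_nonneg_left ?_ (Real.exp_pos _).le
        calc M = Real.exp (Real.log M) := (Real.exp_log (by linarith)).symm
          _ ≤ _ := Real.exp_le_exp.2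
            (le_mul_of_one_le_right (Real.log_nonneg h1) (by linarith [norm_nonneg z]))

lemma expBdd_levelExp [IsProbabilityMeasure K.law] {f : (Fin (k + 1) → E) → ℝ} (hf : ExpBdd f)
    (l : ℕ) : ExpBdd (K.levelExp l f) := by
  obtain ⟨hm, C, hC, hfC⟩ := hf
  refine ⟨?_, C + Real.log (∫ z, Real.exp (C * ‖z‖) ∂K.law),
    add_nonneg hC (Real.log_nonneg (hK.one_le_integral_exp hC)), fun z => ?_⟩
  · exact (measurable_levelExp (A := Unit) l (f := fun _ => f) (hm.comp measurable_snd)).comp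
      (measurable_prodMk_left (x := ()))
  · simpa using hK.abs_levelExp_le hC zero_le_one (by simpa using hfC) l z

end Regular

section Top

variable {C : ℝ}

lemma Nice.integrable_exp (hY : K.Nice C Y) (z : Fin (k + 1) → E) :
    Integrable (fun σ => Real.exp (Y σ z)) K.ν := by
  refine (hY.int.const_mul (Real.exp (C * ‖z‖))).mono'
    (Real.measurable_exp.comp (hY.meas.comp measurable_prodMk_right)).aestronglyMeasurable
    (ae_of_all _ fun σ => ?_)
  rw [Real.norm_eq_abs, Real.abs_exp, ← Real.exp_add]
  exact Real.exp_le_exp.2 (by linarith [(abs_le.1 (hY.bound σ z)).2])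

variable [NeZero K.ν]

lemma Nice.integral_exp_pos (hY : K.Nice C Y) (z : Fin (k + 1) → E) :
    0 < ∫ σ, Real.exp (Y σ z) ∂K.ν :=
  _root_.MeasureTheory.integral_exp_pos (hY.integrable_exp z)

lemma Nice.exp_X_top (hY : K.Nice C Y) {l : ℕ} (hl : k < l) (z : Fin (k + 1) → E) :
    Real.exp (K.X Y l z) = ∫ σ, Real.exp (Y σ z) ∂K.ν := by
  rw [X_top hl, Real.exp_log (hY.integral_exp_pos z)]

lemma Nice.D_top_eq (hY : K.Nice C Y) {l : ℕ} (hl : k < l) (σ : T) (z : Fin (k + 1) → E) :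
    K.D Y σ l z = Real.exp (Y σ z - K.X Y l z) := by
  rw [D_top hl, Real.exp_sub, hY.exp_X_top hl]

/-- Changing the fields from `0` to `z` multiplies every Gibbs weight by a factor between `exp (-C
‖z‖)` and `exp (C ‖z‖)`, hence also the partition function. -/
lemma Nice.abs_X_top_sub_le (hY : K.Nice C Y) {l : ℕ} (hl : k < l) (z : Fin (k + 1) → E) :
    |K.X Y l z - K.X Y (k + 1) 0| ≤ C * ‖z‖ := by
  have h0 := hY.integral_exp_pos 0
  have hz := hY.integral_exp_pos z
  rw [X_top hl, X_top (Nat.lt_succ_self k)]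
  have key : ∀ z₁ z₂ : Fin (k + 1) → E, (∀ σ, Y σ z₁ ≤ C * ‖z‖ + Y σ z₂) →
      Real.log (∫ σ, Real.exp (Y σ z₁) ∂K.ν) ≤
        C * ‖z‖ + Real.log (∫ σ, Real.exp (Y σ z₂) ∂K.ν) := by
    intro z₁ z₂ h
    rw [Real.log_le_iff_le_exp (hY.integral_exp_pos z₁), Real.exp_add,
      Real.exp_log (hY.integral_exp_pos z₂), ← integral_const_mul]
    refine integral_mono (hY.integrable_exp z₁) ((hY.integrable_exp z₂).const_mul _) fun σ => ?_
    simp only [← Real.exp_add]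
    exact Real.exp_le_exp.2 (h σ)
  have h1 := key z 0 fun σ => by linarith [(abs_le.1 (hY.bound σ z)).2]
  have h2 := key 0 z fun σ => by linarith [(abs_le.1 (hY.bound σ z)).1]
  rw [abs_le]
  constructor <;> linarith

end Top

lemma measurable_X' [SFinite K.law] [SFinite K.ν]
    (hY : Measurable fun q : T × (Fin (k + 1) → E) => Y q.1 q.2)
    {l : ℕ} (hl : 1 ≤ l) : Measurable (K.X Y l) :=
  (measurable_X (A := Unit) (Y := fun _ => Y) (hY.comp measurable_snd) l hl).comp
    (measurable_prodMk_left (x := ()))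

lemma measurable_W' [SFinite K.law] [SFinite K.ν]
    (hY : Measurable fun q : T × (Fin (k + 1) → E) => Y q.1 q.2)
    {l : ℕ} (hl : 1 ≤ l) : Measurable (K.W Y l) :=
  (measurable_W (A := Unit) (Y := fun _ => Y) (hY.comp measurable_snd) l hl).comp
    (measurable_prodMk_left (x := ()))

lemma measurable_prodW' [SFinite K.law] [SFinite K.ν]
    (hY : Measurable fun q : T × (Fin (k + 1) → E) => Y q.1 q.2) (l : ℕ) :
    Measurable (K.prodW Y l) :=
  (measurable_prodW (A := Unit) (Y := fun _ => Y) (hY.comp measurable_snd) l).comp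
    (measurable_prodMk_left (x := ()))

lemma measurable_D' [SFinite K.law] [SFinite K.ν]
    (hY : Measurable fun q : T × (Fin (k + 1) → E) => Y q.1 q.2)
    {l : ℕ} (hl : 1 ≤ l) : Measurable fun q : T × (Fin (k + 1) → E) => K.D Y q.1 l q.2 :=
  (measurable_D (A := Unit) (Y := fun _ => Y) (hY.comp measurable_snd) l hl).comp
    ((measurable_const.prodMk measurable_fst).prodMk measurable_snd :
      Measurable fun q : T × (Fin (k + 1) → E) => (((), q.1), q.2))

lemma measurable_avg' [SFinite K.law] [SFinite K.ν]
    (hY : Measurable fun q : T × (Fin (k + 1) → E) => Y q.1 q.2)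
    {l : ℕ} (hl : 1 ≤ l) {u : T → ℝ} (hu : Measurable u) : Measurable (K.avg Y l u) :=
  (measurable_avg (A := Unit) (Y := fun _ => Y) (u := fun _ => u) (hY.comp measurable_snd) l hl
    (hu.comp measurable_snd)).comp (measurable_prodMk_left (x := ()))

section Bounds

variable [∀ p, IsProbabilityMeasure (K.γ p)] [NeZero K.ν] [IsFiniteMeasure K.ν]

/-- The recursion moves the value at the origin by at most a multiple of `1 + ‖z‖` that depends on
the Hamiltonian only through its rate of variation. -/
lemma Regular.exists_abs_X_sub_le (hK : K.Regular) {C : ℝ} (hC : 0 ≤ C) (l : ℕ) (hl : 1 ≤ l) :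
    ∃ C', 0 ≤ C' ∧ ∀ Y, K.Nice C Y → ∀ z, |K.X Y l z - K.X Y (k + 1) 0| ≤ C' * (1 + ‖z‖) := by
  refine level_induction (k := k) (p := fun l => ∃ C', 0 ≤ C' ∧
    ∀ Y, K.Nice C Y → ∀ z, |K.X Y l z - K.X Y (k + 1) 0| ≤ C' * (1 + ‖z‖)) ?_ ?_ l hl
  · exact fun l h => ⟨C, hC, fun Y hY z => (hY.abs_X_top_sub_le h z).trans (by nlinarith)⟩
  · rintro l h1 h ⟨C', hC', ih⟩
    have hm := hK.m_pos l h1 h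
    set m := K.m l
    set M₁ := ∫ z, Real.exp (m * C' * ‖z‖) ∂K.law with hM₁
    set M₂ := ∫ z, Real.exp (-(m * C') * ‖z‖) ∂K.law with hM₂
    have hM₁p : 0 < M₁ := hK.integral_exp_pos _
    have hM₂p : 0 < M₂ := hK.integral_exp_pos _
    -- The bounds at level `l + 1` are exponentiated with factor `m` and integrated: `M₁` and `M₂`
    -- are the moments left over in the upper and in the lower bound. Taking logarithms and dividing
    -- by `m` restores `C'` and leaves the logarithms of the moments divided by `m`.
    refine ⟨C' + (|Real.log M₁| + |Real.log M₂|) / m, by positivity, fun Y hY z => ?_⟩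
    set x₀ := K.X Y (k + 1) 0
    have hmeas := measurable_X' (K := K) hY.meas (l := l + 1) (by omega)
    have hup : ∀ z', Real.exp (m * K.X Y (l + 1) (merge l z z')) ≤
        Real.exp (m * (x₀ + C' * (1 + ‖z‖))) * Real.exp (m * C' * ‖z'‖) := by
      intro z'
      rw [← Real.exp_add]
      refine Real.exp_le_exp.2 ?_
      have := (abs_le.1 (ih Y hY (merge l z z'))).2
      have h2 := mul_le_mul_of_nonneg_left (norm_merge_le l z z') hC'
      nlinarith
    have hlo : ∀ z', Real.exp (m * (x₀ - C' * (1 + ‖z‖))) * Real.exp (-(m * C') * ‖z'‖) ≤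
        Real.exp (m * K.X Y (l + 1) (merge l z z')) := by
      intro z'
      rw [← Real.exp_add]
      refine Real.exp_le_exp.2 ?_
      have := (abs_le.1 (ih Y hY (merge l z z'))).1
      have h2 := mul_le_mul_of_nonneg_left (norm_merge_le l z z') hC'
      nlinarith
    have hint : Integrable (fun z' => Real.exp (m * K.X Y (l + 1) (merge l z z'))) K.law := by
      refine ((hK.exp_int (m * C')).const_mul
        (Real.exp (m * (x₀ + C' * (1 + ‖z‖))))).mono' (Real.measurable_exp.comp
        ((hmeas.comp (measurable_merge_left l z)).const_mul m)).aestronglyMeasurable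
        (ae_of_all _ fun z' => ?_)
      rw [Real.norm_eq_abs, Real.abs_exp]
      exact hup z'
    have hU : K.levelExp l (fun z' => Real.exp (m * K.X Y (l + 1) z')) z ≤
        Real.exp (m * (x₀ + C' * (1 + ‖z‖))) * M₁ := by
      rw [hM₁, ← integral_const_mul]
      exact integral_mono hint ((hK.exp_int _).const_mul _) hup
    have hL : Real.exp (m * (x₀ - C' * (1 + ‖z‖))) * M₂ ≤
        K.levelExp l (fun z' => Real.exp (m * K.X Y (l + 1) z')) z := by
      rw [hM₂, ← integral_const_mul]
      exact integral_mono ((hK.exp_int _).const_mul _) hint hlo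
    set V := K.levelExp l (fun z' => Real.exp (m * K.X Y (l + 1) z')) z with hV
    have hVpos : 0 < V := lt_of_lt_of_le (by positivity) hL
    have hX : K.X Y l z = Real.log V / m := by rw [X_of_le h]; ring
    have hU' : Real.log V ≤ m * (x₀ + C' * (1 + ‖z‖)) + Real.log M₁ := by
      have := Real.log_le_log hVpos hU
      rwa [Real.log_mul (Real.exp_pos _).ne' hM₁p.ne', Real.log_exp] at this
    have hL' : m * (x₀ - C' * (1 + ‖z‖)) + Real.log M₂ ≤ Real.log V := by
      have := Real.log_le_log (by positivity) hL
      rwa [Real.log_mul (Real.exp_pos _).ne' hM₂p.ne', Real.log_exp] at this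
    have e : (C' + (|Real.log M₁| + |Real.log M₂|) / m) * (1 + ‖z‖) =
        (m * C' * (1 + ‖z‖) + (|Real.log M₁| + |Real.log M₂|) * (1 + ‖z‖)) / m := by
      field_simp
    have e' : Real.log V / m - x₀ = (Real.log V - m * x₀) / m := by field_simp
    rw [hX, e, e', abs_div, abs_of_pos hm]
    refine div_le_div_of_nonneg_right ?_ hm.le
    have a1 := le_abs_self (Real.log M₁)
    have a2 := neg_abs_le (Real.log M₂)
    have b1 := mul_nonneg (abs_nonneg (Real.log M₁)) (norm_nonneg z)
    have b2 := mul_nonneg (abs_nonneg (Real.log M₂)) (norm_nonneg z)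
    rw [abs_le]
    constructor <;> nlinarith [abs_nonneg (Real.log M₁), abs_nonneg (Real.log M₂)]

/-- `X` at levels `l` and `l + 1` is compared with the same value at the origin, which cancels in
the difference. The constant therefore does not depend on the size of the Hamiltonian. -/
lemma Regular.exists_W_le (hK : K.Regular) {C : ℝ} (hC : 0 ≤ C) (l : ℕ) (hl : 1 ≤ l) :
    ∃ C', 0 ≤ C' ∧ ∀ Y, K.Nice C Y → ∀ z, K.W Y l z ≤ Real.exp (C' * (1 + ‖z‖)) := by
  obtain ⟨C₁, h₁, H₁⟩ := hK.exists_abs_X_sub_le hC l hl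
  obtain ⟨C₂, h₂, H₂⟩ := hK.exists_abs_X_sub_le hC (l + 1) (by omega)
  refine ⟨|K.m l| * (C₁ + C₂), by positivity, fun Y hY z => Real.exp_le_exp.2 ?_⟩
  have a := H₁ Y hY z
  have b := H₂ Y hY z
  calc K.m l * (K.X Y (l + 1) z - K.X Y l z)
      ≤ |K.m l| * |K.X Y (l + 1) z - K.X Y l z| := by rw [← abs_mul]; exact le_abs_self _
    _ ≤ |K.m l| * ((C₁ + C₂) * (1 + ‖z‖)) := by
        refine mul_le_mul_of_nonneg_left ?_ (abs_nonneg _)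
        rw [abs_le] at *
        constructor <;> linarith
    _ = _ := by ring

lemma Regular.exists_prodW_le (hK : K.Regular) {C : ℝ} (hC : 0 ≤ C) (l : ℕ) :
    ∃ C', 0 ≤ C' ∧ ∀ Y, K.Nice C Y → ∀ z, K.prodW Y l z ≤ Real.exp (C' * (1 + ‖z‖)) := by
  choose! c hc H using fun i (hi : 1 ≤ i) => hK.exists_W_le hC i hi
  refine ⟨∑ i ∈ Finset.Ico 1 l, c i,
    Finset.sum_nonneg fun i hi => hc i (Finset.mem_Ico.1 hi).1, fun Y hY z => ?_⟩
  rw [Finset.sum_mul, Real.exp_sum]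
  exact Finset.prod_le_prod (fun i _ => (W_pos i z).le)
    fun i hi => H i (Finset.mem_Ico.1 hi).1 Y hY z

/-- The bound separates configurations from fields. Its first factor is the Gibbs density at zero
fields, integrable in `σ`, and its second factor is integrable in the fields; this is what Fubini
needs. -/
lemma Regular.exists_D_le (hK : K.Regular) {C : ℝ} (hC : 0 ≤ C) (l : ℕ) (hl : 1 ≤ l) :
    ∃ C', 0 ≤ C' ∧ ∀ Y, K.Nice C Y → ∀ σ z,
      K.D Y σ l z ≤ Real.exp (Y σ 0 - K.X Y (k + 1) 0) * Real.exp (C' * (1 + ‖z‖)) := by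
  refine level_induction (k := k) (p := fun l => ∃ C', 0 ≤ C' ∧ ∀ Y, K.Nice C Y → ∀ σ z,
      K.D Y σ l z ≤ Real.exp (Y σ 0 - K.X Y (k + 1) 0) * Real.exp (C' * (1 + ‖z‖))) ?_ ?_ l hl
  · intro l h
    refine ⟨2 * C, by positivity, fun Y hY σ z => ?_⟩
    rw [hY.D_top_eq h, ← Real.exp_add]
    refine Real.exp_le_exp.2 ?_
    have := (abs_le.1 (hY.bound σ z)).2
    have := (abs_le.1 (hY.abs_X_top_sub_le h z)).1
    linarith
  · rintro l h1 h ⟨C', hC', ih⟩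
    obtain ⟨C'', hC'', hW⟩ := hK.exists_W_le hC l h1
    refine ⟨C'' + C' + Real.log (∫ z, Real.exp ((C'' + C') * ‖z‖) ∂K.law),
      add_nonneg (by positivity) (Real.log_nonneg (hK.one_le_integral_exp (by positivity))),
      fun Y hY σ z => ?_⟩
    rw [D_of_le h]
    refine (le_abs_self _).trans (hK.abs_levelExp_le (by positivity) (Real.exp_pos _).le ?_ l z)
    intro z'
    rw [abs_of_nonneg (mul_nonneg (W_pos l z').le (D_nonneg σ (l + 1) (by omega) z')), add_mul,
      Real.exp_add]
    calc _ ≤ Real.exp (C'' * (1 + ‖z'‖)) *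
          (Real.exp (Y σ 0 - K.X Y (k + 1) 0) * Real.exp (C' * (1 + ‖z'‖))) :=
          mul_le_mul (hW Y hY z') (ih Y hY σ z') (D_nonneg σ (l + 1) (by omega) z')
            (Real.exp_pos _).le
      _ = _ := by ring

variable {C : ℝ}

lemma Regular.expBdd_exp_X (hK : K.Regular) (hC : 0 ≤ C) (hY : K.Nice C Y) {l : ℕ} (hl : 1 ≤ l)
    (c : ℝ) : ExpBdd fun z => Real.exp (c * K.X Y l z) := by
  obtain ⟨C', hC', H⟩ := hK.exists_abs_X_sub_le hC l hl
  refine ⟨Real.measurable_exp.comp ((measurable_X' hY.meas hl).const_mul c),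
    |c| * (|K.X Y (k + 1) 0| + C'), by positivity, fun z => ?_⟩
  rw [Real.abs_exp]
  refine Real.exp_le_exp.2 ?_
  rw [mul_assoc]
  calc c * K.X Y l z ≤ |c| * |K.X Y l z| := by rw [← abs_mul]; exact le_abs_self _
    _ ≤ _ := by
      refine mul_le_mul_of_nonneg_left ?_ (abs_nonneg _)
      have h1 := abs_le.1 (H Y hY z)
      have h3 := mul_nonneg (abs_nonneg (K.X Y (k + 1) 0)) (norm_nonneg z)
      rw [abs_le]
      constructor <;> linarith [neg_abs_le (K.X Y (k + 1) 0), le_abs_self (K.X Y (k + 1) 0)]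

lemma Regular.expBdd_W (hK : K.Regular) (hC : 0 ≤ C) (hY : K.Nice C Y) {l : ℕ} (hl : 1 ≤ l) :
    ExpBdd (K.W Y l) := by
  obtain ⟨C', hC', H⟩ := hK.exists_W_le hC l hl
  exact ⟨measurable_W' hY.meas hl, C', hC', fun z => by
    rw [abs_of_pos (W_pos l z)]; exact H Y hY z⟩

lemma Regular.expBdd_prodW (hK : K.Regular) (hC : 0 ≤ C) (hY : K.Nice C Y) (l : ℕ) :
    ExpBdd (K.prodW Y l) := by
  obtain ⟨C', hC', H⟩ := hK.exists_prodW_le hC l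
  exact ⟨measurable_prodW' hY.meas l, C', hC', fun z => by
    rw [abs_of_pos (prodW_pos l z)]; exact H Y hY z⟩

lemma Regular.exp_mul_X (hK : K.Regular) (hC : 0 ≤ C) (hY : K.Nice C Y) {l : ℕ} (h1 : 1 ≤ l)
    (hl : l ≤ k) (z : Fin (k + 1) → E) :
    Real.exp (K.m l * K.X Y l z) =
      K.levelExp l (fun z' => Real.exp (K.m l * K.X Y (l + 1) z')) z := by
  have hm := (hK.m_pos l h1 hl).ne'
  rw [X_of_le hl, ← mul_assoc, mul_one_div_cancel hm, one_mul, Real.exp_log]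
  exact _root_.MeasureTheory.integral_exp_pos
    (hK.integrable_merge (hK.expBdd_exp_X hC hY (Nat.le_add_left 1 l) (K.m l)) l z)

/-- `X` at level `l` does not see the integrated fields, so the normalization of `W` leaves the
expectation as a constant factor. -/
lemma W_merge_self {l : ℕ} (z z' : Fin (k + 1) → E) :
    K.W Y l (merge l z z') =
      Real.exp (K.m l * K.X Y (l + 1) (merge l z z')) * Real.exp (-(K.m l * K.X Y l z)) := by
  rw [W, X_merge le_rfl, ← Real.exp_add]
  ring_nf

lemma Regular.levelExp_W (hK : K.Regular) (hC : 0 ≤ C) (hY : K.Nice C Y) {l : ℕ} (h1 : 1 ≤ l)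
    (hl : l ≤ k) (z : Fin (k + 1) → E) : K.levelExp l (K.W Y l) z = 1 := by
  have := hK.exp_mul_X hC hY h1 hl z
  simp only [levelExp, W_merge_self, integral_mul_const]
  simp only [levelExp] at this
  rw [← this, ← Real.exp_add]
  simp

lemma Regular.integrable_D (hK : K.Regular) (hC : 0 ≤ C) (hY : K.Nice C Y) {l : ℕ} (hl : 1 ≤ l)
    (z : Fin (k + 1) → E) : Integrable (fun σ => K.D Y σ l z) K.ν := by
  obtain ⟨C', hC', H⟩ := hK.exists_D_le hC l hl
  have : Integrable (fun σ => Real.exp (Y σ 0 - K.X Y (k + 1) 0)) K.ν := by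
    simp only [Real.exp_sub]
    exact hY.int.div_const _
  refine (this.mul_const (Real.exp (C' * (1 + ‖z‖)))).mono'
    ((measurable_D' hY.meas hl).comp measurable_prodMk_right).aestronglyMeasurable
    (ae_of_all _ fun σ => ?_)
  rw [Real.norm_eq_abs, abs_of_nonneg (D_nonneg σ l hl z)]
  exact H Y hY σ z

lemma Regular.integrable_mul_D (hK : K.Regular) (hC : 0 ≤ C) (hY : K.Nice C Y) {l : ℕ}
    (hl : 1 ≤ l) (z : Fin (k + 1) → E) {u : T → ℝ} (hu : Measurable u) {B : ℝ}
    (hB : ∀ σ, |u σ| ≤ B) : Integrable (fun σ => u σ * K.D Y σ l z) K.ν :=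
  (hK.integrable_D hC hY hl z).bdd_mul hu.aestronglyMeasurable (ae_of_all _ hB)

/-- Fubini between fields and configurations, with the product majorant of `exists_W_le` and
`exists_D_le`: the recursion for the densities passes to averages of bounded functions. -/
lemma Regular.levelExp_W_avg (hK : K.Regular) (hC : 0 ≤ C) (hY : K.Nice C Y) {l : ℕ}
    (h1 : 1 ≤ l) (hl : l ≤ k) {u : T → ℝ} (hu : Measurable u) {B : ℝ} (hB : ∀ σ, |u σ| ≤ B)
    (z : Fin (k + 1) → E) :
    K.levelExp l (fun z' => K.W Y l z' * K.avg Y (l + 1) u z') z = K.avg Y l u z := by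
  obtain ⟨C₁, hC₁, HW⟩ := hK.exists_W_le hC l h1
  obtain ⟨C₂, hC₂, HD⟩ := hK.exists_D_le hC (l + 1) (Nat.le_add_left 1 l)
  simp only [avg, levelExp, D_of_le hl, ← integral_const_mul]
  rw [integral_integral_swap]
  · congr 1
    ext σ
    congr 1
    ext z'
    ring
  · have hi : Integrable (fun σ => Real.exp (Y σ 0 - K.X Y (k + 1) 0)) K.ν := by
      simp only [Real.exp_sub]
      exact hY.int.div_const _
    have hj := ((hK.exp_int (C₁ + C₂)).const_mul
      (Real.exp ((C₁ + C₂) * (1 + ‖z‖)))).mul_prod (hi.const_mul B)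
    refine hj.mono' ?_ (ae_of_all _ fun q => ?_)
    · have hm : Measurable fun q : (Fin (k + 1) → E) × T => merge l z q.1 :=
        (measurable_merge_left l z).comp measurable_fst
      exact (((measurable_W' hY.meas h1).comp hm).mul ((hu.comp measurable_snd).mul
        ((measurable_D' hY.meas (Nat.le_add_left 1 l)).comp
          (measurable_snd.prodMk hm)))).aestronglyMeasurable
    · simp only [Function.uncurry, Real.norm_eq_abs, abs_mul]
      rw [abs_of_pos (W_pos l _), abs_of_nonneg (D_nonneg q.2 (l + 1) (Nat.le_add_left 1 l) _)]
      calc _ ≤ Real.exp (C₁ * (1 + ‖merge l z q.1‖)) * (B *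
            (Real.exp (Y q.2 0 - K.X Y (k + 1) 0) * Real.exp (C₂ * (1 + ‖merge l z q.1‖)))) := by
            refine mul_le_mul (HW Y hY _) ?_ (mul_nonneg (abs_nonneg _)
              (D_nonneg q.2 (l + 1) (Nat.le_add_left 1 l) _)) (Real.exp_pos _).le
            exact mul_le_mul (hB _) (HD Y hY _ _) (D_nonneg q.2 (l + 1) (Nat.le_add_left 1 l) _)
              ((abs_nonneg _).trans (hB q.2))
        _ = Real.exp ((C₁ + C₂) * (1 + ‖merge l z q.1‖)) *
              (B * Real.exp (Y q.2 0 - K.X Y (k + 1) 0)) := by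
            rw [add_mul, Real.exp_add]; ring
        _ ≤ _ := mul_le_mul_of_nonneg_right (exp_norm_merge_le (by positivity) l z q.1)
            (mul_nonneg ((abs_nonneg _).trans (hB q.2)) (Real.exp_pos _).le)

/-- At the top this is the normalization of the Gibbs density. Below, the recursion for averages is
applied to the constant `1`, and the expectation of `W` over the levels from `l` on is `1`. -/
lemma Regular.integral_D (hK : K.Regular) (hC : 0 ≤ C) (hY : K.Nice C Y) {l : ℕ} (hl : 1 ≤ l)
    (z : Fin (k + 1) → E) : ∫ σ, K.D Y σ l z ∂K.ν = 1 := by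
  revert z
  refine level_induction (k := k) (p := fun l => ∀ z, ∫ σ, K.D Y σ l z ∂K.ν = 1) ?_ ?_ l hl
  · intro l h z
    simp only [D_top h, integral_div]
    exact div_self (hY.integral_exp_pos z).ne'
  · intro l h1 h ih z
    have := hK.levelExp_W_avg hC hY h1 h (u := fun _ => 1) measurable_const (B := 1) (by simp) z
    simp only [avg, one_mul, ih, mul_one] at this
    rw [← this]
    exact hK.levelExp_W hC hY h1 h z

lemma Regular.abs_avg_le (hK : K.Regular) (hC : 0 ≤ C) (hY : K.Nice C Y) {l : ℕ} (hl : 1 ≤ l)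
    {u : T → ℝ} {B : ℝ} (hB : ∀ σ, |u σ| ≤ B) (z : Fin (k + 1) → E) :
    |K.avg Y l u z| ≤ B := by
  calc |K.avg Y l u z| ≤ ∫ σ, B * K.D Y σ l z ∂K.ν := by
        refine abs_integral_le_of_forall_abs_le ((hK.integrable_D hC hY hl z).const_mul B)
          fun σ => ?_
        rw [abs_mul, abs_of_nonneg (D_nonneg σ l hl z)]
        exact mul_le_mul_of_nonneg_right (hB σ) (D_nonneg σ l hl z)
    _ = B := by rw [integral_const_mul, hK.integral_D hC hY hl, mul_one]

end Bounds

end Cascade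

end

/-! ### Differentiating the recursion in a parameter and along translations of the fields. -/

section

namespace Cascade

variable {k : ℕ} {E T A : Type*} [NormedAddCommGroup E] [MeasurableSpace E] [BorelSpace E]
  [SecondCountableTopology E] [MeasurableSpace T] [MeasurableSpace A]

/-- The average over the levels `≥ l` of the Gibbs average of a function of the configuration and
of the fields. -/
def fieldAvg (K : Cascade k E T) (Y F : T → (Fin (k + 1) → E) → ℝ) (l : ℕ)
    (z : Fin (k + 1) → E) : ℝ :=
  if l ≤ k then K.levelExp l (fun z' => K.W Y l z' * fieldAvg K Y F (l + 1) z') z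
  else ∫ σ, F σ z * K.D Y σ l z ∂K.ν
termination_by k + 1 - l

variable {K : Cascade k E T} {Y F : T → (Fin (k + 1) → E) → ℝ}

lemma fieldAvg_of_le {l : ℕ} (h : l ≤ k) (z : Fin (k + 1) → E) :
    K.fieldAvg Y F l z = K.levelExp l (fun z' => K.W Y l z' * K.fieldAvg Y F (l + 1) z') z := by
  rw [fieldAvg, if_pos h]

lemma fieldAvg_top {l : ℕ} (h : k < l) (z : Fin (k + 1) → E) :
    K.fieldAvg Y F l z = ∫ σ, F σ z * K.D Y σ l z ∂K.ν := by
  rw [fieldAvg, if_neg (not_le.2 h)]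

lemma measurable_fieldAvg [SFinite K.law] [SFinite K.ν]
    {Y F : A → T → (Fin (k + 1) → E) → ℝ}
    (hY : Measurable fun q : A × T × (Fin (k + 1) → E) => Y q.1 q.2.1 q.2.2)
    (hF : Measurable fun q : A × T × (Fin (k + 1) → E) => F q.1 q.2.1 q.2.2)
    (l : ℕ) (hl : 1 ≤ l) :
    Measurable fun q : A × (Fin (k + 1) → E) => K.fieldAvg (Y q.1) (F q.1) l q.2 := by
  refine level_induction (k := k) (p := fun l => Measurable fun q : A × (Fin (k + 1) → E) =>
    K.fieldAvg (Y q.1) (F q.1) l q.2) ?_ ?_ l hl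
  · intro l h
    simp only [fieldAvg_top h]
    refine measurable_integral_snd
      (f := fun (q : A × (Fin (k + 1) → E)) σ => F q.1 σ q.2 * K.D (Y q.1) σ l q.2)
      (Measurable.mul ?_ ?_)
    · exact hF.comp (measurable_fst.fst.prodMk (measurable_snd.prodMk measurable_fst.snd))
    · exact (measurable_D hY l (by omega)).comp
        ((measurable_fst.fst.prodMk measurable_snd).prodMk measurable_fst.snd)
  · intro l h1 h ih
    simp only [fieldAvg_of_le h]
    exact measurable_levelExp l
      (f := fun a z => K.W (Y a) l z * K.fieldAvg (Y a) (F a) (l + 1) z)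
      ((measurable_W hY l h1).mul ih)

lemma measurable_fieldAvg' [SFinite K.law] [SFinite K.ν]
    (hY : Measurable fun q : T × (Fin (k + 1) → E) => Y q.1 q.2)
    (hF : Measurable fun q : T × (Fin (k + 1) → E) => F q.1 q.2)
    {l : ℕ} (hl : 1 ≤ l) : Measurable (K.fieldAvg Y F l) :=
  (measurable_fieldAvg (A := Unit) (Y := fun _ => Y) (F := fun _ => F) (hY.comp measurable_snd)
    (hF.comp measurable_snd) l hl).comp (measurable_prodMk_left (x := ()))

section Bounds

variable [∀ p, IsProbabilityMeasure (K.γ p)] [NeZero K.ν] [IsFiniteMeasure K.ν] {C : ℝ}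

/-- The constant in the exponent depends neither on `Y` nor on `F`, and the bound is linear in `B`.
One majorant therefore serves all parameters near a given one when differentiating under the
integral. -/
lemma Regular.exists_abs_fieldAvg_le (hK : K.Regular) (hC : 0 ≤ C) (l : ℕ) (hl : 1 ≤ l) :
    ∃ C', 0 ≤ C' ∧ ∀ Y, K.Nice C Y → ∀ (F : T → (Fin (k + 1) → E) → ℝ) (B : ℝ), 0 ≤ B →
      (∀ σ z, |F σ z| ≤ B * (1 + ‖z‖)) →
      ∀ z, |K.fieldAvg Y F l z| ≤ B * Real.exp (C' * (1 + ‖z‖)) := by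
  refine level_induction (k := k) (p := fun l => ∃ C', 0 ≤ C' ∧ ∀ Y, K.Nice C Y →
    ∀ (F : T → (Fin (k + 1) → E) → ℝ) (B : ℝ), 0 ≤ B → (∀ σ z, |F σ z| ≤ B * (1 + ‖z‖)) →
      ∀ z, |K.fieldAvg Y F l z| ≤ B * Real.exp (C' * (1 + ‖z‖))) ?_ ?_ l hl
  · intro l h
    refine ⟨1, zero_le_one, fun Y hY F B hB hF z => ?_⟩
    rw [fieldAvg_top h]
    refine (hK.abs_avg_le hC hY (by omega) (u := fun σ => F σ z) (fun σ => hF σ z) z).trans ?_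
    refine mul_le_mul_of_nonneg_left ?_ hB
    linarith [Real.add_one_le_exp (1 * (1 + ‖z‖))]
  · rintro l h1 h ⟨C', hC', ih⟩
    obtain ⟨C'', hC'', hW⟩ := hK.exists_W_le hC l h1
    refine ⟨C'' + C' + Real.log (∫ z, Real.exp ((C'' + C') * ‖z‖) ∂K.law),
      add_nonneg (by positivity) (Real.log_nonneg (hK.one_le_integral_exp (by positivity))),
      fun Y hY F B hB hF z => ?_⟩
    rw [fieldAvg_of_le h]
    refine hK.abs_levelExp_le (by positivity) hB (fun z' => ?_) l z
    rw [abs_mul, abs_of_pos (W_pos l z'), add_mul, Real.exp_add]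
    calc _ ≤ Real.exp (C'' * (1 + ‖z'‖)) * (B * Real.exp (C' * (1 + ‖z'‖))) :=
          mul_le_mul (hW Y hY z') (ih Y hY F B hB hF z') (abs_nonneg _) (Real.exp_pos _).le
      _ = _ := by ring

/-- When the averaged function does not involve the fields, both averages satisfy the same downward
recursion from the same value at the top. -/
lemma Regular.fieldAvg_eq_avg (hK : K.Regular) (hC : 0 ≤ C) (hY : K.Nice C Y) {u : T → ℝ}
    (hu : Measurable u) {B : ℝ} (hB : ∀ σ, |u σ| ≤ B) (l : ℕ) (hl : 1 ≤ l)
    (z : Fin (k + 1) → E) : K.fieldAvg Y (fun σ _ => u σ) l z = K.avg Y l u z := by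
  revert z
  refine level_induction (k := k)
    (p := fun l => ∀ z, K.fieldAvg Y (fun σ _ => u σ) l z = K.avg Y l u z) ?_ ?_ l hl
  · exact fun l h z => fieldAvg_top h z
  · intro l h1 h ih z
    rw [fieldAvg_of_le h]
    simp only [ih]
    exact hK.levelExp_W_avg hC hY h1 h hu hB z

/-- The derivative of the recursion in a parameter of the Hamiltonian. -/
lemma Regular.hasDerivAt_X (hK : K.Regular) (hC : 0 ≤ C) {B : ℝ} (hB : 0 ≤ B) {s : Set ℝ}
    (hs : IsOpen s) {Y Y' : ℝ → T → (Fin (k + 1) → E) → ℝ} (hY : ∀ t ∈ s, K.Nice C (Y t))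
    (hY'm : ∀ t ∈ s, Measurable fun q : T × (Fin (k + 1) → E) => Y' t q.1 q.2)
    (hY'b : ∀ t ∈ s, ∀ σ z, |Y' t σ z| ≤ B * (1 + ‖z‖))
    (hd : ∀ t ∈ s, ∀ σ z, HasDerivAt (fun t => Y t σ z) (Y' t σ z) t)
    (l : ℕ) (hl : 1 ≤ l) (t : ℝ) (ht : t ∈ s) (z : Fin (k + 1) → E) :
    HasDerivAt (fun t => K.X (Y t) l z) (K.fieldAvg (Y t) (Y' t) l z) t := by
  have top : ∀ l, k < l → ∀ t ∈ s, ∀ z,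
      HasDerivAt (fun t => K.X (Y t) l z) (K.fieldAvg (Y t) (Y' t) l z) t := by
    intro l h t ht z
    obtain ⟨r, hr, hrs⟩ := Metric.isOpen_iff.1 hs t ht
    have hmem : Metric.ball t r ∈ 𝓝 t := Metric.ball_mem_nhds t hr
    have key := (hasDerivAt_integral_of_dominated_loc_of_deriv_le (μ := K.ν)
      (F := fun t σ => Real.exp (Y t σ z)) (F' := fun t σ => Real.exp (Y t σ z) * Y' t σ z)
      (bound := fun σ => Real.exp (B * (1 + ‖z‖) * r) * Real.exp (Y t σ z) * (B * (1 + ‖z‖)))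
      hmem ?_ ((hY t ht).integrable_exp z) ?_ (ae_of_all _ ?_)
      ((((hY t ht).integrable_exp z).const_mul _).mul_const _) (ae_of_all _ ?_)).2
    · have hpos := (hY t ht).integral_exp_pos z
      have := key.log hpos.ne'
      simp only [X_top h, fieldAvg_top h, D_top h]
      convert this using 1
      rw [← integral_div]
      congr 1
      ext σ
      ring
    · filter_upwards [hmem] with t' ht'
      exact ((hY t' (hrs ht')).integrable_exp z).aestronglyMeasurable
    · exact ((Real.measurable_exp.comp ((hY t ht).meas.comp measurable_prodMk_right)).mul
        ((hY'm t ht).comp measurable_prodMk_right)).aestronglyMeasurable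
    · intro σ t' ht'
      rw [Real.norm_eq_abs, abs_mul, Real.abs_exp]
      refine mul_le_mul ?_ (hY'b t' (hrs ht') σ z) (abs_nonneg _) (by positivity)
      rw [← Real.exp_add]
      refine Real.exp_le_exp.2 ?_
      -- By the mean value inequality the exponent moves by at most `B (1 + ‖z‖) r` on the ball, so
      -- the weights at `t'` are controlled by those at the centre `t`, which are integrable.
      have h1 := (convex_ball t r).norm_image_sub_le_of_norm_hasDerivWithin_le
        (f := fun t => Y t σ z) (f' := fun t => Y' t σ z) (C := B * (1 + ‖z‖))
        (fun x hx => (hd x (hrs hx) σ z).hasDerivWithinAt)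
        (fun x hx => hY'b x (hrs hx) σ z) (Metric.mem_ball_self hr) ht'
      have h2 : ‖t' - t‖ ≤ r := by
        rw [← dist_eq_norm]; exact (Metric.mem_ball.1 ht').le
      have h3 : B * (1 + ‖z‖) * ‖t' - t‖ ≤ B * (1 + ‖z‖) * r :=
        mul_le_mul_of_nonneg_left h2 (by positivity)
      have h4 := (abs_le.1 (h1.trans h3)).2
      linarith
    · intro σ t' ht'
      exact (hd t' (hrs ht') σ z).exp
  revert t z
  refine level_induction (k := k) (p := fun l => ∀ t, t ∈ s → ∀ z,
    HasDerivAt (fun t => K.X (Y t) l z) (K.fieldAvg (Y t) (Y' t) l z) t) top ?_ l hl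
  intro l h1 h ih t ht z
  obtain ⟨c₁, hc₁, hX⟩ := hK.exists_abs_X_sub_le hC (l + 1) (Nat.le_add_left 1 l)
  obtain ⟨c₂, hc₂, hV⟩ := hK.exists_abs_fieldAvg_le hC (l + 1) (Nat.le_add_left 1 l)
  have hm := hK.m_pos l h1 h
  -- The uniform estimates leave a single quantity depending on the parameter, the value at the
  -- origin at the top level. The case `top` makes it continuous, hence bounded near `t`.
  have hcont : ∀ᶠ t' in 𝓝 t, K.X (Y t') (k + 1) 0 < K.X (Y t) (k + 1) 0 + 1 :=
    (top (k + 1) (Nat.lt_succ_self k) t ht 0).continuousAt.eventually_lt_const (by linarith)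
  set x₀ := K.X (Y t) (k + 1) 0 + 1
  have hmem : {t' | t' ∈ s ∧ K.X (Y t') (k + 1) 0 < x₀} ∈ 𝓝 t :=
    (hs.mem_nhds ht |> fun h => (Filter.Eventually.and h hcont))
  have hEB : ∀ t' ∈ s, ExpBdd fun z => Real.exp (K.m l * K.X (Y t') (l + 1) z) := fun t' ht' =>
    hK.expBdd_exp_X hC (hY t' ht') (Nat.le_add_left 1 l) _
  have key := (hasDerivAt_integral_of_dominated_loc_of_deriv_le (μ := K.law)
    (F := fun t z' => Real.exp (K.m l * K.X (Y t) (l + 1) (merge l z z')))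
    (F' := fun t z' => Real.exp (K.m l * K.X (Y t) (l + 1) (merge l z z')) *
      (K.m l * K.fieldAvg (Y t) (Y' t) (l + 1) (merge l z z')))
    (bound := fun z' => Real.exp (K.m l * x₀) * (K.m l * B) *
      (Real.exp ((K.m l * c₁ + c₂) * (1 + ‖z‖)) * Real.exp ((K.m l * c₁ + c₂) * ‖z'‖)))
    hmem ?_ (hK.integrable_merge (hEB t ht) l z) ?_ (ae_of_all _ ?_)
    (((hK.exp_int _).const_mul _).const_mul _) (ae_of_all _ ?_)).2
  · have e := hK.exp_mul_X hC (hY t ht) h1 h z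
    have hpos : 0 < ∫ z', Real.exp (K.m l * K.X (Y t) (l + 1) (merge l z z')) ∂K.law := by
      simp only [levelExp] at e
      rw [← e]; exact Real.exp_pos _
    have := (key.log hpos.ne').const_mul (1 / K.m l)
    -- In the derivative of the logarithm, dividing by the integral turns the exponential weight
    -- into `W`, and the factors `m l` cancel.
    have hval : K.fieldAvg (Y t) (Y' t) l z = 1 / K.m l *
        ((∫ z', Real.exp (K.m l * K.X (Y t) (l + 1) (merge l z z')) *
          (K.m l * K.fieldAvg (Y t) (Y' t) (l + 1) (merge l z z')) ∂K.law) /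
        ∫ z', Real.exp (K.m l * K.X (Y t) (l + 1) (merge l z z')) ∂K.law) := by
      simp only [levelExp] at e
      rw [fieldAvg_of_le h, levelExp]
      simp only [W_merge_self, Real.exp_neg]
      rw [e, ← integral_div, ← integral_const_mul]
      congr 1
      ext z'
      field_simp
    rw [hval]
    simp only [X_of_le h, levelExp]
    exact this
  · filter_upwards [hs.mem_nhds ht] with t' ht'
    exact (hK.integrable_merge (hEB t' ht') l z).aestronglyMeasurable
  · exact (((hEB t ht).1.comp (measurable_merge_left l z)).mul
      (((measurable_fieldAvg' (hY t ht).meas (hY'm t ht) (Nat.le_add_left 1 l)).comp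
        (measurable_merge_left l z)).const_mul _)).aestronglyMeasurable
  · rintro z' t' ⟨ht', hx⟩
    set w := merge l z z' with hw
    have hz := norm_merge_le l z z'
    rw [← hw] at hz
    rw [Real.norm_eq_abs, abs_mul, Real.abs_exp, abs_mul, abs_of_pos hm]
    have a1 := hV (Y t') (hY t' ht') (Y' t') B hB (hY'b t' ht') w
    have a2 := (abs_le.1 (hX (Y t') (hY t' ht') w)).2
    calc _ ≤ Real.exp (K.m l * (x₀ + c₁ * (1 + ‖w‖))) *
          (K.m l * (B * Real.exp (c₂ * (1 + ‖w‖)))) := by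
          refine mul_le_mul (Real.exp_le_exp.2 (mul_le_mul_of_nonneg_left (by linarith) hm.le))
            (mul_le_mul_of_nonneg_left a1 hm.le) (by positivity) (by positivity)
      _ = Real.exp (K.m l * x₀) * (K.m l * B) * Real.exp ((K.m l * c₁ + c₂) * (1 + ‖w‖)) := by
          rw [show K.m l * (x₀ + c₁ * (1 + ‖w‖)) = K.m l * x₀ + K.m l * c₁ * (1 + ‖w‖) by ring,
            add_mul (K.m l * c₁), Real.exp_add, Real.exp_add]
          ring
      _ ≤ _ := mul_le_mul_of_nonneg_left
          (exp_norm_merge_le (by positivity) l z z') (by positivity)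
  · rintro z' t' ⟨ht', -⟩
    exact ((ih t' ht' (merge l z z')).const_mul (K.m l)).exp

lemma Nice.add_const (hY : K.Nice C Y) {u : T → ℝ} (hu : Measurable u) {B : ℝ}
    (hB : ∀ σ, |u σ| ≤ B) : K.Nice C fun σ z => Y σ z + u σ := by
  refine ⟨hY.meas.add (hu.comp measurable_fst), ?_, fun σ z => ?_⟩
  · refine (hY.int.const_mul (Real.exp B)).mono' (Real.measurable_exp.comp
      ((hY.meas.comp measurable_prodMk_right).add hu)).aestronglyMeasurable
      (ae_of_all _ fun σ => ?_)
    rw [Real.norm_eq_abs, Real.abs_exp, ← Real.exp_add]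
    exact Real.exp_le_exp.2 (by linarith [(abs_le.1 (hB σ)).2])
  · simpa using hY.bound σ z

/-- The case of a perturbation that is linear in the parameter and does not involve the fields. A
bounded perturbation of this kind changes neither integrability nor the rate of variation in the
fields. -/
lemma Regular.hasDerivAt_X_add_mul (hK : K.Regular) (hC : 0 ≤ C) (hY : K.Nice C Y) {u : T → ℝ}
    (hu : Measurable u) {B : ℝ} (hB : ∀ σ, |u σ| ≤ B) (l : ℕ) (hl : 1 ≤ l)
    (z : Fin (k + 1) → E) :
    HasDerivAt (fun t : ℝ => K.X (fun σ z => Y σ z + t * u σ) l z) (K.avg Y l u z) 0 := by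
  rcases isEmpty_or_nonempty T with hT | ⟨⟨σ₀⟩⟩
  · exact absurd (Measure.eq_zero_of_isEmpty K.ν) (NeZero.ne K.ν)
  have hB0 : 0 ≤ B := (abs_nonneg _).trans (hB σ₀)
  have := hK.hasDerivAt_X hC hB0 isOpen_univ (Y := fun t σ z => Y σ z + t * u σ)
    (Y' := fun _ σ _ => u σ)
    (fun t _ => hY.add_const (hu.const_mul t) (B := |t| * B) fun σ => by
      rw [abs_mul]; exact mul_le_mul_of_nonneg_left (hB σ) (abs_nonneg t))
    (fun t _ => hu.comp measurable_fst)
    (fun t _ σ z => (hB σ).trans (le_mul_of_one_le_right hB0 (by linarith [norm_nonneg z])))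
    (fun t _ σ z => by simpa using ((hasDerivAt_id t).mul_const (u σ)).const_add (Y σ z))
    l hl 0 (mem_univ _) z
  rw [← hK.fieldAvg_eq_avg hC hY hu hB l hl z]
  simpa using this

end Bounds

lemma merge_add {l j : ℕ} (hl : l ≤ j) {a : Fin (k + 1) → E} (ha : ∀ p : Fin (k + 1), l ≤ p → a p = 0)
    (z z' : Fin (k + 1) → E) : merge j (z + a) z' = merge j z z' + a := by
  ext p
  simp only [merge, Pi.add_apply]
  split_ifs with h
  · rfl
  · rw [ha p (by omega), add_zero]

/-- A translation supported below level `l` never touches a field that is integrated at levels `j ≥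
l`. It commutes with every such expectation and can be moved into the Hamiltonian. -/
lemma X_add {l : ℕ} (h1 : 1 ≤ l) {a : Fin (k + 1) → E}
    (ha : ∀ p : Fin (k + 1), l ≤ p → a p = 0) (z : Fin (k + 1) → E) :
    K.X Y l (z + a) = K.X (fun σ z => Y σ (z + a)) l z := by
  have := level_induction (k := k) (p := fun j => l ≤ j → ∀ z,
    K.X Y j (z + a) = K.X (fun σ z => Y σ (z + a)) j z) (fun j hj _ z => by
      rw [X_top hj, X_top hj]) (fun j _ hj ih hlj z => by
      simp only [X_of_le hj, levelExp, merge_add hlj ha, ih (hlj.trans (Nat.le_succ j))])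
  exact this l h1 le_rfl z

/-- The fields of level at least `l` do not matter at level `l`, so that a translation can be cut
off there. -/
lemma X_add_eq {l : ℕ} (h1 : 1 ≤ l) (z a : Fin (k + 1) → E) :
    K.X Y l (z + a) = K.X (fun σ z => Y σ (z + merge l a 0)) l z := by
  rw [← X_add h1 (fun p hp => by simp [merge, not_lt.2 hp]), ← X_merge (le_refl l) (z + a) z]
  congr 1
  ext p
  simp only [merge, Pi.add_apply]
  split_ifs <;> simp

end Cascade

end

/-! ### Averages over one and over two configurations under the changes of measure. -/

section

namespace Cascade

variable {k : ℕ} {E T A : Type*} [NormedAddCommGroup E] [MeasurableSpace E] [BorelSpace E]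
  [SecondCountableTopology E] [MeasurableSpace T] [MeasurableSpace A]

/-- The average of a function of two configurations, the first one drawn with density `D_j`, the
second one with density `D_l`, weighted by the changes of measure below level `j`. -/
def pairDensity (K : Cascade k E T) (Y : T → (Fin (k + 1) → E) → ℝ) (j l : ℕ) (f : T → T → ℝ)
    (z : Fin (k + 1) → E) : ℝ :=
  K.prodW Y j z * K.avg Y j (fun σ => K.avg Y l (f σ) z) z

variable {K : Cascade k E T}

lemma measurable_avg_avg [SFinite K.law] [SFinite K.ν] {Y : A → T → (Fin (k + 1) → E) → ℝ}
    (hY : Measurable fun q : A × T × (Fin (k + 1) → E) => Y q.1 q.2.1 q.2.2)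
    {j l : ℕ} (hj : 1 ≤ j) (hl : 1 ≤ l) {f : T → T → ℝ}
    (hf : Measurable fun q : T × T => f q.1 q.2) :
    Measurable fun q : A × (Fin (k + 1) → E) =>
      K.avg (Y q.1) j (fun σ => K.avg (Y q.1) l (f σ) q.2) q.2 := by
  have h1 : Measurable fun q : (A × T) × (Fin (k + 1) → E) => K.avg (Y q.1.1) l (f q.1.2) q.2 :=
    measurable_avg (A := A × T) (Y := fun a => Y a.1) (u := fun a => f a.2)
      (hY.comp (measurable_fst.fst.prodMk measurable_snd)) l hl
      (hf.comp (measurable_fst.snd.prodMk measurable_snd))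
  have h2 := measurable_avg (K := K) (A := A × (Fin (k + 1) → E)) (Y := fun a => Y a.1)
    (u := fun a σ => K.avg (Y a.1) l (f σ) a.2)
    (hY.comp (measurable_fst.fst.prodMk measurable_snd)) j hj
    (h1.comp ((measurable_fst.fst.prodMk measurable_snd).prodMk measurable_fst.snd))
  exact h2.comp (measurable_id.prodMk measurable_snd)

lemma measurable_pairDensity [SFinite K.law] [SFinite K.ν] {Y : A → T → (Fin (k + 1) → E) → ℝ}
    (hY : Measurable fun q : A × T × (Fin (k + 1) → E) => Y q.1 q.2.1 q.2.2)
    {j l : ℕ} (hj : 1 ≤ j) (hl : 1 ≤ l) {f : T → T → ℝ}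
    (hf : Measurable fun q : T × T => f q.1 q.2) :
    Measurable fun q : A × (Fin (k + 1) → E) => K.pairDensity (Y q.1) j l f q.2 :=
  (measurable_prodW hY j).mul (measurable_avg_avg hY hj hl hf)

variable {Y F : T → (Fin (k + 1) → E) → ℝ}
variable [∀ p, IsProbabilityMeasure (K.γ p)] [NeZero K.ν] [IsFiniteMeasure K.ν] {C : ℝ}

lemma prodW_one (z : Fin (k + 1) → E) : K.prodW Y 1 z = 1 := by simp [prodW]

/-- The last factor is peeled off with the tower property: the earlier ones do not see the fields
being integrated, and the last one has conditional expectation `1`. -/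
lemma Regular.integral_prodW (hK : K.Regular) (hC : 0 ≤ C) (hY : K.Nice C Y) {l : ℕ}
    (h1 : 1 ≤ l) (hl : l ≤ k + 1) : ∫ z, K.prodW Y l z ∂K.law = 1 := by
  induction l, h1 using Nat.le_induction with
  | base => simp [prodW_one]
  | succ l h1 ih =>
    rw [← ih (by omega), ← integral_levelExp l (hK.integrable (hK.expBdd_prodW hC hY (l + 1)))]
    congr 1
    ext z
    have := hK.levelExp_W hC hY h1 (by omega) z
    simp only [levelExp] at this
    simp only [levelExp, prodW_succ h1, prodW_merge le_rfl, integral_const_mul, this, mul_one]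

/-- Under the total expectation the nested conditional expectations collapse one level at a time,
each leaving its factor `W` behind. What remains is one integral against the density used in the
integration by parts. -/
lemma Regular.integral_fieldAvg (hK : K.Regular) (hC : 0 ≤ C) (hY : K.Nice C Y)
    (hF : Measurable fun q : T × (Fin (k + 1) → E) => F q.1 q.2) {B : ℝ} (hB : 0 ≤ B)
    (hFB : ∀ σ z, |F σ z| ≤ B * (1 + ‖z‖)) :
    ∫ z, K.fieldAvg Y F 1 z ∂K.law =
      ∫ z, K.prodW Y (k + 1) z * ∫ σ, F σ z * K.D Y σ (k + 1) z ∂K.ν ∂K.law := by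
  have key : ∀ l, 1 ≤ l → l ≤ k + 1 → ∫ z, K.fieldAvg Y F 1 z ∂K.law =
      ∫ z, K.prodW Y l z * K.fieldAvg Y F l z ∂K.law := by
    intro l h1 hl
    induction l, h1 using Nat.le_induction with
    | base => simp [prodW_one]
    | succ l h1 ih =>
      obtain ⟨C', hC', H⟩ := hK.exists_abs_fieldAvg_le hC (l + 1) (by omega)
      have hbd : ExpBdd (K.fieldAvg Y F (l + 1)) := by
        refine ⟨measurable_fieldAvg' hY.meas hF (by omega), B + C', by positivity, fun z => ?_⟩
        refine (H Y hY F B hB hFB z).trans ?_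
        rw [add_mul, Real.exp_add]
        refine mul_le_mul_of_nonneg_right ?_ (Real.exp_pos _).le
        have := Real.add_one_le_exp (B * (1 + ‖z‖))
        nlinarith [mul_nonneg hB (norm_nonneg z)]
      rw [ih (by omega), ← integral_levelExp l
        (hK.integrable ((hK.expBdd_prodW hC hY (l + 1)).mul hbd))]
      congr 1
      ext z
      rw [fieldAvg_of_le (by omega)]
      simp only [levelExp, prodW_succ h1, prodW_merge le_rfl, mul_assoc, integral_const_mul]
  rw [key (k + 1) (by omega) le_rfl]
  simp only [fieldAvg_top (Nat.lt_succ_self k)]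

lemma Regular.abs_avg_avg_le (hK : K.Regular) (hC : 0 ≤ C) (hY : K.Nice C Y) {j l : ℕ}
    (hj : 1 ≤ j) (hl : 1 ≤ l) {f : T → T → ℝ} {B : ℝ} (hB : ∀ σ ρ, |f σ ρ| ≤ B)
    (z : Fin (k + 1) → E) : |K.avg Y j (fun σ => K.avg Y l (f σ) z) z| ≤ B :=
  hK.abs_avg_le hC hY hj (fun σ => hK.abs_avg_le hC hY hl (hB σ) z) z

lemma Regular.expBdd_pairDensity (hK : K.Regular) (hC : 0 ≤ C) (hY : K.Nice C Y) {j l : ℕ}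
    (hj : 1 ≤ j) (hl : 1 ≤ l) {f : T → T → ℝ} (hf : Measurable fun q : T × T => f q.1 q.2)
    {B : ℝ} (hB : ∀ σ ρ, |f σ ρ| ≤ B) : ExpBdd (K.pairDensity Y j l f) :=
  (hK.expBdd_prodW hC hY j).mul (ExpBdd.of_bounded
    ((measurable_avg_avg (A := Unit) (Y := fun _ => Y) (hY.meas.comp measurable_snd) hj hl hf).comp
      (measurable_prodMk_left (x := ()))) (hK.abs_avg_avg_le hC hY hj hl hB))

lemma Regular.measurable_avg_left (_hK : K.Regular) (hY : K.Nice C Y) {l : ℕ}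
    (hl : 1 ≤ l) {f : T → T → ℝ} (hf : Measurable fun q : T × T => f q.1 q.2)
    (z : Fin (k + 1) → E) : Measurable fun σ => K.avg Y l (f σ) z :=
  (measurable_avg (A := T) (Y := fun _ => Y) (u := f) (hY.meas.comp measurable_snd) l hl hf).comp
    measurable_prodMk_right

/-- Raising the level of the first configuration does not change the average. -/
lemma Regular.integral_pairDensity_eq (hK : K.Regular) (hC : 0 ≤ C) (hY : K.Nice C Y) {l j : ℕ}
    (hl : 1 ≤ l) (hlj : l ≤ j) (hj : j ≤ k + 1) {f : T → T → ℝ}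
    (hf : Measurable fun q : T × T => f q.1 q.2) {B : ℝ} (hB : ∀ σ ρ, |f σ ρ| ≤ B) :
    ∫ z, K.pairDensity Y j l f z ∂K.law = ∫ z, K.pairDensity Y l l f z ∂K.law := by
  induction j, hlj using Nat.le_induction with
  | base => rfl
  | succ j hlj ih =>
    have h1 : 1 ≤ j := hl.trans hlj
    rw [← ih (by omega), ← integral_levelExp j
      (hK.integrable (hK.expBdd_pairDensity hC hY (by omega) hl hf hB))]
    congr 1
    ext z
    -- The average over the second configuration depends only on fields below `l ≤ j`. It is frozen
    -- while the levels from `j` on are integrated, and so acts as a fixed bounded function of the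
    -- first configuration.
    have := hK.levelExp_W_avg hC hY h1 (by omega) (hK.measurable_avg_left hY hl hf z)
      (fun σ => hK.abs_avg_le hC hY hl (hB σ) z) z
    rw [pairDensity, ← this]
    simp only [levelExp, pairDensity, prodW_succ h1, prodW_merge le_rfl, avg_merge hlj, mul_assoc,
      integral_const_mul]

end Cascade

end

/-! ### Gaussian integration by parts. -/

section

section GaussianIntegrationByParts

open scoped NNReal

lemma hasDerivAt_gaussianPDFReal_zero (v : ℝ≥0) (x : ℝ) :
    HasDerivAt (gaussianPDFReal 0 v) (-(x / v) * gaussianPDFReal 0 v x) x := by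
  simp only [gaussianPDFReal_def]
  have h : HasDerivAt (fun x : ℝ => -(x - 0) ^ 2 / (2 * (v : ℝ))) (-(x / v)) x := by
    have := ((((hasDerivAt_id x).sub_const 0).pow 2).neg).div_const (2 * (v : ℝ))
    exact this.congr_deriv (by simp; ring)
  have := h.exp.const_mul ((√(2 * Real.pi * v))⁻¹)
  exact this.congr_deriv (by ring)

/-- **Stein's lemma** in dimension one. -/
lemma integral_id_mul_gaussianReal {v : ℝ≥0} (hv : v ≠ 0) {f f' : ℝ → ℝ}
    (hf : ∀ x, HasDerivAt f (f' x) x) (hi : Integrable f (gaussianReal 0 v))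
    (hi' : Integrable f' (gaussianReal 0 v))
    (hxi : Integrable (fun x => x * f x) (gaussianReal 0 v)) :
    ∫ x, x * f x ∂(gaussianReal 0 v) = v * ∫ x, f' x ∂(gaussianReal 0 v) := by
  have conv : ∀ {g : ℝ → ℝ}, Integrable g (gaussianReal 0 v) →
      Integrable fun x => gaussianPDFReal 0 v x * g x := by
    intro g hg
    rw [gaussianReal_of_var_ne_zero _ hv, integrable_withDensity_iff_integrable_smul'
      (measurable_gaussianPDF 0 v) (ae_of_all _ fun _ => gaussianPDF_lt_top)] at hg
    simpa [toReal_gaussianPDF] using hg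
  have hv' : (v : ℝ) ≠ 0 := by exact_mod_cast hv
  have hd : ∀ x, HasDerivAt (fun x => gaussianPDFReal 0 v x * f x)
      (gaussianPDFReal 0 v x * f' x - (v : ℝ)⁻¹ * (gaussianPDFReal 0 v x * (x * f x))) x := by
    intro x
    exact ((hasDerivAt_gaussianPDFReal_zero v x).mul (hf x)).congr_deriv (by ring)
  have := integral_eq_zero_of_hasDerivAt_of_integrable hd
    ((conv hi').sub ((conv hxi).const_mul _)) (conv hi)
  rw [integral_sub (conv hi') ((conv hxi).const_mul _), integral_const_mul] at this
  rw [integral_gaussianReal_eq_integral_smul hv, integral_gaussianReal_eq_integral_smul hv]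
  simp only [smul_eq_mul]
  rw [sub_eq_zero.1 this, mul_inv_cancel_left₀ hv']

variable {F : Type*} [NormedAddCommGroup F] [NormedSpace ℝ F] [MeasurableSpace F] [BorelSpace F]
  [SecondCountableTopology F] [CompleteSpace F]

/-- Fernique's theorem makes `exp (C ‖x‖²)` integrable for some `C > 0`, and completing the square
bounds a linear exponent by a constant plus `C ‖x‖²`. -/
lemma integrable_exp_norm_of_isGaussian (μ : Measure F) [IsGaussian μ] (c : ℝ) :
    Integrable (fun x => Real.exp (c * ‖x‖)) μ := by
  obtain ⟨C, hC, hi⟩ := IsGaussian.exists_integrable_exp_sq μ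
  refine (hi.const_mul (Real.exp (c ^ 2 / (4 * C)))).mono'
    (Real.measurable_exp.comp (measurable_norm.const_mul c)).aestronglyMeasurable
    (ae_of_all _ fun x => ?_)
  rw [Real.norm_eq_abs, Real.abs_exp, ← Real.exp_add]
  refine Real.exp_le_exp.2 ?_
  have : c ^ 2 / (4 * C) + C * ‖x‖ ^ 2 - c * ‖x‖ = (c - 2 * C * ‖x‖) ^ 2 / (4 * C) := by
    field_simp
    ring
  have h2 : 0 ≤ (c - 2 * C * ‖x‖) ^ 2 / (4 * C) := by positivity
  linarith

/-- Integration by parts for a centered Gaussian measure: multiplication by a linear form `w` is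
adjoint to the derivative along the vector representing the covariance with `w`. -/
lemma integral_dual_mul_of_isGaussian (μ : Measure F) [IsGaussian μ] (h0 : ∫ x, x ∂μ = 0)
    (w : StrongDual ℝ F) {G G' : F → ℝ}
    (hd : ∀ x, HasDerivAt (fun t : ℝ => G (x + t • ∫ y, w y • y ∂μ)) (G' x) 0)
    (hi : Integrable G μ) (hi' : Integrable G' μ) (hwi : Integrable (fun x => w x * G x) μ) :
    ∫ x, w x * G x ∂μ = ∫ x, G' x ∂μ := by
  set a := ∫ y, w y • y ∂μ with ha
  have hwy : Integrable (fun y => w y • y) μ := by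
    have h2 : MemLp (fun y : F => y) 2 μ := IsGaussian.memLp_id μ 2 (by norm_num)
    have hw2 : MemLp (fun y => w y) 2 μ := IsGaussian.memLp_dual μ w 2 (by norm_num)
    exact memLp_one_iff_integrable.1 (h2.smul hw2)
  have hva : ∀ v : StrongDual ℝ F, v a = ∫ y, w y * v y ∂μ := by
    intro v
    rw [ha, ← v.integral_comp_comm hwy]
    simp
  have hmean : ∀ v : StrongDual ℝ F, ∫ y, v y ∂μ = 0 := by
    intro v
    have := IsGaussian.integral_dual (μ := μ) v
    rw [this, h0, map_zero]
  have hmem : ∀ v : StrongDual ℝ F, MemLp v 2 μ := fun v => IsGaussian.memLp_dual μ v 2 (by norm_num)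
  set c := w a with hc
  have hc2 : c = ∫ y, w y * w y ∂μ := hva w
  have hc0 : 0 ≤ c := hc2 ▸ integral_nonneg fun y => mul_self_nonneg _
  -- `c` is the variance of `w`. If it vanishes, then `w = 0` almost everywhere and `a = 0`, so the
  -- directional derivative is that of a constant and both sides are `0`.
  rcases hc0.eq_or_lt with hc0 | hc0
  · have hw0 : ∀ᵐ y ∂μ, w y = 0 := by
      have := (integral_eq_zero_iff_of_nonneg (fun y => mul_self_nonneg (w y))
        ((hmem w).integrable_mul (hmem w))).1 (hc2.symm.trans hc0.symm)
      filter_upwards [this] with y hy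
      simpa using hy
    have ha0 : a = 0 := by
      rw [ha]
      refine integral_eq_zero_of_ae ?_
      filter_upwards [hw0] with y hy
      simp [hy]
    have hG' : ∀ x, G' x = 0 := by
      intro x
      have := hd x
      simp only [ha0, smul_zero, add_zero] at this
      exact this.unique (hasDerivAt_const _ _)
    rw [integral_eq_zero_of_ae (by filter_upwards [hw0] with y hy; simp [hy])]
    simp [hG']
  -- Subtracting from `x` its regression on `w` leaves a vector uncorrelated with `w`; as the pair
  -- is jointly Gaussian, they are independent. Stein's lemma is then applied in the variable `w`
  -- with the rest held fixed.
  · set R : F →L[ℝ] F := ContinuousLinearMap.id ℝ F - (c⁻¹ • w).smulRight a with hR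
    have hRx : ∀ x, R x = x - (c⁻¹ * w x) • a := fun x => by simp [hR]
    have hlaw : HasGaussianLaw (fun x => (R x, w x)) μ :=
      IsGaussian.hasGaussianLaw_id.map_fun (R.prod w)
    have hind : IndepFun R w μ := by
      refine hlaw.indepFun_of_covariance_strongDual fun v s => ?_
      have hs : (s ∘ w : F → ℝ) = fun x => w x * s 1 := by
        ext x
        have := s.map_smul (w x) 1
        simpa using this
      have e1 : ∫ x, (v ∘ R) x ∂μ = 0 := hmean (v.comp R)
      have e2 : ∫ x, (s ∘ w) x ∂μ = 0 := hmean (s.comp w)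
      rw [covariance, e1, e2, hs]
      have : ∀ x, ((v ∘ R) x - 0) * (w x * s 1 - 0) = s 1 * (w x * v x - c⁻¹ * v a * (w x * w x)) := by
        intro x
        simp only [Function.comp, hRx, map_sub, map_smul, smul_eq_mul]
        ring
      simp only [this]
      have i1 : Integrable (fun x => w x * v x) μ := (hmem w).integrable_mul (hmem v)
      have i2 : Integrable (fun x => w x * w x) μ := (hmem w).integrable_mul (hmem w)
      rw [integral_const_mul, integral_sub i1 (i2.const_mul _), integral_const_mul, ← hva v, ← hc2]
      field_simp
      simp
    have hRm : Measurable R := R.measurable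
    have hwm : Measurable w := w.measurable
    have hmap : μ.map (fun x => (R x, w x)) = (μ.map R).prod (μ.map w) :=
      (indepFun_iff_map_prod_eq_prod_map_map hRm.aemeasurable hwm.aemeasurable).1 hind
    have hwlaw : μ.map w = gaussianReal 0 c.toNNReal := by
      rw [IsGaussian.map_eq_gaussianReal w, hmean w, variance_of_integral_eq_zero
        hwm.aemeasurable (hmean w)]
      congr 2
      rw [hc2]
      congr 1
      ext y
      ring
    have hcn : c.toNNReal ≠ 0 := by simpa using hc0
    have hcc : (c.toNNReal : ℝ) = c := Real.coe_toNNReal _ hc0.le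
    have hprodm : Measurable fun x => (R x, w x) := hRm.prodMk hwm
    -- `J` reassembles `x` from its residual part and its value under `w`, and so carries the
    -- product law back to `μ`.
    set J : F × ℝ → F := fun q => q.1 + (c⁻¹ * q.2) • a with hJ
    have hJm : Measurable J := by
      have : Continuous J := by fun_prop
      exact this.measurable
    have hJx : ∀ x, J (R x, w x) = x := fun x => by simp [hJ, hRx]
    have hJmap : ((μ.map R).prod (μ.map w)).map J = μ := by
      rw [← hmap, Measure.map_map hJm hprodm]
      convert Measure.map_id
      ext x
      exact hJx x
    have trans : ∀ {g : F → ℝ}, Integrable g μ →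
        Integrable (fun q => g (J q)) ((μ.map R).prod (gaussianReal 0 c.toNNReal)) ∧
        ∫ x, g x ∂μ = ∫ y, ∫ s, g (J (y, s)) ∂(gaussianReal 0 c.toNNReal) ∂(μ.map R) := by
      intro g hg
      have hm : MeasurePreserving J ((μ.map R).prod (μ.map w)) μ := ⟨hJm, hJmap⟩
      rw [hwlaw] at hm
      have h1 : Integrable (fun q => g (J q)) ((μ.map R).prod (gaussianReal 0 c.toNNReal)) :=
        (hm.integrable_comp hg.aestronglyMeasurable).2 hg
      have : IsProbabilityMeasure (μ.map R) := Measure.isProbabilityMeasure_map hRm.aemeasurable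
      refine ⟨h1, ?_⟩
      rw [← integral_prod (fun q => g (J q)) h1]
      conv_lhs => rw [← hm.map_eq]
      exact integral_map hJm.aemeasurable (by rw [hm.map_eq]; exact hg.aestronglyMeasurable)
    have hwJ : ∀ y s, y ∈ LinearMap.ker (w : F →ₗ[ℝ] ℝ) → w (J (y, s)) = s := by
      intro y s hy
      have hy' : w y = 0 := hy
      simp only [hJ, map_add, map_smul, hy', smul_eq_mul, ← hc]
      field_simp
      simp
    -- The residual part has no `w` component since `w a = c`. Hence the real coordinate of `J` is
    -- exactly the value of `w`.
    have hker : ∀ᵐ y ∂(μ.map R), w y = 0 := by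
      have hms : MeasurableSet {y | w y = 0} := hwm (measurableSet_singleton 0)
      rw [ae_map_iff hRm.aemeasurable hms]
      refine ae_of_all _ fun x => ?_
      rw [hRx, map_sub, map_smul, smul_eq_mul, ← hc]
      field_simp
      simp
    have : IsProbabilityMeasure (μ.map R) := Measure.isProbabilityMeasure_map hRm.aemeasurable
    rw [(trans hwi).2, (trans hi').2]
    refine integral_congr_ae ?_
    filter_upwards [hker, (trans hi).1.prod_right_ae, (trans hi').1.prod_right_ae,
      (trans hwi).1.prod_right_ae] with y hy j1 j2 j3
    have hs : ∀ s, w (J (y, s)) = s := fun s => hwJ y s hy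
    simp only [hs] at j3 ⊢
    have hder : ∀ s, HasDerivAt (fun s => G (J (y, s))) (c⁻¹ * G' (J (y, s))) s := by
      intro s
      have h1 : HasDerivAt (fun t : ℝ => c⁻¹ * (t - s)) c⁻¹ s := by
        simpa using ((hasDerivAt_id s).sub_const s).const_mul c⁻¹
      have h2 : HasDerivAt (fun t : ℝ => G (J (y, s) + t • a)) (G' (J (y, s))) (c⁻¹ * (s - s)) := by
        simpa using hd (J (y, s))
      have h3 := h2.comp s h1
      have e : (fun s => G (J (y, s))) =
          (fun t : ℝ => G (J (y, s) + t • a)) ∘ fun t : ℝ => c⁻¹ * (t - s) := by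
        ext t
        simp only [hJ, Function.comp, add_assoc, ← add_smul]
        congr 3
        ring
      rw [mul_comm, e]
      exact h3
    rw [integral_id_mul_gaussianReal hcn hder j1 (j2.const_mul _) j3, integral_const_mul, hcc]
    field_simp

end GaussianIntegrationByParts

end

/-! ### Products of Gaussian laws, and the interpolating Hamiltonian. -/

section

section ProductMeasures

variable {ι E : Type*} [Fintype ι] [NormedAddCommGroup E] [NormedSpace ℝ E] [MeasurableSpace E]
  [BorelSpace E] [SecondCountableTopology E] [CompleteSpace E]

lemma isGaussian_pi (γ : ι → Measure E) [∀ i, IsGaussian (γ i)] : IsGaussian (Measure.pi γ) := by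
  have h := iIndepFun.hasGaussianLaw (P := Measure.pi γ) (X := fun i (z : ι → E) => z i)
    (fun i => by
      have : IsGaussian ((Measure.pi γ).map fun z : ι → E => z i) := by
        have e : (Measure.pi γ).map (fun z : ι → E => z i) = γ i :=
          (measurePreserving_eval γ i).map_eq
        rw [e]; infer_instance
      exact IsGaussian.hasGaussianLaw)
    (iIndepFun_pi (X := fun _ x => x) fun i => aemeasurable_id)
  have := h.isGaussian_map
  rwa [show (fun ω : ι → E => fun i => ω i) = id from rfl, Measure.map_id] at this

lemma integral_id_pi_eq_zero (γ : ι → Measure E) [∀ i, IsGaussian (γ i)]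
    (h0 : ∀ i, ∫ x, x ∂(γ i) = 0) : ∫ z, z ∂(Measure.pi γ) = 0 := by
  have : IsGaussian (Measure.pi γ) := isGaussian_pi γ
  have hi : Integrable (fun z : ι → E => z) (Measure.pi γ) := IsGaussian.integrable_id
  ext i
  have := (ContinuousLinearMap.proj (R := ℝ) (φ := fun _ : ι => E) i).integral_comp_comm hi
  simp only [ContinuousLinearMap.proj_apply] at this
  rw [← this, Pi.zero_apply, ← h0 i]
  exact integral_comp_eval (μ := γ) (f := fun x => x) aestronglyMeasurable_id

/-- Distinct coordinates are independent and centered, so only the diagonal contributes. -/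
lemma integral_dual_mul_dual_pi [DecidableEq ι] (γ : ι → Measure E) [∀ i, IsGaussian (γ i)]
    (h0 : ∀ i, ∫ x, x ∂(γ i) = 0) (v w : StrongDual ℝ E) (i j : ι) :
    ∫ z, v (z i) * w (z j) ∂(Measure.pi γ) = if i = j then ∫ x, v x * w x ∂(γ i) else 0 := by
  split_ifs with h
  · subst h
    exact integral_comp_eval (μ := γ) (f := fun x => v x * w x)
      (v.measurable.mul w.measurable).aestronglyMeasurable
  · have hind : iIndepFun (fun i (z : ι → E) => z i) (Measure.pi γ) :=
      iIndepFun_pi (X := fun _ x => x) fun i => aemeasurable_id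
    have h1 : IndepFun (fun z : ι → E => v (z i)) (fun z => w (z j)) (Measure.pi γ) :=
      (hind.indepFun h).comp v.measurable w.measurable
    rw [h1.integral_fun_mul_eq_mul_integral
      (v.measurable.comp (measurable_pi_apply i)).aestronglyMeasurable
      (w.measurable.comp (measurable_pi_apply j)).aestronglyMeasurable,
      integral_comp_eval (μ := γ) (f := v) v.measurable.aestronglyMeasurable,
      IsGaussian.integral_dual, h0, map_zero, zero_mul]

end ProductMeasures

namespace Cascade

variable {k : ℕ} {E T A : Type*} [NormedAddCommGroup E] [NormedSpace ℝ E] [MeasurableSpace E]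
  [BorelSpace E] [SecondCountableTopology E] [CompleteSpace E] [MeasurableSpace T]
  [MeasurableSpace A]

/-- The sum of the values on the fields of level less than `l` of a linear form. -/
def fieldForm (L : T → StrongDual ℝ E) (l : ℕ) (σ : T) (z : Fin (k + 1) → E) : ℝ :=
  ∑ p : Fin (k + 1), if (p : ℕ) < l then L σ (z p) else 0

/-- The Hamiltonian interpolating between a function `G` and a sum of independent fields, in the
presence of an external field `b`. -/
def pathHam (b : T → ℝ) (L : T → StrongDual ℝ E) (G : T → ℝ) (t : ℝ) (σ : T)
    (z : Fin (k + 1) → E) : ℝ :=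
  √t * G σ + b σ + √(1 - t) * fieldForm L (k + 1) σ z

/-- The standing assumptions on an interpolation: the fields are centered Gaussian, and the
external field and the linear forms are bounded. -/
structure Admissible (K : Cascade k E T) (b : T → ℝ) (L : T → StrongDual ℝ E) (M : ℝ) : Prop where
  m_zero : K.m 0 = 0
  m_last : K.m k = 1
  m_pos : ∀ l, 1 ≤ l → l ≤ k → 0 < K.m l
  centered : ∀ p, ∫ x, x ∂(K.γ p) = 0
  b_meas : Measurable b
  L_meas : Measurable fun q : T × E => L q.1 q.2
  b_le : ∀ σ, |b σ| ≤ M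
  L_le : ∀ σ, ‖L σ‖ ≤ M

/-- The covariance structure at level `l` of the interpolation. -/
def kernel {Ω : Type*} [MeasurableSpace Ω] (K : Cascade k E T) (L : T → StrongDual ℝ E)
    (P : Measure Ω) (G : T → Ω → ℝ) (l : ℕ) (σ ρ : T) : ℝ :=
  ∫ ω, G σ ω * G ρ ω ∂P - ∑ p : Fin (k + 1), if (p : ℕ) < l then ∫ x, L σ x * L ρ x ∂(K.γ p) else 0

/-- The interpolated free energy. -/
def pathEnergy {Ω : Type*} [MeasurableSpace Ω] (K : Cascade k E T) (b : T → ℝ)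
    (L : T → StrongDual ℝ E) (P : Measure Ω) (G : T → Ω → ℝ) (t : ℝ) : ℝ :=
  ∫ q, K.X (pathHam b L (fun σ => G σ q.1) t) 1 q.2 ∂(P.prod K.law)

/-- The average of a function of a configuration along the interpolation. -/
def pathAvg {Ω : Type*} [MeasurableSpace Ω] (K : Cascade k E T) (b : T → ℝ)
    (L : T → StrongDual ℝ E) (P : Measure Ω) (G : T → Ω → ℝ) (f : T → ℝ) (t : ℝ) : ℝ :=
  ∫ q, K.prodW (pathHam b L (fun σ => G σ q.1) t) (k + 1) q.2 *
    K.avg (pathHam b L (fun σ => G σ q.1) t) (k + 1) f q.2 ∂(P.prod K.law)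

/-- The average of a function of two configurations drawn with density `D_l`. -/
def pathPair {Ω : Type*} [MeasurableSpace Ω] (K : Cascade k E T) (b : T → ℝ)
    (L : T → StrongDual ℝ E) (P : Measure Ω) (G : T → Ω → ℝ) (l : ℕ) (f : T → T → ℝ) (t : ℝ) : ℝ :=
  ∫ q, K.pairDensity (pathHam b L (fun σ => G σ q.1) t) l l f q.2 ∂(P.prod K.law)

/-- The derivative of the interpolated free energy. -/
def pathDeriv {Ω : Type*} [MeasurableSpace Ω] (K : Cascade k E T) (b : T → ℝ)
    (L : T → StrongDual ℝ E) (P : Measure Ω) (G : T → Ω → ℝ) (t : ℝ) : ℝ :=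
  (1 / 2) * (K.pathAvg b L P G (fun σ => K.kernel L P G (k + 1) σ σ) t -
    ∑ l ∈ Finset.Icc 1 k, (K.m l - K.m (l - 1)) * K.pathPair b L P G l (K.kernel L P G l) t)

variable {K : Cascade k E T} {b : T → ℝ} {L : T → StrongDual ℝ E} {M : ℝ}

lemma fieldForm_add (l : ℕ) (σ : T) (z z' : Fin (k + 1) → E) :
    fieldForm L l σ (z + z') = fieldForm L l σ z + fieldForm L l σ z' := by
  simp only [fieldForm, ← Finset.sum_add_distrib]
  refine Finset.sum_congr rfl fun p _ => ?_
  split_ifs <;> simp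

lemma fieldForm_smul (l : ℕ) (σ : T) (c : ℝ) (z : Fin (k + 1) → E) :
    fieldForm L l σ (c • z) = c * fieldForm L l σ z := by
  simp only [fieldForm, Finset.mul_sum]
  refine Finset.sum_congr rfl fun p _ => ?_
  split_ifs <;> simp

lemma fieldForm_zero (l : ℕ) (σ : T) : fieldForm L l σ (0 : Fin (k + 1) → E) = 0 := by
  simp [fieldForm]

/-- Truncating a direction at level `l` is the same as summing the form over the levels below `l`.
This is where the kernel of level `l` acquires its truncated sum. -/
lemma fieldForm_merge (l : ℕ) (σ : T) (z : Fin (k + 1) → E) :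
    fieldForm L (k + 1) σ (merge l z 0) = fieldForm L l σ z := by
  simp only [fieldForm]
  refine Finset.sum_congr rfl fun p _ => ?_
  rw [if_pos p.2, merge]
  split_ifs <;> simp

lemma abs_fieldForm_le (hL : ∀ σ, ‖L σ‖ ≤ M) (l : ℕ) (σ : T) (z : Fin (k + 1) → E) :
    |fieldForm L l σ z| ≤ (k + 1) * M * ‖z‖ := by
  have hM : 0 ≤ M := (norm_nonneg _).trans (hL σ)
  calc |fieldForm L l σ z| ≤ ∑ p : Fin (k + 1), |if (p : ℕ) < l then L σ (z p) else 0| :=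
        Finset.abs_sum_le_sum_abs _ _
    _ ≤ ∑ _p : Fin (k + 1), M * ‖z‖ := by
        refine Finset.sum_le_sum fun p _ => ?_
        split_ifs
        · exact ((L σ).le_opNorm _).trans (mul_le_mul (hL σ) (norm_le_pi_norm z p)
            (norm_nonneg _) hM)
        · simp only [abs_zero]; positivity
    _ = _ := by simp; ring

lemma measurable_fieldForm (hL : Measurable fun q : T × E => L q.1 q.2) (l : ℕ) :
    Measurable fun q : T × (Fin (k + 1) → E) => fieldForm L l q.1 q.2 := by
  refine Finset.measurable_sum _ fun p _ => ?_
  split_ifs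
  · exact hL.comp (measurable_fst.prodMk ((measurable_pi_apply p).comp measurable_snd))
  · exact measurable_const

lemma measurable_pathHam (hL : Measurable fun q : T × E => L q.1 q.2) (hb : Measurable b)
    {G : A → T → ℝ} (hG : Measurable fun q : A × T => G q.1 q.2) (t : ℝ) :
    Measurable fun q : A × T × (Fin (k + 1) → E) => pathHam b L (G q.1) t q.2.1 q.2.2 := by
  refine ((Measurable.const_mul ?_ _).add (hb.comp measurable_snd.fst)).add
    (Measurable.const_mul ((measurable_fieldForm hL (k + 1)).comp measurable_snd) _)
  exact hG.comp (measurable_fst.prodMk measurable_snd.fst)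

lemma pathHam_zero (G : T → ℝ) (t : ℝ) (σ : T) :
    pathHam b L G t σ (0 : Fin (k + 1) → E) = √t * G σ + b σ := by
  simp [pathHam, fieldForm_zero]

/-- The interpolating Hamiltonian has a rate of variation that does not depend on `t` or `G`. -/
lemma Admissible.nice [IsFiniteMeasure K.ν] (h : K.Admissible b L M) {G : T → ℝ}
    (hG : Measurable G) {t : ℝ} (ht0 : 0 ≤ t)
    (hi : Integrable (fun σ => Real.exp (√t * G σ)) K.ν) :
    K.Nice ((k + 1) * M) (pathHam b L G t) where
  meas := (measurable_pathHam h.L_meas h.b_meas (A := Unit) (G := fun _ => G)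
    (hG.comp measurable_snd) t).comp (measurable_prodMk_left (x := ()))
  int := by
    simp only [pathHam_zero, Real.exp_add]
    refine hi.mul_bdd (Real.measurable_exp.comp h.b_meas).aestronglyMeasurable (c := Real.exp M)
      (ae_of_all _ fun σ => ?_)
    change ‖Real.exp (b σ)‖ ≤ _
    rw [Real.norm_eq_abs, Real.abs_exp]
    exact Real.exp_le_exp.2 (abs_le.1 (h.b_le σ)).2
  bound σ z := by
    have h1 : √(1 - t) ≤ 1 := Real.sqrt_le_one.2 (by linarith)
    rw [pathHam_zero, pathHam, add_sub_cancel_left, abs_mul, abs_of_nonneg (Real.sqrt_nonneg _)]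
    exact (mul_le_of_le_one_left (abs_nonneg _) h1).trans (abs_fieldForm_le h.L_le (k + 1) σ z)

lemma Admissible.M_nonneg [Nonempty T] (h : K.Admissible b L M) : 0 ≤ M :=
  (abs_nonneg _).trans (h.b_le (Classical.arbitrary T))

instance isGaussian_law [∀ p, IsGaussian (K.γ p)] : IsGaussian K.law := isGaussian_pi K.γ

lemma Admissible.regular [∀ p, IsGaussian (K.γ p)] (h : K.Admissible b L M) : K.Regular where
  exp_int := integrable_exp_norm_of_isGaussian K.law
  m_pos := h.m_pos

/-- The logarithm of the density of the Gibbs measure under all changes of measure. -/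
lemma prodW_mul_D_top [NeZero K.ν] {Y : T → (Fin (k + 1) → E) → ℝ} {C : ℝ} (hY : K.Nice C Y)
    (hk : 1 ≤ k) (h0 : K.m 0 = 0) (h1 : K.m k = 1) (σ : T) (z : Fin (k + 1) → E) :
    K.prodW Y (k + 1) z * K.D Y σ (k + 1) z =
      Real.exp (Y σ z - ∑ l ∈ Finset.Icc 1 k, (K.m l - K.m (l - 1)) * K.X Y l z) := by
  rw [hY.D_top_eq (Nat.lt_succ_self k), prodW]
  simp only [W]
  rw [← Real.exp_sum, ← Real.exp_add]
  congr 1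
  -- Summation by parts. The boundary term at the lower end is `m 1 * X 1`, which fits the pattern
  -- because `m 0 = 0`.
  have key : ∀ j, 1 ≤ j → ∑ i ∈ Finset.Ico 1 (j + 1), K.m i * (K.X Y (i + 1) z - K.X Y i z) =
      K.m j * K.X Y (j + 1) z - ∑ l ∈ Finset.Icc 1 j, (K.m l - K.m (l - 1)) * K.X Y l z := by
    intro j hj
    induction j, hj using Nat.le_induction with
    | base => simp [h0]; ring
    | succ j hj ih =>
      rw [Finset.sum_Ico_succ_top (by omega), ih, Finset.sum_Icc_succ_top (by omega)]
      simp only [Nat.add_sub_cancel]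
      ring
  -- Since `m k = 1`, the boundary term at the upper end cancels the normalization of the Gibbs
  -- density.
  rw [key k hk, h1]
  ring

end Cascade

end

/-! ### Averages over both the disorder and the fields. -/

section

namespace Cascade

variable {k : ℕ} {E T Ω : Type*} [NormedAddCommGroup E] [NormedSpace ℝ E] [MeasurableSpace E]
  [BorelSpace E] [SecondCountableTopology E] [CompleteSpace E] [MeasurableSpace T]
  [MeasurableSpace Ω] {K : Cascade k E T} {P : Measure Ω} [IsProbabilityMeasure P]
  [∀ p, IsProbabilityMeasure (K.γ p)] [NeZero K.ν] [IsFiniteMeasure K.ν] {C : ℝ}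
  {Y : Ω → T → (Fin (k + 1) → E) → ℝ}

lemma ae_prod_of_ae_fst {p : Ω → Prop} (h : ∀ᵐ ω ∂P, p ω) :
    ∀ᵐ q ∂(P.prod K.law), p q.1 :=
  Measure.quasiMeasurePreserving_fst.ae h

/-- The bound on the product of the `W` is the same for almost all realizations of the disorder, so
no integrability in the disorder is needed beyond the boundedness of `f`. -/
lemma Regular.integrable_prodW_mul (hK : K.Regular) (hC : 0 ≤ C)
    (hm : Measurable fun q : Ω × T × (Fin (k + 1) → E) => Y q.1 q.2.1 q.2.2)
    (hY : ∀ᵐ ω ∂P, K.Nice C (Y ω)) (j : ℕ) {f : Ω × (Fin (k + 1) → E) → ℝ} (hf : Measurable f)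
    {B : ℝ} (hB : ∀ᵐ ω ∂P, ∀ z, |f (ω, z)| ≤ B) :
    Integrable (fun q => K.prodW (Y q.1) j q.2 * f q) (P.prod K.law) := by
  obtain ⟨C', hC', H⟩ := hK.exists_prodW_le hC j
  have hi : Integrable (fun q : Ω × (Fin (k + 1) → E) => B * Real.exp (C' * (1 + ‖q.2‖)))
      (P.prod K.law) :=
    (integrable_const (μ := P) B).mul_prod (hK.integrable_exp_one_add C')
  refine hi.mono' ((measurable_prodW hm j).mul hf).aestronglyMeasurable ?_
  filter_upwards [ae_prod_of_ae_fst hY, ae_prod_of_ae_fst hB] with q h1 h2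
  rw [Real.norm_eq_abs, abs_mul, abs_of_pos (prodW_pos j _), mul_comm]
  exact mul_le_mul (h2 q.2) (H _ h1 q.2) (prodW_pos j _).le ((abs_nonneg _).trans (h2 q.2))

lemma Regular.integrable_prodW_mul_avg (hK : K.Regular) (hC : 0 ≤ C)
    (hm : Measurable fun q : Ω × T × (Fin (k + 1) → E) => Y q.1 q.2.1 q.2.2)
    (hY : ∀ᵐ ω ∂P, K.Nice C (Y ω)) (j : ℕ) {l : ℕ} (hl : 1 ≤ l) {f : T → ℝ} (hf : Measurable f)
    {B : ℝ} (hB : ∀ σ, |f σ| ≤ B) :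
    Integrable (fun q => K.prodW (Y q.1) j q.2 * K.avg (Y q.1) l f q.2) (P.prod K.law) :=
  hK.integrable_prodW_mul hC hm hY j
    (measurable_avg (u := fun _ => f) hm l hl (hf.comp measurable_snd))
    (B := B) (hY.mono fun _ h => hK.abs_avg_le hC h hl hB)

lemma Regular.integrable_pairDensity (hK : K.Regular) (hC : 0 ≤ C)
    (hm : Measurable fun q : Ω × T × (Fin (k + 1) → E) => Y q.1 q.2.1 q.2.2)
    (hY : ∀ᵐ ω ∂P, K.Nice C (Y ω)) {j l : ℕ} (hj : 1 ≤ j) (hl : 1 ≤ l) {f : T → T → ℝ}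
    (hf : Measurable fun q : T × T => f q.1 q.2) {B : ℝ} (hB : ∀ σ ρ, |f σ ρ| ≤ B) :
    Integrable (fun q => K.pairDensity (Y q.1) j l f q.2) (P.prod K.law) :=
  hK.integrable_prodW_mul hC hm hY j (measurable_avg_avg hm hj hl hf)
    (B := B) (hY.mono fun _ h => hK.abs_avg_avg_le hC h hj hl hB)

lemma Regular.integral_prodW_prod (hK : K.Regular) (hC : 0 ≤ C)
    (hm : Measurable fun q : Ω × T × (Fin (k + 1) → E) => Y q.1 q.2.1 q.2.2)
    (hY : ∀ᵐ ω ∂P, K.Nice C (Y ω)) {l : ℕ} (h1 : 1 ≤ l) (hl : l ≤ k + 1) :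
    ∫ q, K.prodW (Y q.1) l q.2 ∂(P.prod K.law) = 1 := by
  have hi := hK.integrable_prodW_mul hC hm hY l (f := fun _ => 1) measurable_const (B := 1) (by simp)
  simp only [mul_one] at hi
  rw [integral_prod _ hi]
  have : ∀ᵐ ω ∂P, ∫ z, K.prodW (Y ω) l z ∂K.law = 1 :=
    hY.mono fun ω h => hK.integral_prodW hC h h1 hl
  rw [integral_congr_ae this]
  simp

/-- Averages against `W_1 ⋯ W_{l-1}` are bounded like the averaged function. -/
lemma Regular.abs_integral_prodW_mul_le (hK : K.Regular) (hC : 0 ≤ C)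
    (hm : Measurable fun q : Ω × T × (Fin (k + 1) → E) => Y q.1 q.2.1 q.2.2)
    (hY : ∀ᵐ ω ∂P, K.Nice C (Y ω)) {l : ℕ} (h1 : 1 ≤ l) (hl : l ≤ k + 1)
    {f : Ω × (Fin (k + 1) → E) → ℝ} {B : ℝ} (hB : ∀ᵐ ω ∂P, ∀ z, |f (ω, z)| ≤ B) :
    |∫ q, K.prodW (Y q.1) l q.2 * f q ∂(P.prod K.law)| ≤ B := by
  have hi := hK.integrable_prodW_mul hC hm hY l (f := fun _ => B) measurable_const (B := |B|)
    (by simp)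
  calc |∫ q, K.prodW (Y q.1) l q.2 * f q ∂(P.prod K.law)|
      ≤ ∫ q, K.prodW (Y q.1) l q.2 * B ∂(P.prod K.law) := by
        rw [← Real.norm_eq_abs]
        refine norm_integral_le_of_norm_le hi ?_
        filter_upwards [ae_prod_of_ae_fst hB] with q h2
        rw [Real.norm_eq_abs, abs_mul, abs_of_pos (prodW_pos l _)]
        exact mul_le_mul_of_nonneg_left (h2 q.2) (prodW_pos l _).le
    _ = B := by rw [integral_mul_const, hK.integral_prodW_prod hC hm hY h1 hl, one_mul]

lemma Regular.integral_pairDensity_prod_eq (hK : K.Regular) (hC : 0 ≤ C)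
    (hm : Measurable fun q : Ω × T × (Fin (k + 1) → E) => Y q.1 q.2.1 q.2.2)
    (hY : ∀ᵐ ω ∂P, K.Nice C (Y ω)) {j l : ℕ} (hl : 1 ≤ l) (hlj : l ≤ j) (hj : j ≤ k + 1)
    {f : T → T → ℝ} (hf : Measurable fun q : T × T => f q.1 q.2) {B : ℝ}
    (hB : ∀ σ ρ, |f σ ρ| ≤ B) :
    ∫ q, K.pairDensity (Y q.1) j l f q.2 ∂(P.prod K.law) =
      ∫ q, K.pairDensity (Y q.1) l l f q.2 ∂(P.prod K.law) := by
  rw [integral_prod _ (hK.integrable_pairDensity hC hm hY (hl.trans hlj) hl hf hB),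
    integral_prod _ (hK.integrable_pairDensity hC hm hY hl hl hf hB)]
  exact integral_congr_ae (hY.mono fun ω h => hK.integral_pairDensity_eq hC h hl hlj hj hf hB)

variable {b : T → ℝ} {L : T → StrongDual ℝ E} {M : ℝ} {G : T → Ω → ℝ}

lemma measurable_kernel (hL : Measurable fun q : T × E => L q.1 q.2)
    (hG : Measurable fun q : T × Ω => G q.1 q.2) (l : ℕ) :
    Measurable fun q : T × T => K.kernel L P G l q.1 q.2 := by
  refine Measurable.sub ?_ (Finset.measurable_sum _ fun p _ => ?_)
  · exact measurable_integral_snd (f := fun (q : T × T) ω => G q.1 ω * G q.2 ω)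
      ((hG.comp (measurable_fst.fst.prodMk measurable_snd)).mul
        (hG.comp (measurable_fst.snd.prodMk measurable_snd)))
  · split_ifs
    · exact measurable_integral_snd (f := fun (q : T × T) x => L q.1 x * L q.2 x)
        ((hL.comp (measurable_fst.fst.prodMk measurable_snd)).mul
          (hL.comp (measurable_fst.snd.prodMk measurable_snd)))
    · exact measurable_const

lemma abs_integral_mul_le_of_sq_le {f g : Ω → ℝ} (hf : MemLp f 2 P) (hg : MemLp g 2 P) {V : ℝ}
    (hfV : ∫ ω, f ω ^ 2 ∂P ≤ V) (hgV : ∫ ω, g ω ^ 2 ∂P ≤ V) : |∫ ω, f ω * g ω ∂P| ≤ V := by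
  calc |∫ ω, f ω * g ω ∂P| ≤ ∫ ω, (f ω ^ 2 + g ω ^ 2) / 2 ∂P := by
        refine abs_integral_le_of_forall_abs_le ((hf.integrable_sq.add hg.integrable_sq).div_const 2)
          fun ω => ?_
        rw [abs_le]
        constructor <;> nlinarith [sq_nonneg (f ω + g ω), sq_nonneg (f ω - g ω)]
    _ = (∫ ω, f ω ^ 2 ∂P + ∫ ω, g ω ^ 2 ∂P) / 2 := by
        rw [integral_div, integral_add hf.integrable_sq hg.integrable_sq]
    _ ≤ V := by linarith

/-- The part of the kernel due to the process is bounded by its variance, and the part due to the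
fields by their second moments. The constant `c` involves only the latter, so it is common to a
process and all its approximations. -/
lemma Admissible.exists_abs_kernel_le [∀ p, IsGaussian (K.γ p)] (h : K.Admissible b L M) :
    ∃ c, ∀ (l : ℕ) (σ ρ : T) {Ω : Type*} [MeasurableSpace Ω] (P : Measure Ω)
      [IsProbabilityMeasure P] (G : T → Ω → ℝ) (V : ℝ),
      MemLp (G σ) 2 P → MemLp (G ρ) 2 P → ∫ ω, G σ ω ^ 2 ∂P ≤ V → ∫ ω, G ρ ω ^ 2 ∂P ≤ V →
      |K.kernel L P G l σ ρ| ≤ V + c := by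
  refine ⟨∑ p, M ^ 2 * ∫ x, ‖x‖ ^ 2 ∂(K.γ p), ?_⟩
  intro l σ ρ Ω _ P _ G V h1 h2 h3 h4
  refine (abs_sub _ _).trans (add_le_add (abs_integral_mul_le_of_sq_le h1 h2 h3 h4)
    ((Finset.abs_sum_le_sum_abs _ _).trans (Finset.sum_le_sum fun p _ => ?_)))
  have hx : Integrable (fun x : E => ‖x‖ ^ 2) (K.γ p) :=
    (IsGaussian.memLp_two_id (μ := K.γ p)).integrable_norm_pow (by norm_num)
  split_ifs
  · rw [← integral_const_mul]
    refine abs_integral_le_of_forall_abs_le (hx.const_mul _) fun x => ?_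
    rw [abs_mul]
    have a1 := ((L σ).le_opNorm x).trans (mul_le_mul_of_nonneg_right (h.L_le σ) (norm_nonneg x))
    have a2 := ((L ρ).le_opNorm x).trans (mul_le_mul_of_nonneg_right (h.L_le ρ) (norm_nonneg x))
    rw [Real.norm_eq_abs] at a1 a2
    calc _ ≤ (M * ‖x‖) * (M * ‖x‖) :=
          mul_le_mul a1 a2 (abs_nonneg _) ((abs_nonneg _).trans a1)
      _ = _ := by ring
  · rw [abs_zero]
    exact mul_nonneg (sq_nonneg M) (integral_nonneg fun x => by positivity)

/-- The Gibbs weights lie between `exp (-B)` and `exp B`; the mass of `ν`, which need not be `1`,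
accounts for the second term. -/
lemma abs_X_top_zero_le {Y : T → (Fin (k + 1) → E) → ℝ} (hY : K.Nice C Y) {B : ℝ}
    (hB : ∀ σ, |Y σ 0| ≤ B) :
    |K.X Y (k + 1) 0| ≤ B + |Real.log (K.ν.real univ)| := by
  have hν : 0 < K.ν.real univ := by
    rw [Measure.real, ENNReal.toReal_pos_iff]
    exact ⟨Measure.measure_univ_pos.2 (NeZero.ne K.ν), measure_lt_top _ _⟩
  rw [X_top (Nat.lt_succ_self k)]
  have h1 : ∫ σ, Real.exp (Y σ 0) ∂K.ν ≤ Real.exp B * K.ν.real univ := by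
    calc _ ≤ ∫ _, Real.exp B ∂K.ν := integral_mono (hY.integrable_exp 0) (integrable_const _)
          fun σ => Real.exp_le_exp.2 (abs_le.1 (hB σ)).2
      _ = _ := by simp [mul_comm]
  have h2 : Real.exp (-B) * K.ν.real univ ≤ ∫ σ, Real.exp (Y σ 0) ∂K.ν := by
    calc _ = ∫ _, Real.exp (-B) ∂K.ν := by simp [mul_comm]
      _ ≤ _ := integral_mono (integrable_const _) (hY.integrable_exp 0)
          fun σ => Real.exp_le_exp.2 (abs_le.1 (hB σ)).1
  have h3 := Real.log_le_log (hY.integral_exp_pos 0) h1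
  have h4 := Real.log_le_log (by positivity) h2
  rw [Real.log_mul (Real.exp_pos _).ne' hν.ne', Real.log_exp] at h3 h4
  rw [abs_le]
  constructor <;> linarith [le_abs_self (Real.log (K.ν.real univ)),
    neg_abs_le (Real.log (K.ν.real univ))]

/-- Integrability of the recursion from integrability of its value at the origin. -/
lemma Regular.integrable_X (hK : K.Regular) (hC : 0 ≤ C)
    (hm : Measurable fun q : Ω × T × (Fin (k + 1) → E) => Y q.1 q.2.1 q.2.2)
    (hY : ∀ᵐ ω ∂P, K.Nice C (Y ω)) {B : Ω → ℝ} (hB : Integrable B P)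
    (h0 : ∀ᵐ ω ∂P, |K.X (Y ω) (k + 1) 0| ≤ B ω) {l : ℕ} (hl : 1 ≤ l) :
    Integrable (fun q => K.X (Y q.1) l q.2) (P.prod K.law) := by
  obtain ⟨C', hC', H⟩ := hK.exists_abs_X_sub_le hC l hl
  have i1 : Integrable (fun q : Ω × (Fin (k + 1) → E) => B q.1) (P.prod K.law) := hB.comp_fst _
  have i2 : Integrable (fun z : Fin (k + 1) → E => C' * (1 + ‖z‖)) K.law := by
    refine (hK.integrable_exp_one_add C').mono' (by fun_prop) (ae_of_all _ fun z => ?_)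
    rw [Real.norm_eq_abs, abs_of_nonneg (by positivity)]
    linarith [Real.add_one_le_exp (C' * (1 + ‖z‖))]
  refine (i1.add (i2.comp_snd P)).mono' (measurable_X hm l hl).aestronglyMeasurable ?_
  filter_upwards [ae_prod_of_ae_fst hY, ae_prod_of_ae_fst h0] with q h1 h2
  have h3 := abs_le.1 (H _ h1 q.2)
  have h4 := abs_le.1 h2
  simp only [Real.norm_eq_abs, Pi.add_apply]
  rw [abs_le]
  constructor <;> linarith

end Cascade

end

/-! ### Covariances of linear forms in the disorder and the fields. -/

section

namespace Cascade

variable {k : ℕ} {E T F : Type*} [NormedAddCommGroup E] [NormedSpace ℝ E] [MeasurableSpace E]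
  [BorelSpace E] [SecondCountableTopology E] [CompleteSpace E] [MeasurableSpace T]
  [NormedAddCommGroup F] [NormedSpace ℝ F] [MeasurableSpace F]
  [BorelSpace F] [SecondCountableTopology F] [CompleteSpace F]
  {K : Cascade k E T} {b : T → ℝ} {L : T → StrongDual ℝ E} {M : ℝ} {μ : Measure F}
  {g : T → StrongDual ℝ F}

/-- The continuous linear form `(y, z) ↦ α g_σ(y) + α' ∑_{p < l} L_σ(z_p)`. -/
def jointForm (k : ℕ) (g : T → StrongDual ℝ F) (L : T → StrongDual ℝ E) (α α' : ℝ) (l : ℕ) (σ : T) :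
    StrongDual ℝ (F × (Fin (k + 1) → E)) :=
  α • (g σ).comp (ContinuousLinearMap.fst ℝ F (Fin (k + 1) → E)) +
    α' • ∑ p : Fin (k + 1), if (p : ℕ) < l then
      (L σ).comp ((ContinuousLinearMap.proj (R := ℝ) (φ := fun _ : Fin (k + 1) => E) p).comp
        (ContinuousLinearMap.snd ℝ F (Fin (k + 1) → E))) else 0

lemma jointForm_apply (α α' : ℝ) (l : ℕ) (σ : T) (x : F × (Fin (k + 1) → E)) :
    jointForm k g L α α' l σ x = α * g σ x.1 + α' * fieldForm L l σ x.2 := by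
  simp only [jointForm, fieldForm, add_apply, smul_apply,
    ContinuousLinearMap.comp_apply, sum_apply, smul_eq_mul,
    ContinuousLinearMap.coe_fst']
  congr 2
  refine Finset.sum_congr rfl fun p _ => ?_
  split_ifs <;> simp

attribute [irreducible] jointForm

/-- The fields of different levels are independent and centered, so the double sum reduces to the
levels common to both forms, those below `l`. -/
lemma integral_fieldForm_mul [∀ p, IsGaussian (K.γ p)] (h0 : ∀ p, ∫ x, x ∂(K.γ p) = 0) (l : ℕ)
    (σ ρ : T) :
    ∫ z, fieldForm L (k + 1) σ z * fieldForm L l ρ z ∂K.law =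
      ∑ p : Fin (k + 1), if (p : ℕ) < l then ∫ x, L σ x * L ρ x ∂(K.γ p) else 0 := by
  have hmem : ∀ (v : StrongDual ℝ E) (p : Fin (k + 1)), MemLp (fun z : Fin (k + 1) → E => v (z p))
      2 K.law := fun v p => IsGaussian.memLp_dual K.law
        (v.comp (ContinuousLinearMap.proj (R := ℝ) (φ := fun _ : Fin (k + 1) => E) p)) 2
        (by norm_num)
  have hi : ∀ q p : Fin (k + 1), Integrable (fun z : Fin (k + 1) → E =>
      L σ (z q) * if (p : ℕ) < l then L ρ (z p) else 0) K.law := by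
    intro q p
    split_ifs
    · exact (hmem (L σ) q).integrable_mul (hmem (L ρ) p)
    · simp
  simp only [fieldForm, Finset.sum_mul_sum]
  have hi' : ∀ q p : Fin (k + 1), Integrable (fun z : Fin (k + 1) → E =>
      (if (q : ℕ) < k + 1 then L σ (z q) else 0) * if (p : ℕ) < l then L ρ (z p) else 0) K.law := by
    intro q p
    simpa only [q.2, if_true] using hi q p
  rw [integral_finsetSum _ fun q _ => integrable_finsetSum _ fun p _ => hi' q p]
  rw [Finset.sum_congr rfl fun q _ => integral_finsetSum _ fun p _ => hi' q p]
  rw [Finset.sum_comm]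
  refine Finset.sum_congr rfl fun p _ => ?_
  have : ∀ q : Fin (k + 1), ∫ z : Fin (k + 1) → E, (if (q : ℕ) < k + 1 then L σ (z q) else 0) *
      (if (p : ℕ) < l then L ρ (z p) else 0) ∂K.law =
      if (p : ℕ) < l then (if q = p then ∫ x, L σ x * L ρ x ∂(K.γ q) else 0) else 0 := by
    intro q
    simp only [q.2, if_true]
    split_ifs with h1 h2
    · rw [law, integral_dual_mul_dual_pi K.γ h0, if_pos h2]
    · rw [law, integral_dual_mul_dual_pi K.γ h0, if_neg h2]
    · simp
  simp only [this]
  split_ifs <;> simp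

/-- The mixed terms vanish since disorder and fields are independent and the disorder is centered.
The forms carry different coefficients because one will be the time derivative of the Hamiltonian,
the other its shift at level `l`. -/
lemma integral_jointForm_mul [∀ p, IsGaussian (K.γ p)] [IsGaussian μ]
    (hμ : ∫ y, y ∂μ = 0) (h0 : ∀ p, ∫ x, x ∂(K.γ p) = 0) (α α' β β' : ℝ) (l : ℕ) (σ ρ : T) :
    ∫ x, jointForm k g L α α' (k + 1) σ x * jointForm k g L β β' l ρ x ∂(μ.prod K.law) =
      α * β * ∫ y, g σ y * g ρ y ∂μ + α' * β' *
        ∑ p : Fin (k + 1), if (p : ℕ) < l then ∫ x, L σ x * L ρ x ∂(K.γ p) else 0 := by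
  have hmem : ∀ (α α' : ℝ) (l : ℕ) (σ : T), MemLp (fun x : F × (Fin (k + 1) → E) =>
      α * g σ x.1 + α' * fieldForm L l σ x.2) 2 (μ.prod K.law) := by
    intro α α' l σ
    have e : (fun x : F × (Fin (k + 1) → E) => α * g σ x.1 + α' * fieldForm L l σ x.2) =
        jointForm k g L α α' l σ := by
      ext x
      rw [jointForm_apply]
    rw [e]
    exact IsGaussian.memLp_dual (μ.prod K.law) (jointForm k g L α α' l σ) 2 (by norm_num)
  have hA : ∀ σ, MemLp (fun x : F × (Fin (k + 1) → E) => g σ x.1) 2 (μ.prod K.law) := fun σ => by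
    simpa using hmem 1 0 0 σ
  have hB : ∀ l σ, MemLp (fun x : F × (Fin (k + 1) → E) => fieldForm L l σ x.2) 2
      (μ.prod K.law) := fun l σ => by simpa using hmem 0 1 l σ
  have i1 := (hA σ).integrable_mul (hA ρ)
  have i2 := (hA σ).integrable_mul (hB l ρ)
  have i3 := (hB (k + 1) σ).integrable_mul (hA ρ)
  have i4 := (hB (k + 1) σ).integrable_mul (hB l ρ)
  have hg0 : ∀ σ, ∫ y, g σ y ∂μ = 0 := fun σ => by rw [IsGaussian.integral_dual, hμ, map_zero]
  have e1 : ∫ x : F × (Fin (k + 1) → E), g σ x.1 * g ρ x.1 ∂(μ.prod K.law) =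
      ∫ y, g σ y * g ρ y ∂μ := by
    rw [integral_fun_fst (f := fun y => g σ y * g ρ y)]
    simp
  have e2 : ∫ x : F × (Fin (k + 1) → E), g σ x.1 * fieldForm L l ρ x.2 ∂(μ.prod K.law) = 0 := by
    rw [integral_prod_mul (g σ) (fun z => fieldForm L l ρ z), hg0, zero_mul]
  have e3 : ∫ x : F × (Fin (k + 1) → E), fieldForm L (k + 1) σ x.2 * g ρ x.1 ∂(μ.prod K.law) = 0 := by
    simp only [mul_comm (fieldForm L (k + 1) σ _)]
    rw [integral_prod_mul (g ρ) (fun z => fieldForm L (k + 1) σ z), hg0, zero_mul]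
  have e4 : ∫ x : F × (Fin (k + 1) → E), fieldForm L (k + 1) σ x.2 * fieldForm L l ρ x.2
      ∂(μ.prod K.law) =
        ∑ p : Fin (k + 1), if (p : ℕ) < l then ∫ x, L σ x * L ρ x ∂(K.γ p) else 0 := by
    rw [integral_fun_snd (f := fun z => fieldForm L (k + 1) σ z * fieldForm L l ρ z)]
    simp [integral_fieldForm_mul h0]
  simp only [Pi.mul_def] at i1 i2 i3 i4
  calc _ = ∫ x : F × (Fin (k + 1) → E), (α * β * (g σ x.1 * g ρ x.1) +
        α * β' * (g σ x.1 * fieldForm L l ρ x.2)) +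
        (α' * β * (fieldForm L (k + 1) σ x.2 * g ρ x.1) +
        α' * β' * (fieldForm L (k + 1) σ x.2 * fieldForm L l ρ x.2)) ∂(μ.prod K.law) := by
        congr 1
        ext x
        rw [jointForm_apply, jointForm_apply]
        ring
    _ = _ := by
        have j1 : Integrable (fun x : F × (Fin (k + 1) → E) => α * β * (g σ x.1 * g ρ x.1) +
            α * β' * (g σ x.1 * fieldForm L l ρ x.2)) (μ.prod K.law) :=
          (i1.const_mul _).add (i2.const_mul _)
        have j2 : Integrable (fun x : F × (Fin (k + 1) → E) =>
            α' * β * (fieldForm L (k + 1) σ x.2 * g ρ x.1) +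
            α' * β' * (fieldForm L (k + 1) σ x.2 * fieldForm L l ρ x.2)) (μ.prod K.law) :=
          (i3.const_mul _).add (i4.const_mul _)
        rw [integral_add j1 j2, integral_add (i1.const_mul _) (i2.const_mul _),
          integral_add (i3.const_mul _) (i4.const_mul _), integral_const_mul, integral_const_mul,
          integral_const_mul, integral_const_mul, e1, e2, e3, e4]
        ring

/-- The Bochner integral, which exists by Gaussian second moments, is the vector representing the
covariance with `w`: continuous linear forms pass under the integral. -/
lemma dual_integral_smul (Γ : Measure F) [IsGaussian Γ] (w v : StrongDual ℝ F) :
    v (∫ x, w x • x ∂Γ) = ∫ x, w x * v x ∂Γ := by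
  have hi : Integrable (fun y => w y • y) Γ := memLp_one_iff_integrable.1
    ((IsGaussian.memLp_id Γ 2 (by norm_num)).smul (IsGaussian.memLp_dual Γ w 2 (by norm_num)))
  rw [← v.integral_comp_comm hi]
  simp

lemma hasDerivAt_pathHam {G : T → ℝ} {t : ℝ} (h0 : 0 < t) (h1 : t < 1) (σ : T)
    (z : Fin (k + 1) → E) :
    HasDerivAt (fun t => pathHam b L G t σ z)
      (1 / (2 * √t) * G σ + -(1 / (2 * √(1 - t))) * fieldForm L (k + 1) σ z) t := by
  have a1 := ((Real.hasDerivAt_sqrt h0.ne').mul_const (G σ)).add_const (b σ)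
  have a2 : HasDerivAt (fun t : ℝ => √(1 - t)) (-(1 / (2 * √(1 - t)))) t := by
    have := (Real.hasDerivAt_sqrt (sub_pos.2 h1).ne').comp t ((hasDerivAt_id t).const_sub 1)
    exact this.congr_deriv (by simp)
  exact a1.add (a2.mul_const _)

end Cascade

end

/-! ### The weighted Gibbs density and its directional derivatives. -/

section

namespace Cascade

variable {k : ℕ} {E T F : Type*} [NormedAddCommGroup E] [NormedSpace ℝ E] [MeasurableSpace E]
  [BorelSpace E] [SecondCountableTopology E] [CompleteSpace E] [MeasurableSpace T]
  [NormedAddCommGroup F] [NormedSpace ℝ F] [MeasurableSpace F]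
  [BorelSpace F] [SecondCountableTopology F] [CompleteSpace F]
  {K : Cascade k E T} {b : T → ℝ} {L : T → StrongDual ℝ E} {M R : ℝ} {μ : Measure F}
  {g : T → StrongDual ℝ F} [∀ p, IsGaussian (K.γ p)] [NeZero K.ν] [IsFiniteMeasure K.ν]
  [IsGaussian μ]

/-- The interpolating Hamiltonian driven by linear forms. -/
abbrev formHam (k : ℕ) (b : T → ℝ) (L : T → StrongDual ℝ E) (g : T → StrongDual ℝ F) (t : ℝ)
    (y : F) : T → (Fin (k + 1) → E) → ℝ :=
  pathHam b L (fun σ => g σ y) t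

/-- The density, under all the changes of measure, of the Gibbs measure driven by linear forms. -/
def formDensity (K : Cascade k E T) (b : T → ℝ) (L : T → StrongDual ℝ E) (g : T → StrongDual ℝ F)
    (t : ℝ) (σ : T) (x : F × (Fin (k + 1) → E)) : ℝ :=
  K.prodW (formHam k b L g t x.1) (k + 1) x.2 * K.D (formHam k b L g t x.1) σ (k + 1) x.2

omit [NeZero K.ν] in
lemma Admissible.nice_formHam (h : K.Admissible b L M) (hg : Measurable fun q : T × F => g q.1 q.2)
    (hgR : ∀ σ, ‖g σ‖ ≤ R) {t : ℝ} (ht : 0 ≤ t) (y : F) :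
    K.Nice ((k + 1) * M) (formHam k b L g t y) := by
  have hm : Measurable fun σ => g σ y := hg.comp measurable_prodMk_right
  refine h.nice hm ht ?_
  refine Integrable.of_bound (Real.measurable_exp.comp (hm.const_mul _)).aestronglyMeasurable
    (Real.exp (√t * (R * ‖y‖))) (ae_of_all _ fun σ => ?_)
  rw [Real.norm_eq_abs, Real.abs_exp]
  refine Real.exp_le_exp.2 (mul_le_mul_of_nonneg_left ?_ (Real.sqrt_nonneg t))
  exact (le_abs_self _).trans (((g σ).le_opNorm y).trans
    (mul_le_mul_of_nonneg_right (hgR σ) (norm_nonneg y)))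

omit [IsGaussian μ] [NeZero K.ν] [IsFiniteMeasure K.ν] [∀ p, IsGaussian (K.γ p)] in
lemma Admissible.measurable_formHam (h : K.Admissible b L M)
    (hg : Measurable fun q : T × F => g q.1 q.2) (t : ℝ) :
    Measurable fun q : F × T × (Fin (k + 1) → E) => formHam k b L g t q.1 q.2.1 q.2.2 :=
  measurable_pathHam h.L_meas h.b_meas (A := F) (G := fun y σ => g σ y)
    (hg.comp (measurable_snd.prodMk measurable_fst)) t

lemma Admissible.measurable_formDensity (h : K.Admissible b L M)
    (hg : Measurable fun q : T × F => g q.1 q.2) (t : ℝ) :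
    Measurable fun q : T × (F × (Fin (k + 1) → E)) => formDensity K b L g t q.1 q.2 := by
  have hm := h.measurable_formHam hg t
  refine Measurable.mul ?_ ?_
  · exact (measurable_prodW hm (k + 1)).comp measurable_snd
  · exact (measurable_D hm (k + 1) (Nat.le_add_left 1 k)).comp
      ((measurable_snd.fst.prodMk measurable_fst).prodMk measurable_snd.snd)

/-- The forms `g σ` are uniformly bounded, so at zero fields the exponent is at most linear in the
disorder. The resulting exponential growth, uniform in `σ`, supplies every integrability condition
of the integration by parts. -/
lemma Admissible.exists_formDensity_le (h : K.Admissible b L M)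
    (hg : Measurable fun q : T × F => g q.1 q.2) (hgR : ∀ σ, ‖g σ‖ ≤ R) (hM : 0 ≤ M)
    {t : ℝ} (ht : t ∈ Icc (0 : ℝ) 1) :
    ∃ c, 0 ≤ c ∧ ∀ σ x, |formDensity K b L g t σ x| ≤ Real.exp (c * (1 + ‖x‖)) := by
  have hC : 0 ≤ (k + 1) * M := by positivity
  obtain ⟨C₁, h₁, H₁⟩ := h.regular.exists_prodW_le hC (k + 1)
  obtain ⟨C₂, h₂, H₂⟩ := h.regular.exists_D_le hC (k + 1) (Nat.le_add_left 1 k)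
  set c₀ := |Real.log (K.ν.real univ)|
  have hc₀ : 0 ≤ c₀ := abs_nonneg _
  have hR : ∀ _ : T, 0 ≤ R := fun σ => (norm_nonneg _).trans (hgR σ)
  refine ⟨C₁ + C₂ + 2 * |R| + 2 * M + c₀, by positivity, fun σ x => ?_⟩
  have hR0 := hR σ
  have hn := h.nice_formHam hg hgR ht.1 x.1
  have hY : ∀ σ, |formHam k b L g t x.1 σ 0| ≤ R * ‖x.1‖ + M := fun σ => by
    rw [formHam, pathHam_zero]
    refine (abs_add_le _ _).trans (add_le_add ?_ (h.b_le σ))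
    rw [abs_mul, abs_of_nonneg (Real.sqrt_nonneg t)]
    exact (mul_le_of_le_one_left (abs_nonneg _) (Real.sqrt_le_one.2 ht.2)).trans
      (((g σ).le_opNorm x.1).trans (mul_le_mul_of_nonneg_right (hgR σ) (norm_nonneg _)))
  have hX := abs_X_top_zero_le hn hY
  rw [formDensity, abs_of_nonneg (mul_nonneg (prodW_pos _ _).le (D_nonneg _ _ (by omega) _))]
  refine (mul_le_mul (H₁ _ hn x.2) (H₂ _ hn σ x.2) (D_nonneg _ _ (by omega) _)
    (Real.exp_pos _).le).trans ?_
  rw [← Real.exp_add, ← Real.exp_add]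
  refine Real.exp_le_exp.2 ?_
  have a1 := abs_le.1 (hY σ)
  have a2 := abs_le.1 hX
  have a3 : ‖x.1‖ ≤ ‖x‖ := norm_fst_le x
  have a4 : ‖x.2‖ ≤ ‖x‖ := norm_snd_le x
  rw [abs_of_nonneg hR0]
  have a5 := mul_le_mul_of_nonneg_left a3 hR0
  have a6 := mul_le_mul_of_nonneg_left a4 h₁
  have a7 := mul_le_mul_of_nonneg_left a4 h₂
  have a8 := mul_nonneg hM (norm_nonneg x)
  have a9 := mul_nonneg hc₀ (norm_nonneg x)
  have : formHam k b L g t x.1 σ 0 - K.X (formHam k b L g t x.1) (k + 1) 0 ≤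
    2 * (R * ‖x.1‖ + M) + c₀ := by linarith
  nlinarith

/-- The shift of the Hamiltonian along a direction, as seen at level `l`. -/
def shift (L : T → StrongDual ℝ E) (g : T → StrongDual ℝ F) (t : ℝ) (l : ℕ)
    (a : F × (Fin (k + 1) → E)) (ρ : T) : ℝ :=
  √t * g ρ a.1 + √(1 - t) * fieldForm L l ρ a.2

lemma formHam_add_smul (t : ℝ) (l : ℕ) (x a : F × (Fin (k + 1) → E)) (s : ℝ) (ρ : T)
    (z : Fin (k + 1) → E) :
    formHam k b L g t (x.1 + s • a.1) ρ (z + merge l (s • a.2) 0) =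
      formHam k b L g t x.1 ρ z + s * shift L g t l a ρ := by
  simp only [pathHam, shift, fieldForm_add, fieldForm_merge, fieldForm_smul, map_add, map_smul,
    smul_eq_mul]
  ring

/-- The translation of the fields is cut off at level `l` and moved into the Hamiltonian, where it
joins the translation of the disorder as a bounded perturbation linear in `s`. The derivative is
then a Gibbs average at level `l`. -/
lemma Admissible.hasDerivAt_X_shift (h : K.Admissible b L M)
    (hg : Measurable fun q : T × F => g q.1 q.2) (hgR : ∀ σ, ‖g σ‖ ≤ R) (hM : 0 ≤ M)
    {t : ℝ} (ht : 0 ≤ t) {l : ℕ} (hl : 1 ≤ l) (x a : F × (Fin (k + 1) → E)) :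
    HasDerivAt (fun s : ℝ => K.X (formHam k b L g t (x + s • a).1) l (x + s • a).2)
      (K.avg (formHam k b L g t x.1) l (shift L g t l a) x.2) 0 := by
  have e : (fun s : ℝ => K.X (formHam k b L g t (x + s • a).1) l (x + s • a).2) =
      fun s : ℝ => K.X (fun σ z => formHam k b L g t x.1 σ z + s * shift L g t l a σ) l x.2 := by
    ext s
    simp only [Prod.fst_add, Prod.snd_add, Prod.smul_fst, Prod.smul_snd]
    rw [X_add_eq hl]
    simp only [formHam_add_smul]
  rw [e]
  refine h.regular.hasDerivAt_X_add_mul (by positivity) (h.nice_formHam hg hgR ht x.1) ?_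
    (B := √t * (R * ‖a.1‖) + √(1 - t) * ((k + 1) * M * ‖a.2‖)) ?_ l hl x.2
  · exact ((hg.comp measurable_prodMk_right).const_mul _).add
      (((measurable_fieldForm h.L_meas l).comp measurable_prodMk_right).const_mul _)
  · intro σ
    refine (abs_add_le _ _).trans (add_le_add ?_ ?_)
    · rw [abs_mul, abs_of_nonneg (Real.sqrt_nonneg _)]
      exact mul_le_mul_of_nonneg_left (((g σ).le_opNorm _).trans
        (mul_le_mul_of_nonneg_right (hgR σ) (norm_nonneg _))) (Real.sqrt_nonneg _)
    · rw [abs_mul, abs_of_nonneg (Real.sqrt_nonneg _)]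
      exact mul_le_mul_of_nonneg_left (abs_fieldForm_le h.L_le l σ _) (Real.sqrt_nonneg _)

/-- The closed form of the density as an exponential reduces this to differentiating the Hamiltonian
and each `X` along `a`. -/
lemma Admissible.hasDerivAt_formDensity (h : K.Admissible b L M) (hk : 1 ≤ k)
    (hg : Measurable fun q : T × F => g q.1 q.2) (hgR : ∀ σ, ‖g σ‖ ≤ R) (hM : 0 ≤ M)
    {t : ℝ} (ht : 0 ≤ t) (σ : T) (x a : F × (Fin (k + 1) → E)) :
    HasDerivAt (fun s : ℝ => formDensity K b L g t σ (x + s • a))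
      (formDensity K b L g t σ x * (shift L g t (k + 1) a σ -
        ∑ l ∈ Finset.Icc 1 k, (K.m l - K.m (l - 1)) *
          K.avg (formHam k b L g t x.1) l (shift L g t l a) x.2)) 0 := by
  have e : ∀ y, formDensity K b L g t σ y = Real.exp (formHam k b L g t y.1 σ y.2 -
      ∑ l ∈ Finset.Icc 1 k, (K.m l - K.m (l - 1)) * K.X (formHam k b L g t y.1) l y.2) := fun y =>
    prodW_mul_D_top (h.nice_formHam hg hgR ht y.1) hk h.m_zero h.m_last σ y.2
  have e2 : (fun s : ℝ => formHam k b L g t (x + s • a).1 σ (x + s • a).2) = fun s =>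
      formHam k b L g t x.1 σ x.2 + s * shift L g t (k + 1) a σ := by
    ext s
    rw [← formHam_add_smul, merge_eq_left le_rfl]
    simp
  have h1 : HasDerivAt (fun s : ℝ => formHam k b L g t (x + s • a).1 σ (x + s • a).2)
      (shift L g t (k + 1) a σ) 0 := by
    rw [e2]
    exact (((hasDerivAt_id (0 : ℝ)).mul_const _).const_add _).congr_deriv (one_mul _)
  have h2 := (h1.fun_sub (HasDerivAt.fun_sum fun l (hl : l ∈ Finset.Icc 1 k) =>
    (h.hasDerivAt_X_shift hg hgR hM ht (Finset.mem_Icc.1 hl).1 x a).const_mul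
      (K.m l - K.m (l - 1)))).exp
  simp only [e]
  refine h2.congr_deriv ?_
  simp

/-- The singular coefficients of the time derivative meet the coefficients `√t` and `√(1 - t)` of
the Hamiltonian, leaving `1/2` and `-1/2`. This explains both the sign in the kernel and the absence
of any explicit dependence on `t`. -/
lemma shift_integral (h : K.Admissible b L M) (hμ : ∫ y, y ∂μ = 0) {t : ℝ}
    (h0 : 0 < t) (h1 : t < 1) (l : ℕ) (σ ρ : T) :
    shift L g t l (∫ x, jointForm k g L (1 / (2 * √t)) (-(1 / (2 * √(1 - t)))) (k + 1) σ x • x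
      ∂(μ.prod K.law)) ρ = 1 / 2 * K.kernel L μ (fun σ y => g σ y) l σ ρ := by
  have e : ∀ a, shift L g t l a ρ = jointForm k g L (√t) (√(1 - t)) l ρ a := fun a => by
    rw [jointForm_apply, shift]
  rw [e, dual_integral_smul, integral_jointForm_mul hμ h.centered, kernel]
  have a1 : √t ≠ 0 := (Real.sqrt_pos.2 h0).ne'
  have a2 : √(1 - t) ≠ 0 := (Real.sqrt_pos.2 (sub_pos.2 h1)).ne'
  have b1 : 1 / (2 * √t) * √t = 1 / 2 := by field_simp
  have b2 : -(1 / (2 * √(1 - t))) * √(1 - t) = -(1 / 2) := by field_simp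
  rw [b1, b2]
  ring

end Cascade

end

/-! ### Integration by parts against the weighted Gibbs density. -/

section

namespace Cascade

variable {k : ℕ} {E T F : Type*} [NormedAddCommGroup E] [NormedSpace ℝ E] [MeasurableSpace E]
  [BorelSpace E] [SecondCountableTopology E] [CompleteSpace E] [MeasurableSpace T]
  [NormedAddCommGroup F] [NormedSpace ℝ F] [MeasurableSpace F]
  [BorelSpace F] [SecondCountableTopology F] [CompleteSpace F]
  {K : Cascade k E T} {b : T → ℝ} {L : T → StrongDual ℝ E} {M R : ℝ} {μ : Measure F}
  {g : T → StrongDual ℝ F} [∀ p, IsGaussian (K.γ p)] [NeZero K.ν] [IsFiniteMeasure K.ν]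
  [IsGaussian μ]

lemma measurable_kernel_form (h : K.Admissible b L M) (hg : Measurable fun q : T × F => g q.1 q.2)
    (l : ℕ) : Measurable fun q : T × T => K.kernel L μ (fun σ y => g σ y) l q.1 q.2 :=
  measurable_kernel h.L_meas hg l

lemma Admissible.exists_abs_kernel_form_le (h : K.Admissible b L M) (hgR : ∀ σ, ‖g σ‖ ≤ R)
    (μ : Measure F) [IsGaussian μ] :
    ∃ B, ∀ l σ ρ, |K.kernel L μ (fun σ y => g σ y) l σ ρ| ≤ B := by
  obtain ⟨c, hc⟩ := h.exists_abs_kernel_le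
  have hm : ∀ σ, MemLp (fun y => g σ y) 2 μ := fun σ => IsGaussian.memLp_dual μ (g σ) 2 (by norm_num)
  have hV : ∀ σ, ∫ y, g σ y ^ 2 ∂μ ≤ R ^ 2 * ∫ y, ‖y‖ ^ 2 ∂μ := fun σ => by
    rw [← integral_const_mul]
    refine integral_mono (hm σ).integrable_sq (((IsGaussian.memLp_two_id
      (μ := μ)).integrable_norm_pow (by norm_num)).const_mul _) fun y => ?_
    have := ((g σ).le_opNorm y).trans (mul_le_mul_of_nonneg_right (hgR σ) (norm_nonneg y))
    rw [Real.norm_eq_abs] at this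
    change g σ y ^ 2 ≤ R ^ 2 * ‖y‖ ^ 2
    rw [← mul_pow, ← sq_abs]
    exact pow_le_pow_left₀ (abs_nonneg _) this 2
  exact ⟨_, fun l σ ρ => hc l σ ρ μ _ _ (hm σ) (hm ρ) (hV σ) (hV ρ)⟩

lemma integral_id_prod_law (hμ : ∫ y, y ∂μ = 0) (h0 : ∀ p, ∫ x, x ∂(K.γ p) = 0) :
    ∫ x, x ∂(μ.prod K.law) = 0 := by
  have hi : Integrable (fun x : F × (Fin (k + 1) → E) => x) (μ.prod K.law) :=
    IsGaussian.integrable_id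
  have e1 := (ContinuousLinearMap.fst ℝ F (Fin (k + 1) → E)).integral_comp_comm hi
  have e2 := (ContinuousLinearMap.snd ℝ F (Fin (k + 1) → E)).integral_comp_comm hi
  have f1 : ∫ x : F × (Fin (k + 1) → E), x.1 ∂(μ.prod K.law) = 0 := by
    rw [integral_fun_fst (f := fun x : F => x), hμ, smul_zero]
  have f2 : ∫ x : F × (Fin (k + 1) → E), x.2 ∂(μ.prod K.law) = 0 := by
    rw [integral_fun_snd (f := fun x : Fin (k + 1) → E => x),
      show ∫ x, x ∂K.law = 0 from integral_id_pi_eq_zero K.γ h0, smul_zero]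
  exact Prod.ext (e1.symm.trans f1) (e2.symm.trans f2)

lemma Admissible.integrable_formDensity (h : K.Admissible b L M)
    (hg : Measurable fun q : T × F => g q.1 q.2) (hgR : ∀ σ, ‖g σ‖ ≤ R) (hM : 0 ≤ M)
    {t : ℝ} (ht : t ∈ Icc (0 : ℝ) 1) (σ : T) :
    Integrable (formDensity K b L g t σ) (μ.prod K.law) := by
  obtain ⟨c, hc, H⟩ := h.exists_formDensity_le hg hgR hM ht
  have hexp : Integrable (fun x : F × (Fin (k + 1) → E) => Real.exp (c * (1 + ‖x‖)))
      (μ.prod K.law) := by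
    simp only [mul_add, Real.exp_add]
    exact (integrable_exp_norm_of_isGaussian _ c).const_mul _
  exact hexp.mono' ((h.measurable_formDensity hg t).comp
    measurable_prodMk_left).aestronglyMeasurable (ae_of_all _ fun x => H σ x)

lemma Admissible.integrable_mul_formDensity (h : K.Admissible b L M)
    (hg : Measurable fun q : T × F => g q.1 q.2) (hgR : ∀ σ, ‖g σ‖ ≤ R) (hM : 0 ≤ M)
    {t : ℝ} (ht : t ∈ Icc (0 : ℝ) 1) {f : T → F × (Fin (k + 1) → E) → ℝ}
    (hf : Measurable fun q : T × (F × (Fin (k + 1) → E)) => f q.1 q.2) {B : ℝ}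
    (hB : ∀ σ x, |f σ x| ≤ B * ‖x‖) :
    Integrable (fun q : (F × (Fin (k + 1) → E)) × T => f q.2 q.1 * formDensity K b L g t q.2 q.1)
      ((μ.prod K.law).prod K.ν) := by
  obtain ⟨c, hc, H⟩ := h.exists_formDensity_le hg hgR hM ht
  have hexp : Integrable (fun x : F × (Fin (k + 1) → E) =>
      |B| * (Real.exp ((c + 1) * (1 + ‖x‖)))) (μ.prod K.law) := by
    simp only [mul_add, Real.exp_add]
    exact ((integrable_exp_norm_of_isGaussian _ (c + 1)).const_mul _).const_mul _
  refine (hexp.comp_fst K.ν).mono' (((hf.mul (h.measurable_formDensity hg t)).comp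
    measurable_swap).aestronglyMeasurable) (ae_of_all _ fun q => ?_)
  rw [norm_mul, add_mul, one_mul, add_comm (c * _), Real.exp_add, ← mul_assoc]
  refine mul_le_mul ((hB q.2 q.1).trans (mul_le_mul (le_abs_self _) ?_ (norm_nonneg _)
    (abs_nonneg _))) (H q.2 q.1) (norm_nonneg _) (by positivity)
  linarith [Real.add_one_le_exp (1 + ‖q.1‖)]

lemma Admissible.integrable_dual_mul_formDensity (h : K.Admissible b L M)
    (hg : Measurable fun q : T × F => g q.1 q.2) (hgR : ∀ σ, ‖g σ‖ ≤ R) (hM : 0 ≤ M)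
    {t : ℝ} (ht : t ∈ Icc (0 : ℝ) 1) (σ : T) (w : StrongDual ℝ (F × (Fin (k + 1) → E))) :
    Integrable (fun x => w x * formDensity K b L g t σ x) (μ.prod K.law) := by
  obtain ⟨c, hc, H⟩ := h.exists_formDensity_le hg hgR hM ht
  have hexp : Integrable (fun x : F × (Fin (k + 1) → E) =>
      ‖w‖ * (Real.exp ((c + 1) * (1 + ‖x‖)))) (μ.prod K.law) := by
    simp only [mul_add, Real.exp_add]
    exact ((integrable_exp_norm_of_isGaussian _ (c + 1)).const_mul _).const_mul _
  refine hexp.mono' (w.measurable.mul ((h.measurable_formDensity hg t).comp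
    measurable_prodMk_left)).aestronglyMeasurable (ae_of_all _ fun x => ?_)
  rw [norm_mul, add_mul, one_mul, add_comm (c * _), Real.exp_add, ← mul_assoc]
  refine mul_le_mul ((w.le_opNorm x).trans (mul_le_mul_of_nonneg_left ?_ (norm_nonneg _)))
    (H σ x) (norm_nonneg _) (by positivity)
  linarith [Real.add_one_le_exp (1 + ‖x‖)]

/-- The derivative of the density along the covariance direction of its own linear form, divided
by the density. -/
def formScore (K : Cascade k E T) (b : T → ℝ) (L : T → StrongDual ℝ E) (μ : Measure F)
    (g : T → StrongDual ℝ F) (t : ℝ) (σ : T) (x : F × (Fin (k + 1) → E)) : ℝ :=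
  1 / 2 * (K.kernel L μ (fun σ y => g σ y) (k + 1) σ σ -
    ∑ l ∈ Finset.Icc 1 k, (K.m l - K.m (l - 1)) *
      K.avg (formHam k b L g t x.1) l (K.kernel L μ (fun σ y => g σ y) l σ) x.2)

lemma Admissible.measurable_formScore (h : K.Admissible b L M)
    (hg : Measurable fun q : T × F => g q.1 q.2) (t : ℝ) :
    Measurable fun q : T × (F × (Fin (k + 1) → E)) => formScore K b L μ g t q.1 q.2 := by
  have hmk := fun l => measurable_kernel_form (μ := μ) h hg l
  refine Measurable.const_mul (Measurable.sub ?_ (Finset.measurable_fun_sum _ fun l hl =>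
    Measurable.const_mul ?_ _)) _
  · exact (hmk (k + 1)).comp (measurable_fst.prodMk measurable_fst)
  · exact (measurable_avg (A := F × T) (Y := fun a => formHam k b L g t a.1)
      (u := fun a => K.kernel L μ (fun σ y => g σ y) l a.2)
      ((h.measurable_formHam hg t).comp (measurable_fst.fst.prodMk measurable_snd)) l
      (Finset.mem_Icc.1 hl).1 ((hmk l).comp (measurable_fst.snd.prodMk measurable_snd))).comp
      ((measurable_snd.fst.prodMk measurable_fst).prodMk measurable_snd.snd)

lemma Admissible.exists_abs_formScore_le (h : K.Admissible b L M)
    (hg : Measurable fun q : T × F => g q.1 q.2) (hgR : ∀ σ, ‖g σ‖ ≤ R) (hM : 0 ≤ M)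
    {t : ℝ} (ht : 0 ≤ t) : ∃ B, ∀ σ x, |formScore K b L μ g t σ x| ≤ B := by
  obtain ⟨B, hB⟩ := h.exists_abs_kernel_form_le hgR μ
  refine ⟨1 / 2 * (B + ∑ l ∈ Finset.Icc 1 k, |K.m l - K.m (l - 1)| * B), fun σ x => ?_⟩
  rw [formScore, abs_mul, abs_of_pos (by norm_num : (0 : ℝ) < 1 / 2)]
  refine mul_le_mul_of_nonneg_left ((abs_sub _ _).trans (add_le_add (hB _ σ σ)
    ((Finset.abs_sum_le_sum_abs _ _).trans (Finset.sum_le_sum fun l hl => ?_)))) (by norm_num)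
  rw [abs_mul]
  exact mul_le_mul_of_nonneg_left (h.regular.abs_avg_le (by positivity)
    (h.nice_formHam hg hgR ht x.1) (Finset.mem_Icc.1 hl).1 (hB l σ) x.2) (abs_nonneg _)

lemma Admissible.integrable_formDensity_mul_score (h : K.Admissible b L M)
    (hg : Measurable fun q : T × F => g q.1 q.2) (hgR : ∀ σ, ‖g σ‖ ≤ R) (hM : 0 ≤ M)
    {t : ℝ} (ht : t ∈ Icc (0 : ℝ) 1) (σ : T) :
    Integrable (fun x => formDensity K b L g t σ x * formScore K b L μ g t σ x)
      (μ.prod K.law) := by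
  obtain ⟨B, hB⟩ := h.exists_abs_formScore_le (μ := μ) hg hgR hM ht.1
  exact (h.integrable_formDensity hg hgR hM ht σ).mul_bdd (c := B)
    ((h.measurable_formScore hg t).comp measurable_prodMk_left).aestronglyMeasurable
    (ae_of_all _ fun x => hB σ x)

/-- The direction is the covariance vector of the time derivative at `σ`. It depends on `σ`, so the
score has the kernel at `(σ, σ)` as own term and averages of the kernel at `(σ, ρ)` over `ρ` alone.
-/
lemma Admissible.hasDerivAt_formDensity_score (h : K.Admissible b L M) (hk : 1 ≤ k)
    (hμ : ∫ y, y ∂μ = 0)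
    (hg : Measurable fun q : T × F => g q.1 q.2) (hgR : ∀ σ, ‖g σ‖ ≤ R) (hM : 0 ≤ M)
    {t : ℝ} (h0 : 0 < t) (h1 : t < 1) (σ : T) (x : F × (Fin (k + 1) → E)) :
    HasDerivAt (fun s : ℝ => formDensity K b L g t σ (x + s • ∫ x,
        jointForm k g L (1 / (2 * √t)) (-(1 / (2 * √(1 - t)))) (k + 1) σ x • x ∂(μ.prod K.law)))
      (formDensity K b L g t σ x * formScore K b L μ g t σ x) 0 := by
  refine (h.hasDerivAt_formDensity hk hg hgR hM h0.le σ x _).congr_deriv ?_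
  have e : ∀ l, shift L g t l (∫ x, jointForm k g L (1 / (2 * √t)) (-(1 / (2 * √(1 - t))))
      (k + 1) σ x • x ∂(μ.prod K.law)) =
      fun ρ => 1 / 2 * K.kernel L μ (fun σ y => g σ y) l σ ρ := fun l =>
    funext fun ρ => shift_integral h hμ h0 h1 l σ ρ
  simp only [e, formScore, avg, mul_assoc, integral_const_mul, mul_sub, Finset.mul_sum]
  congr 1
  refine Finset.sum_congr rfl fun l _ => ?_
  ring

lemma Admissible.integral_jointForm_mul_formDensity (h : K.Admissible b L M) (hk : 1 ≤ k)
    (hμ : ∫ y, y ∂μ = 0)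
    (hg : Measurable fun q : T × F => g q.1 q.2) (hgR : ∀ σ, ‖g σ‖ ≤ R) (hM : 0 ≤ M)
    {t : ℝ} (h0 : 0 < t) (h1 : t < 1) (σ : T) :
    ∫ x, jointForm k g L (1 / (2 * √t)) (-(1 / (2 * √(1 - t)))) (k + 1) σ x *
        formDensity K b L g t σ x ∂(μ.prod K.law) =
      ∫ x, formDensity K b L g t σ x * formScore K b L μ g t σ x ∂(μ.prod K.law) :=
  have ht : t ∈ Icc (0 : ℝ) 1 := ⟨h0.le, h1.le⟩
  integral_dual_mul_of_isGaussian (μ.prod K.law) (integral_id_prod_law hμ h.centered) _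
    (fun x => h.hasDerivAt_formDensity_score hk hμ hg hgR hM h0 h1 σ x)
    (h.integrable_formDensity hg hgR hM ht σ) (h.integrable_formDensity_mul_score hg hgR hM ht σ)
    (h.integrable_dual_mul_formDensity hg hgR hM ht σ _)

end Cascade

end

/-! ### The derivative of the free energy when the process consists of linear forms. -/

section

namespace Cascade

variable {k : ℕ} {E T F : Type*} [NormedAddCommGroup E] [NormedSpace ℝ E] [MeasurableSpace E]
  [BorelSpace E] [SecondCountableTopology E] [CompleteSpace E] [MeasurableSpace T]
  [NormedAddCommGroup F] [NormedSpace ℝ F] [MeasurableSpace F]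
  [BorelSpace F] [SecondCountableTopology F] [CompleteSpace F]
  {K : Cascade k E T} {b : T → ℝ} {L : T → StrongDual ℝ E} {M R : ℝ} {μ : Measure F}
  {g : T → StrongDual ℝ F} [∀ p, IsGaussian (K.γ p)] [NeZero K.ν] [IsFiniteMeasure K.ν]
  [IsGaussian μ]

/-- Integrating the score over `σ` produces pair averages with the first configuration at level `k +
1` and the second at level `l`. -/
lemma Admissible.integral_formDensity_mul_score (h : K.Admissible b L M)
    (hg : Measurable fun q : T × F => g q.1 q.2) (hgR : ∀ σ, ‖g σ‖ ≤ R) (hM : 0 ≤ M)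
    {t : ℝ} (ht : t ∈ Icc (0 : ℝ) 1) :
    ∫ x, ∫ σ, formDensity K b L g t σ x * formScore K b L μ g t σ x ∂K.ν ∂(μ.prod K.law) =
      K.pathDeriv b L μ (fun σ y => g σ y) t := by
  have hC : 0 ≤ (k + 1) * M := by positivity
  have hn : ∀ y, K.Nice ((k + 1) * M) (formHam k b L g t y) := fun y =>
    h.nice_formHam hg hgR ht.1 y
  have hYm := h.measurable_formHam hg t
  obtain ⟨B, hB⟩ := h.exists_abs_kernel_form_le hgR μ
  have hmk := fun l => measurable_kernel_form (μ := μ) h hg l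
  have hdiag : Measurable fun σ => K.kernel L μ (fun σ y => g σ y) (k + 1) σ σ :=
    (hmk (k + 1)).comp (measurable_id.prodMk measurable_id)
  have e : ∀ x : F × (Fin (k + 1) → E),
      ∫ σ, formDensity K b L g t σ x * formScore K b L μ g t σ x ∂K.ν =
      1 / 2 * (K.prodW (formHam k b L g t x.1) (k + 1) x.2 *
        K.avg (formHam k b L g t x.1) (k + 1)
          (fun σ => K.kernel L μ (fun σ y => g σ y) (k + 1) σ σ) x.2) -
      ∑ l ∈ Finset.Icc 1 k, 1 / 2 * (K.m l - K.m (l - 1)) *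
        K.pairDensity (formHam k b L g t x.1) (k + 1) l (K.kernel L μ (fun σ y => g σ y) l) x.2 := by
    intro x
    have e1 : ∀ σ, formDensity K b L g t σ x * formScore K b L μ g t σ x =
        1 / 2 * K.prodW (formHam k b L g t x.1) (k + 1) x.2 *
          (K.kernel L μ (fun σ y => g σ y) (k + 1) σ σ *
            K.D (formHam k b L g t x.1) σ (k + 1) x.2) -
        ∑ l ∈ Finset.Icc 1 k, 1 / 2 * (K.m l - K.m (l - 1)) *
          K.prodW (formHam k b L g t x.1) (k + 1) x.2 *
          (K.avg (formHam k b L g t x.1) l (K.kernel L μ (fun σ y => g σ y) l σ) x.2 *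
            K.D (formHam k b L g t x.1) σ (k + 1) x.2) := by
      intro σ
      simp only [formDensity, formScore, mul_sub, Finset.mul_sum]
      congr 1
      · ring
      · exact Finset.sum_congr rfl fun l _ => by ring
    have i1 : Integrable (fun σ => K.kernel L μ (fun σ y => g σ y) (k + 1) σ σ *
            K.D (formHam k b L g t x.1) σ (k + 1) x.2) K.ν :=
      h.regular.integrable_mul_D hC (hn x.1) (Nat.le_add_left 1 k) x.2 hdiag
        (fun σ => hB (k + 1) σ σ)
    have i2 : ∀ l ∈ Finset.Icc 1 k, Integrable (fun σ =>
        K.avg (formHam k b L g t x.1) l (K.kernel L μ (fun σ y => g σ y) l σ) x.2 *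
            K.D (formHam k b L g t x.1) σ (k + 1) x.2) K.ν := fun l hl =>
      h.regular.integrable_mul_D hC (hn x.1) (Nat.le_add_left 1 k) x.2
        (h.regular.measurable_avg_left (hn x.1) (Finset.mem_Icc.1 hl).1 (hmk l) x.2)
        (fun σ => h.regular.abs_avg_le hC (hn x.1) (Finset.mem_Icc.1 hl).1 (hB l σ) x.2)
    simp only [e1]
    rw [integral_sub (i1.const_mul _) (integrable_finsetSum _ fun l hl => (i2 l hl).const_mul _),
      integral_finsetSum _ fun l hl => (i2 l hl).const_mul _]
    simp only [integral_const_mul, pairDensity]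
    congr 1
    · rw [avg]; ring
    · refine Finset.sum_congr rfl fun l _ => ?_
      rw [avg]; ring
  have hna : ∀ᵐ y ∂μ, K.Nice ((k + 1) * M) (formHam k b L g t y) := ae_of_all _ hn
  have j1 := h.regular.integrable_prodW_mul_avg (P := μ) hC hYm hna (k + 1) (Nat.le_add_left 1 k)
    hdiag (fun σ => hB (k + 1) σ σ)
  have j2 := fun l (hl : l ∈ Finset.Icc 1 k) => h.regular.integrable_pairDensity (P := μ) hC hYm hna
    (Nat.le_add_left 1 k) (Finset.mem_Icc.1 hl).1 (hmk l) (hB l)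
  simp only [e]
  rw [integral_sub (j1.const_mul _) (integrable_finsetSum _ fun l hl => (j2 l hl).const_mul _),
    integral_finsetSum _ fun l hl => (j2 l hl).const_mul _]
  rw [pathDeriv, mul_sub, Finset.mul_sum]
  simp only [integral_const_mul]
  congr 1
  refine Finset.sum_congr rfl fun l hl => ?_
  have hl' := Finset.mem_Icc.1 hl
  -- Consistency of the densities lowers the first configuration from level `k + 1` to level `l`.
  rw [h.regular.integral_pairDensity_prod_eq (P := μ) hC hYm hna hl'.1 (by omega) le_rfl (hmk l)
    (hB l), mul_assoc]
  rfl

/-- The derivative in `t` of the interpolating Hamiltonian driven by linear forms. -/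
def formDot (k : ℕ) (L : T → StrongDual ℝ E) (g : T → StrongDual ℝ F) (t : ℝ) (y : F) (σ : T)
    (z : Fin (k + 1) → E) : ℝ :=
  jointForm k g L (1 / (2 * √t)) (-(1 / (2 * √(1 - t)))) (k + 1) σ (y, z)

lemma abs_jointForm_le (hL : ∀ σ, ‖L σ‖ ≤ M) (hgR : ∀ σ, ‖g σ‖ ≤ R)
    {α α' c : ℝ} (hα : |α| ≤ c) (hα' : |α'| ≤ c) (σ : T) (x : F × (Fin (k + 1) → E)) :
    |jointForm k g L α α' (k + 1) σ x| ≤ c * (R * ‖x.1‖ + (k + 1) * M * ‖x.2‖) := by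
  have hc : 0 ≤ c := (abs_nonneg _).trans hα
  rw [jointForm_apply, mul_add]
  refine (abs_add_le _ _).trans (add_le_add ?_ ?_)
  · rw [abs_mul]
    exact mul_le_mul hα (((g σ).le_opNorm _).trans
        (mul_le_mul_of_nonneg_right (hgR σ) (norm_nonneg _))) (abs_nonneg _) hc
  · rw [abs_mul]
    exact mul_le_mul hα' (abs_fieldForm_le hL _ σ _) (abs_nonneg _) hc

lemma Admissible.measurable_jointForm (h : K.Admissible b L M)
    (hg : Measurable fun q : T × F => g q.1 q.2) (α α' : ℝ) (l : ℕ) :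
    Measurable fun q : T × (F × (Fin (k + 1) → E)) => jointForm k g L α α' l q.1 q.2 := by
  simp only [jointForm_apply]
  exact ((hg.comp (measurable_fst.prodMk measurable_snd.fst)).const_mul _).add
    (((measurable_fieldForm h.L_meas l).comp
      (measurable_fst.prodMk measurable_snd.snd)).const_mul _)

lemma Admissible.measurable_formDot (h : K.Admissible b L M)
    (hg : Measurable fun q : T × F => g q.1 q.2) (t : ℝ) :
    Measurable fun q : F × T × (Fin (k + 1) → E) => formDot k L g t q.1 q.2.1 q.2.2 := by
  simp only [formDot, jointForm_apply]
  exact ((hg.comp (measurable_snd.fst.prodMk measurable_fst)).const_mul _).add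
    (((measurable_fieldForm h.L_meas (k + 1)).comp measurable_snd).const_mul _)

/-- The nested average of the time derivative unfolds to one integral against the weighted density.
After Fubini, the integration by parts is made for each configuration separately, since its
direction depends on the configuration. -/
lemma Admissible.integral_fieldAvg_jointForm (h : K.Admissible b L M) (hk : 1 ≤ k)
    (hμ : ∫ y, y ∂μ = 0)
    (hg : Measurable fun q : T × F => g q.1 q.2) (hgR : ∀ σ, ‖g σ‖ ≤ R) (hR : 0 ≤ R) (hM : 0 ≤ M)
    {t : ℝ} (h0 : 0 < t) (h1 : t < 1)
    (hi : Integrable (fun q : F × (Fin (k + 1) → E) => K.fieldAvg (formHam k b L g t q.1) (formDot k L g t q.1) 1 q.2) (μ.prod K.law)) :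
    ∫ q : F × (Fin (k + 1) → E), K.fieldAvg (formHam k b L g t q.1) (formDot k L g t q.1) 1 q.2 ∂(μ.prod K.law) = K.pathDeriv b L μ (fun σ y => g σ y) t := by
  have hC : 0 ≤ (k + 1) * M := by positivity
  have ht : t ∈ Icc (0 : ℝ) 1 := ⟨h0.le, h1.le⟩
  set α := 1 / (2 * √t)
  set α' := -(1 / (2 * √(1 - t)))
  set c := max |α| |α'|
  have hc : 0 ≤ c := (abs_nonneg _).trans (le_max_left _ _)
  have hJm := h.measurable_jointForm hg α α' (k + 1)
  have hJ : ∀ σ x, |jointForm k g L α α' (k + 1) σ x| ≤ c * (R * ‖x.1‖ + (k + 1) * M * ‖x.2‖) :=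
    fun σ x => abs_jointForm_le h.L_le hgR (le_max_left _ _) (le_max_right _ _) σ x
  have hJ2 : ∀ σ x, |jointForm k g L α α' (k + 1) σ x| ≤ c * (R + (k + 1) * M) * ‖x‖ := by
    intro σ x
    refine (hJ σ x).trans ?_
    rw [mul_assoc c, add_mul R]
    exact mul_le_mul_of_nonneg_left (add_le_add (mul_le_mul_of_nonneg_left (norm_fst_le x) hR)
      (mul_le_mul_of_nonneg_left (norm_snd_le x) hC)) hc
  have hint := h.integrable_mul_formDensity (μ := μ) hg hgR hM ht hJm hJ2
  have hint2 : Integrable (fun x => ∫ σ, jointForm k g L α α' (k + 1) σ x *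
      formDensity K b L g t σ x ∂K.ν) (μ.prod K.law) := hint.integral_prod_left
  have hint3 : Integrable (fun q : (F × (Fin (k + 1) → E)) × T =>
      formDensity K b L g t q.2 q.1 * formScore K b L μ g t q.2 q.1) ((μ.prod K.law).prod K.ν) := by
    obtain ⟨B, hB⟩ := h.exists_abs_formScore_le (μ := μ) hg hgR hM ht.1
    obtain ⟨c, hc, H⟩ := h.exists_formDensity_le hg hgR hM ht
    have hexp : Integrable (fun x : F × (Fin (k + 1) → E) => Real.exp (c * (1 + ‖x‖)) * |B|)
        (μ.prod K.law) := by
      simp only [mul_add, Real.exp_add]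
      exact ((integrable_exp_norm_of_isGaussian _ c).const_mul _).mul_const _
    refine (hexp.comp_fst K.ν).mono' (((h.measurable_formDensity hg t).mul
      (h.measurable_formScore hg t)).comp measurable_swap).aestronglyMeasurable
      (ae_of_all _ fun q => ?_)
    rw [norm_mul]
    exact mul_le_mul (H _ _) ((hB _ _).trans (le_abs_self B)) (norm_nonneg _) (Real.exp_pos _).le
  rw [← h.integral_formDensity_mul_score hg hgR hM ht, integral_integral_swap hint3]
  have e : ∀ σ, ∫ x, formDensity K b L g t σ x * formScore K b L μ g t σ x ∂(μ.prod K.law) =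
      ∫ x, jointForm k g L α α' (k + 1) σ x * formDensity K b L g t σ x ∂(μ.prod K.law) :=
    fun σ => (h.integral_jointForm_mul_formDensity hk hμ hg hgR hM h0 h1 σ).symm
  simp only [e]
  rw [← integral_integral_swap hint, integral_prod _ hi, integral_prod _ hint2]
  congr 1
  ext y
  have hB : ∀ σ z, |formDot k L g t y σ z| ≤
      (c * (R * ‖y‖ + (k + 1) * M)) * (1 + ‖z‖) := by
    intro σ z
    refine (hJ σ (y, z)).trans ?_
    have a1 : 0 ≤ c * (R * ‖y‖) * ‖z‖ := by positivity
    have a2 : 0 ≤ c * ((k + 1) * M) := by positivity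
    simp only
    linarith
  have := h.regular.integral_fieldAvg hC (h.nice_formHam hg hgR ht.1 y)
    (F := formDot k L g t y)
    ((h.measurable_formDot hg t).comp (measurable_prodMk_left (x := y))) (by positivity) hB
  rw [this]
  congr 1
  ext z
  rw [← integral_const_mul]
  congr 1
  ext σ
  simp only [formDensity, formDot]
  ring

/-- The derivative of the free energy for a process given by linear forms on a Gaussian space. -/
theorem Admissible.hasDerivAt_pathEnergy_form (h : K.Admissible b L M) (hk : 1 ≤ k)
    (hμ : ∫ y, y ∂μ = 0) (hg : Measurable fun q : T × F => g q.1 q.2) (hgR : ∀ σ, ‖g σ‖ ≤ R)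
    (hR : 0 ≤ R) (hM : 0 ≤ M) {t : ℝ} (h0 : 0 < t) (h1 : t < 1) :
    HasDerivAt (K.pathEnergy b L μ (fun σ y => g σ y)) (K.pathDeriv b L μ (fun σ y => g σ y) t) t := by
  have hC : 0 ≤ (k + 1) * M := by positivity
  -- An interval around `t` on which `τ > t / 2` and `1 - τ > (1 - t) / 2`, so that the singular
  -- coefficients of the time derivative stay below the constant `c`.
  set s : Set ℝ := Ioo (t / 2) ((1 + t) / 2) with hs
  have hts : t ∈ s := ⟨by linarith, by linarith⟩
  have hs0 : ∀ τ ∈ s, 0 < τ ∧ τ < 1 := fun τ hτ => ⟨by linarith [hτ.1], by linarith [hτ.2]⟩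
  set c := max (1 / (2 * √(t / 2))) (1 / (2 * √((1 - t) / 2)))
  have hc : 0 ≤ c := le_max_of_le_left (by positivity)
  have hcα : ∀ τ ∈ s, |1 / (2 * √τ)| ≤ c ∧ |-(1 / (2 * √(1 - τ)))| ≤ c := by
    intro τ hτ
    constructor
    · rw [abs_of_nonneg (by positivity)]
      refine le_max_of_le_left (one_div_le_one_div_of_le ?_ ?_)
      · have : 0 < √(t / 2) := Real.sqrt_pos.2 (by linarith)
        linarith
      · have := Real.sqrt_le_sqrt hτ.1.le
        linarith
    · rw [abs_neg, abs_of_nonneg (by positivity)]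
      refine le_max_of_le_right (one_div_le_one_div_of_le ?_ ?_)
      · have : 0 < √((1 - t) / 2) := Real.sqrt_pos.2 (by linarith)
        linarith
      · have := Real.sqrt_le_sqrt (show (1 - t) / 2 ≤ 1 - τ by linarith [hτ.2])
        linarith
  have hJm : ∀ τ, Measurable fun q : F × T × (Fin (k + 1) → E) => formDot k L g τ q.1 q.2.1 q.2.2 := fun τ =>
    h.measurable_formDot hg τ
  have hJ : ∀ τ ∈ s, ∀ y σ z, |formDot k L g τ y σ z| ≤ c * (R * ‖y‖ + (k + 1) * M) * (1 + ‖z‖) := by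
    intro τ hτ y σ z
    refine (abs_jointForm_le h.L_le hgR (hcα τ hτ).1 (hcα τ hτ).2 σ (y, z)).trans ?_
    have a1 : 0 ≤ c * (R * ‖y‖) * ‖z‖ := by positivity
    have a2 : 0 ≤ c * ((k + 1) * M) := by positivity
    simp only
    linarith
  obtain ⟨C', hC', H⟩ := h.regular.exists_abs_fieldAvg_le hC 1 le_rfl
  have hnice : ∀ τ ∈ s, ∀ y, K.Nice ((k + 1) * M) (formHam k b L g τ y) := fun τ hτ y =>
    h.nice_formHam hg hgR (hs0 τ hτ).1.le y
  have hXm : ∀ τ, Measurable fun q : F × (Fin (k + 1) → E) => K.X (formHam k b L g τ q.1) 1 q.2 :=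
    fun τ => measurable_X (h.measurable_formHam hg τ) 1 le_rfl
  have hFm : ∀ τ, Measurable fun q : F × (Fin (k + 1) → E) =>
      K.fieldAvg (formHam k b L g τ q.1) (formDot k L g τ q.1) 1 q.2 :=
    fun τ => measurable_fieldAvg (h.measurable_formHam hg τ) (hJm τ) 1 le_rfl
  have hbd : ∀ τ ∈ s, ∀ q : F × (Fin (k + 1) → E),
      ‖K.fieldAvg (formHam k b L g τ q.1) (formDot k L g τ q.1) 1 q.2‖ ≤
        c * (R * ‖q.1‖ + (k + 1) * M) * Real.exp (C' * (1 + ‖q.2‖)) := fun τ hτ q =>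
    H _ (hnice τ hτ q.1) (formDot k L g τ q.1) _ (by positivity) (hJ τ hτ q.1) q.2
  have hbi : Integrable (fun q : F × (Fin (k + 1) → E) =>
      c * (R * ‖q.1‖ + (k + 1) * M) * Real.exp (C' * (1 + ‖q.2‖))) (μ.prod K.law) := by
    have : Integrable (fun y : F => c * (R * ‖y‖ + (k + 1) * M)) μ :=
      (((IsGaussian.integrable_id (μ := μ)).norm.const_mul R).add (integrable_const _)).const_mul c
    exact this.mul_prod (h.regular.integrable_exp_one_add C')
  have hXi : Integrable (fun q : F × (Fin (k + 1) → E) => K.X (formHam k b L g t q.1) 1 q.2)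
      (μ.prod K.law) := by
    have hi : Integrable (fun y : F => (R * ‖y‖ + M) + |Real.log (K.ν.real univ)|) μ :=
      (((IsGaussian.integrable_id (μ := μ)).norm.const_mul R).add (integrable_const _)).add
        (integrable_const _)
    refine h.regular.integrable_X hC (h.measurable_formHam hg t) (ae_of_all _ (hnice t hts)) hi
      (ae_of_all _ fun y => abs_X_top_zero_le (hnice t hts y) fun σ => ?_) le_rfl
    rw [formHam, pathHam_zero]
    refine (abs_add_le _ _).trans (add_le_add ?_ (h.b_le σ))
    rw [abs_mul, abs_of_nonneg (Real.sqrt_nonneg t)]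
    exact (mul_le_of_le_one_left (abs_nonneg _) (Real.sqrt_le_one.2 h1.le)).trans
      (((g σ).le_opNorm y).trans (mul_le_mul_of_nonneg_right (hgR σ) (norm_nonneg _)))
  have hd : ∀ q : F × (Fin (k + 1) → E), ∀ τ ∈ s,
      HasDerivAt (fun τ => K.X (formHam k b L g τ q.1) 1 q.2)
        (K.fieldAvg (formHam k b L g τ q.1) (formDot k L g τ q.1) 1 q.2) τ := by
    intro q τ hτ
    refine h.regular.hasDerivAt_X hC (B := c * (R * ‖q.1‖ + (k + 1) * M)) (by positivity) isOpen_Ioo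
      (Y := fun τ => formHam k b L g τ q.1) (Y' := fun τ => formDot k L g τ q.1)
      (fun τ hτ => hnice τ hτ q.1) (fun τ _ => ?_) (fun τ hτ => hJ τ hτ q.1) ?_ 1 le_rfl τ hτ q.2
    · exact (hJm τ).comp (measurable_prodMk_left (x := q.1))
    · intro τ hτ σ z
      refine (hasDerivAt_pathHam (hs0 τ hτ).1 (hs0 τ hτ).2 σ z).congr_deriv ?_
      simp only [formDot, jointForm_apply]
  have main := hasDerivAt_integral_of_dominated_loc_of_deriv_le (μ := μ.prod K.law)
    (F := fun τ q => K.X (formHam k b L g τ q.1) 1 q.2)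
    (F' := fun τ q => K.fieldAvg (formHam k b L g τ q.1) (formDot k L g τ q.1) 1 q.2)
    (x₀ := t) (s := s) (bound := fun q => c * (R * ‖q.1‖ + (k + 1) * M) *
      Real.exp (C' * (1 + ‖q.2‖))) (isOpen_Ioo.mem_nhds hts)
    (Eventually.of_forall fun τ => (hXm τ).aestronglyMeasurable) hXi
    (hFm t).aestronglyMeasurable (ae_of_all _ fun q τ hτ => hbd τ hτ q) hbi
    (ae_of_all _ fun q τ hτ => hd q τ hτ)
  rw [← h.integral_fieldAvg_jointForm hk hμ hg hgR hR hM h0 h1 main.1]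
  exact main.2

end Cascade

end

/-! ### Stability of the recursion under convergence of the Gibbs weights. -/

section

namespace Cascade

section Pointwise

variable {k : ℕ} {E T ι : Type*} [NormedAddCommGroup E] [MeasurableSpace E]
  [BorelSpace E] [SecondCountableTopology E] [MeasurableSpace T]
  {K : Cascade k E T} [∀ p, IsProbabilityMeasure (K.γ p)] [NeZero K.ν] [IsFiniteMeasure K.ν]
  {C : ℝ} {Y : T → (Fin (k + 1) → E) → ℝ} {Ys : ι → T → (Fin (k + 1) → E) → ℝ}
  {u : Filter ι} [u.IsCountablyGenerated]

/-- Convergence of the Gibbs weights in `L¹`, for all values of the fields. -/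
def ExpTendsto (K : Cascade k E T) (Ys : ι → T → (Fin (k + 1) → E) → ℝ) (u : Filter ι)
    (Y : T → (Fin (k + 1) → E) → ℝ) : Prop :=
  ∀ z, Tendsto (fun i => ∫ σ, |Real.exp (Ys i σ z) - Real.exp (Y σ z)| ∂K.ν) u (𝓝 0)

lemma ExpTendsto.tendsto_integral_exp (hlim : K.ExpTendsto Ys u Y) (hYs : ∀ i, K.Nice C (Ys i))
    (hY : K.Nice C Y) (z : Fin (k + 1) → E) :
    Tendsto (fun i => ∫ σ, Real.exp (Ys i σ z) ∂K.ν) u (𝓝 (∫ σ, Real.exp (Y σ z) ∂K.ν)) := by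
  rw [tendsto_iff_norm_sub_tendsto_zero]
  refine squeeze_zero (fun _ => norm_nonneg _) (fun i => ?_) (hlim z)
  rw [← integral_sub ((hYs i).integrable_exp z) (hY.integrable_exp z)]
  exact norm_integral_le_integral_norm _

/-- Dominated convergence level by level from the top. The growth estimates are common to the whole
family once the values at the origin are bounded, which holds eventually because these converge. -/
lemma Regular.tendsto_X (hK : K.Regular) (hC : 0 ≤ C) (hYs : ∀ i, K.Nice C (Ys i))
    (hY : K.Nice C Y) (hlim : K.ExpTendsto Ys u Y) (l : ℕ) (hl : 1 ≤ l) (z : Fin (k + 1) → E) :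
    Tendsto (fun i => K.X (Ys i) l z) u (𝓝 (K.X Y l z)) := by
  have htop : ∀ l, k < l → ∀ z, Tendsto (fun i => K.X (Ys i) l z) u (𝓝 (K.X Y l z)) := by
    intro l h z
    simp only [X_top h]
    exact (hlim.tendsto_integral_exp hYs hY z).log (hY.integral_exp_pos z).ne'
  revert z
  refine level_induction (k := k)
    (p := fun l => ∀ z, Tendsto (fun i => K.X (Ys i) l z) u (𝓝 (K.X Y l z))) htop ?_ l hl
  intro l h1 h ih z
  have hm := hK.m_pos l h1 h
  obtain ⟨C', hC', H⟩ := hK.exists_abs_X_sub_le hC (l + 1) (Nat.le_add_left 1 l)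
  have hev : ∀ᶠ i in u, |K.X (Ys i) (k + 1) 0| ≤ |K.X Y (k + 1) 0| + 1 :=
    ((htop (k + 1) (Nat.lt_succ_self k) 0).abs).eventually_le_const (by linarith)
  set B := |K.X Y (k + 1) 0| + 1
  simp only [X_of_le h]
  refine Tendsto.const_mul _ (Tendsto.log ?_ ?_)
  · simp only [levelExp]
    refine tendsto_integral_filter_of_dominated_convergence
      (fun z' => Real.exp (K.m l * (B + C' * (1 + ‖z‖))) * Real.exp (K.m l * C' * ‖z'‖))
      (Eventually.of_forall fun i => ?_) ?_ ((hK.exp_int _).const_mul _) (ae_of_all _ fun z' => ?_)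
    · exact (Real.measurable_exp.comp (((measurable_X' (hYs i).meas (Nat.le_add_left 1 l)).comp
        (measurable_merge_left l z)).const_mul _)).aestronglyMeasurable
    · filter_upwards [hev] with i hi
      refine ae_of_all _ fun z' => ?_
      rw [Real.norm_eq_abs, Real.abs_exp, ← Real.exp_add]
      refine Real.exp_le_exp.2 ?_
      have h1 := abs_le.1 (H _ (hYs i) (merge l z z'))
      have h2 := abs_le.1 hi
      have h3 : C' * (1 + ‖merge l z z'‖) ≤ C' * (1 + ‖z‖) + C' * ‖z'‖ := by
        rw [← mul_add]
        exact mul_le_mul_of_nonneg_left (by linarith [norm_merge_le l z z']) hC'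
      rw [mul_assoc, ← mul_add]
      exact mul_le_mul_of_nonneg_left (by linarith) hm.le
    · exact (Real.continuous_exp.tendsto _).comp ((ih _).const_mul _)
  · rw [← hK.exp_mul_X hC hY h1 h]
    exact (Real.exp_pos _).ne'

lemma Regular.tendsto_W (hK : K.Regular) (hC : 0 ≤ C) (hYs : ∀ i, K.Nice C (Ys i))
    (hY : K.Nice C Y) (hlim : K.ExpTendsto Ys u Y) (l : ℕ) (hl : 1 ≤ l) (z : Fin (k + 1) → E) :
    Tendsto (fun i => K.W (Ys i) l z) u (𝓝 (K.W Y l z)) :=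
  (Real.continuous_exp.tendsto _).comp ((((hK.tendsto_X hC hYs hY hlim (l + 1) (by omega) z).sub
    (hK.tendsto_X hC hYs hY hlim l hl z))).const_mul _)

lemma Regular.tendsto_prodW (hK : K.Regular) (hC : 0 ≤ C) (hYs : ∀ i, K.Nice C (Ys i))
    (hY : K.Nice C Y) (hlim : K.ExpTendsto Ys u Y) (l : ℕ) (z : Fin (k + 1) → E) :
    Tendsto (fun i => K.prodW (Ys i) l z) u (𝓝 (K.prodW Y l z)) :=
  tendsto_finsetProd _ fun i hi => hK.tendsto_W hC hYs hY hlim i (Finset.mem_Ico.1 hi).1 z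

/-- The Gibbs averages converge uniformly over the functions bounded by `1`. -/
lemma Regular.exists_abs_avg_sub_le (hK : K.Regular) (hC : 0 ≤ C) (hYs : ∀ i, K.Nice C (Ys i))
    (hY : K.Nice C Y) (hlim : K.ExpTendsto Ys u Y) (l : ℕ) (hl : 1 ≤ l) :
    ∃ δ : ι → (Fin (k + 1) → E) → ℝ, (∀ i, Measurable (δ i)) ∧ (∀ i z, 0 ≤ δ i z) ∧
      (∀ i z, δ i z ≤ 2) ∧ (∀ z, Tendsto (fun i => δ i z) u (𝓝 0)) ∧
      ∀ i z (f : T → ℝ), Measurable f → (∀ σ, |f σ| ≤ 1) →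
        |K.avg (Ys i) l f z - K.avg Y l f z| ≤ δ i z := by
  have hle2 : ∀ l, 1 ≤ l → ∀ i z (f : T → ℝ), (∀ σ, |f σ| ≤ 1) →
      |K.avg (Ys i) l f z - K.avg Y l f z| ≤ 2 := by
    intro l hl i z f hf
    refine (abs_sub _ _).trans ?_
    linarith [hK.abs_avg_le hC (hYs i) hl hf z, hK.abs_avg_le hC hY hl hf z]
  refine level_induction (k := k) (p := fun l => ∃ δ : ι → (Fin (k + 1) → E) → ℝ,
    (∀ i, Measurable (δ i)) ∧ (∀ i z, 0 ≤ δ i z) ∧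
      (∀ i z, δ i z ≤ 2) ∧ (∀ z, Tendsto (fun i => δ i z) u (𝓝 0)) ∧
      ∀ i z (f : T → ℝ), Measurable f → (∀ σ, |f σ| ≤ 1) →
        |K.avg (Ys i) l f z - K.avg Y l f z| ≤ δ i z) ?_ ?_ l hl
  · intro l h
    have h1l : 1 ≤ l := by omega
    have hDi : ∀ (i : ι) z, Integrable (fun σ => |K.D (Ys i) σ l z - K.D Y σ l z|) K.ν :=
      fun i z => ((hK.integrable_D hC (hYs i) h1l z).sub (hK.integrable_D hC hY h1l z)).abs
    -- At the top level the error is the `L¹` distance of the Gibbs densities. It splits into the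
    -- distance of the weights and the difference of the two normalizations.
    have hlimD : ∀ z, Tendsto (fun i => ∫ σ, |K.D (Ys i) σ l z - K.D Y σ l z| ∂K.ν) u (𝓝 0) := by
      intro z
      have hZ := hlim.tendsto_integral_exp hYs hY z
      have hZ0 := hY.integral_exp_pos z
      set Z := ∫ σ, Real.exp (Y σ z) ∂K.ν
      have hbd : ∀ i, ∫ σ, |K.D (Ys i) σ l z - K.D Y σ l z| ∂K.ν ≤
          (∫ σ, Real.exp (Ys i σ z) ∂K.ν)⁻¹ *
            ∫ σ, |Real.exp (Ys i σ z) - Real.exp (Y σ z)| ∂K.ν +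
          |(∫ σ, Real.exp (Ys i σ z) ∂K.ν)⁻¹ - Z⁻¹| * Z := by
        intro i
        have hZi := (hYs i).integral_exp_pos z
        have i1 := (((hYs i).integrable_exp z).sub (hY.integrable_exp z)).abs
        simp only [Pi.sub_apply] at i1
        rw [← integral_const_mul, ← integral_const_mul,
          ← integral_add (i1.const_mul _) ((hY.integrable_exp z).const_mul _)]
        refine integral_mono (hDi i z) ((i1.const_mul _).add
          ((hY.integrable_exp z).const_mul _)) fun σ => ?_
        simp only [D_top h]
        have e : Real.exp (Ys i σ z) / ∫ τ, Real.exp (Ys i τ z) ∂K.ν -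
            Real.exp (Y σ z) / ∫ τ, Real.exp (Y τ z) ∂K.ν =
            (∫ σ, Real.exp (Ys i σ z) ∂K.ν)⁻¹ * (Real.exp (Ys i σ z) - Real.exp (Y σ z)) +
            ((∫ σ, Real.exp (Ys i σ z) ∂K.ν)⁻¹ - Z⁻¹) * Real.exp (Y σ z) := by
          simp only [div_eq_mul_inv, Z]
          ring
        rw [e]
        refine (abs_add_le _ _).trans (le_of_eq ?_)
        rw [abs_mul, abs_mul, abs_of_pos (inv_pos.2 hZi), Real.abs_exp]
      have hinv := hZ.inv₀ hZ0.ne'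
      have hl2 := ((hinv.mul (hlim z)).add (((hinv.sub_const Z⁻¹).abs).mul_const Z))
      refine squeeze_zero (fun i => integral_nonneg fun σ => abs_nonneg _) hbd ?_
      simpa using hl2
    refine ⟨fun i z => ∫ σ, |K.D (Ys i) σ l z - K.D Y σ l z| ∂K.ν, fun i => ?_,
      fun i z => integral_nonneg fun σ => abs_nonneg _, fun i z => ?_, hlimD, fun i z f hf hf1 => ?_⟩
    · refine measurable_integral_snd (f := fun z σ => |K.D (Ys i) σ l z - K.D Y σ l z|) ?_
      exact measurable_abs.comp (((measurable_D' (hYs i).meas h1l).comp measurable_swap).sub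
        ((measurable_D' hY.meas h1l).comp measurable_swap))
    · calc ∫ σ, |K.D (Ys i) σ l z - K.D Y σ l z| ∂K.ν
          ≤ ∫ σ, (K.D (Ys i) σ l z + K.D Y σ l z) ∂K.ν := by
            refine integral_mono (hDi i z)
              ((hK.integrable_D hC (hYs i) h1l z).add (hK.integrable_D hC hY h1l z)) fun σ => ?_
            refine (abs_sub _ _).trans ?_
            rw [abs_of_nonneg (D_nonneg _ _ h1l _), abs_of_nonneg (D_nonneg _ _ h1l _)]
        _ = 2 := by
            rw [integral_add (hK.integrable_D hC (hYs i) h1l z) (hK.integrable_D hC hY h1l z),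
              hK.integral_D hC (hYs i) h1l, hK.integral_D hC hY h1l]
            norm_num
    · rw [avg, avg, ← integral_sub (hK.integrable_mul_D hC (hYs i) h1l z hf hf1)
        (hK.integrable_mul_D hC hY h1l z hf hf1)]
      refine abs_integral_le_of_forall_abs_le (hDi i z) fun σ => ?_
      rw [← mul_sub, abs_mul]
      exact mul_le_of_le_one_left (abs_nonneg _) (hf1 σ)
  · rintro l h1 h ⟨δ, hδm, hδ0, hδ2, hδlim, hδ⟩
    obtain ⟨C', hC', H⟩ := hK.exists_W_le hC l h1
    -- The two terms of `W_i a_i - W a = W_i (a_i - a) + (W_i - W) a`, with `a_i` and `a` averages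
    -- of a function bounded by `1`.
    set R : ι → (Fin (k + 1) → E) → ℝ := fun i z =>
      K.W (Ys i) l z * δ i z + |K.W (Ys i) l z - K.W Y l z| with hR
    have hRm : ∀ i, Measurable (R i) := fun i =>
      ((measurable_W' (hYs i).meas h1).mul (hδm i)).add
        (measurable_abs.comp ((measurable_W' (hYs i).meas h1).sub (measurable_W' hY.meas h1)))
    have hR0 : ∀ i z, 0 ≤ R i z := fun i z =>
      add_nonneg (mul_nonneg (W_pos _ _).le (hδ0 i z)) (abs_nonneg _)
    have hRle : ∀ i z, R i z ≤ 4 * Real.exp (C' * (1 + ‖z‖)) := by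
      intro i z
      have a1 := H _ (hYs i) z
      have a2 := H _ hY z
      have a3 : K.W (Ys i) l z * δ i z ≤ Real.exp (C' * (1 + ‖z‖)) * 2 :=
        mul_le_mul a1 (hδ2 i z) (hδ0 i z) (Real.exp_pos _).le
      have a4 := abs_sub (K.W (Ys i) l z) (K.W Y l z)
      rw [abs_of_pos (W_pos l z), abs_of_pos (W_pos l z)] at a4
      simp only [hR]
      linarith
    have hRexp : ∀ i, ExpBdd (R i) := by
      intro i
      refine ⟨hRm i, C' + 3, by linarith, fun z => ?_⟩
      rw [abs_of_nonneg (hR0 i z)]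
      refine (hRle i z).trans ?_
      rw [add_mul, Real.exp_add, mul_comm]
      refine mul_le_mul_of_nonneg_left ?_ (Real.exp_pos _).le
      have := Real.add_one_le_exp (3 * (1 + ‖z‖))
      linarith [norm_nonneg z]
    -- Truncation at `2`, the trivial bound for the difference of two such averages, preserves the
    -- uniform bound used as a majorant at the next level.
    refine ⟨fun i z => min 2 (K.levelExp l (R i) z), fun i => ?_, fun i z => ?_,
      fun i z => min_le_left _ _, fun z => ?_, fun i z f hf hf1 => ?_⟩
    · exact measurable_const.min (hK.expBdd_levelExp (hRexp i) l).1
    · exact le_min zero_le_two (integral_nonneg fun z' => hR0 i _)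
    · have hlev : Tendsto (fun i => K.levelExp l (R i) z) u (𝓝 0) := by
        have : Tendsto (fun i => K.levelExp l (R i) z) u (𝓝 (∫ _, (0 : ℝ) ∂K.law)) := by
          simp only [levelExp]
          refine tendsto_integral_filter_of_dominated_convergence
            (fun z' => 4 * (Real.exp (C' * (1 + ‖z‖)) * Real.exp (C' * ‖z'‖)))
            (Eventually.of_forall fun i =>
              ((hRm i).comp (measurable_merge_left l z)).aestronglyMeasurable)
            (Eventually.of_forall fun i => ae_of_all _ fun z' => ?_)
            (((hK.exp_int _).const_mul _).const_mul _) (ae_of_all _ fun z' => ?_)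
          · rw [Real.norm_eq_abs, abs_of_nonneg (hR0 i _)]
            exact (hRle i _).trans (mul_le_mul_of_nonneg_left (exp_norm_merge_le hC' l z z')
              (by norm_num))
          · have hW := hK.tendsto_W hC hYs hY hlim l h1 (merge l z z')
            have := (hW.mul (hδlim (merge l z z'))).add ((hW.sub_const (K.W Y l (merge l z z'))).abs)
            simpa using this
        simpa using this
      have := (tendsto_const_nhds (x := (2 : ℝ)) (f := u)).min hlev
      simpa using this
    · refine le_min (hle2 l h1 i z f hf1) ?_
      rw [← hK.levelExp_W_avg hC (hYs i) h1 h hf hf1, ← hK.levelExp_W_avg hC hY h1 h hf hf1]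
      have hl1 : 1 ≤ l + 1 := Nat.le_add_left 1 l
      have j1 : ExpBdd fun z' => K.W (Ys i) l z' * K.avg (Ys i) (l + 1) f z' :=
        (hK.expBdd_W hC (hYs i) h1).mul (ExpBdd.of_bounded (measurable_avg' (hYs i).meas hl1 hf)
          (hK.abs_avg_le hC (hYs i) hl1 hf1))
      have j2 : ExpBdd fun z' => K.W Y l z' * K.avg Y (l + 1) f z' :=
        (hK.expBdd_W hC hY h1).mul (ExpBdd.of_bounded (measurable_avg' hY.meas hl1 hf)
          (hK.abs_avg_le hC hY hl1 hf1))
      simp only [levelExp]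
      rw [← integral_sub (hK.integrable_merge j1 l z) (hK.integrable_merge j2 l z)]
      refine abs_integral_le_of_forall_abs_le (hK.integrable_merge (hRexp i) l z) fun z' => ?_
      set y := merge l z z'
      have e : K.W (Ys i) l y * K.avg (Ys i) (l + 1) f y - K.W Y l y * K.avg Y (l + 1) f y =
        K.W (Ys i) l y * (K.avg (Ys i) (l + 1) f y - K.avg Y (l + 1) f y) +
          (K.W (Ys i) l y - K.W Y l y) * K.avg Y (l + 1) f y := by ring
      rw [e]
      refine (abs_add_le _ _).trans (add_le_add ?_ ?_)
      · rw [abs_mul, abs_of_pos (W_pos l y)]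
        exact mul_le_mul_of_nonneg_left (hδ i y f hf hf1) (W_pos l y).le
      · rw [abs_mul]
        exact mul_le_of_le_one_right (abs_nonneg _) (hK.abs_avg_le hC hY hl1 hf1 y)

/-- The uniform estimate changes the measure while the function is held fixed; dominated convergence
then changes the function. Letting the function vary with `i` is what makes iterated averages
possible. -/
lemma Regular.tendsto_avg (hK : K.Regular) (hC : 0 ≤ C) (hYs : ∀ i, K.Nice C (Ys i))
    (hY : K.Nice C Y) (hlim : K.ExpTendsto Ys u Y) {l : ℕ} (hl : 1 ≤ l) {fs : ι → T → ℝ}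
    {f : T → ℝ} (hfs : ∀ i, Measurable (fs i)) {B : ℝ}
    (hfsB : ∀ i σ, |fs i σ| ≤ B)
    (hfl : ∀ σ, Tendsto (fun i => fs i σ) u (𝓝 (f σ))) (z : Fin (k + 1) → E) :
    Tendsto (fun i => K.avg (Ys i) l (fs i) z) u (𝓝 (K.avg Y l f z)) := by
  obtain ⟨δ, -, -, -, hδlim, hδ⟩ := hK.exists_abs_avg_sub_le hC hYs hY hlim l hl
  have hB1 : 0 < |B| + 1 := by positivity
  have h1 : Tendsto (fun i => K.avg Y l (fs i) z) u (𝓝 (K.avg Y l f z)) := by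
    simp only [avg]
    refine tendsto_integral_filter_of_dominated_convergence (fun σ => B * K.D Y σ l z)
      (Eventually.of_forall fun i => (hK.integrable_mul_D hC hY hl z (hfs i) (hfsB i)).1)
      (Eventually.of_forall fun i => ae_of_all _ fun σ => ?_)
      ((hK.integrable_D hC hY hl z).const_mul B) (ae_of_all _ fun σ => (hfl σ).mul_const _)
    rw [Real.norm_eq_abs, abs_mul, abs_of_nonneg (D_nonneg σ l hl z)]
    exact mul_le_mul_of_nonneg_right (hfsB i σ) (D_nonneg σ l hl z)
  have h2 : Tendsto (fun i => K.avg (Ys i) l (fs i) z - K.avg Y l (fs i) z) u (𝓝 0) := by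
    refine squeeze_zero_norm (a := fun i => (|B| + 1) * δ i z) (fun i => ?_)
      (by simpa using (hδlim z).const_mul (|B| + 1))
    have := hδ i z (fun σ => (|B| + 1)⁻¹ * fs i σ) ((hfs i).const_mul _) fun σ => by
      rw [abs_mul, abs_of_pos (inv_pos.2 hB1), inv_mul_le_one₀ hB1]
      linarith [hfsB i σ, le_abs_self B]
    have e : ∀ Y, K.avg Y l (fun σ => (|B| + 1)⁻¹ * fs i σ) z = (|B| + 1)⁻¹ * K.avg Y l (fs i) z :=
      fun Y => by simp only [avg, mul_assoc, integral_const_mul]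
    rw [e, e, ← mul_sub, abs_mul, abs_of_pos (inv_pos.2 hB1), inv_mul_le_iff₀ hB1] at this
    exact this
  simpa using h2.add h1

lemma Regular.tendsto_avg_avg (hK : K.Regular) (hC : 0 ≤ C) (hYs : ∀ i, K.Nice C (Ys i))
    (hY : K.Nice C Y) (hlim : K.ExpTendsto Ys u Y) {j l : ℕ} (hj : 1 ≤ j) (hl : 1 ≤ l)
    {fs : ι → T → T → ℝ} {f : T → T → ℝ} (hfs : ∀ i, Measurable fun q : T × T => fs i q.1 q.2)
    {B : ℝ} (hfsB : ∀ i σ ρ, |fs i σ ρ| ≤ B)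
    (hfl : ∀ σ ρ, Tendsto (fun i => fs i σ ρ) u (𝓝 (f σ ρ))) (z : Fin (k + 1) → E) :
    Tendsto (fun i => K.avg (Ys i) j (fun σ => K.avg (Ys i) l (fs i σ) z) z) u
      (𝓝 (K.avg Y j (fun σ => K.avg Y l (f σ) z) z)) :=
  hK.tendsto_avg hC hYs hY hlim hj (fun i => hK.measurable_avg_left (hYs i) hl (hfs i) z)
    (fun i σ => hK.abs_avg_le hC (hYs i) hl (hfsB i σ) z)
    (fun σ => hK.tendsto_avg hC hYs hY hlim hl (fun i => (hfs i).comp measurable_prodMk_left)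
      (fun i => hfsB i σ) (hfl σ) z) z

end Pointwise

section Averaged

variable {k : ℕ} {E T Ω ι : Type*} [NormedAddCommGroup E] [MeasurableSpace E]
  [NormedSpace ℝ E] [CompleteSpace E]
  [BorelSpace E] [SecondCountableTopology E] [MeasurableSpace T] [MeasurableSpace Ω]
  {K : Cascade k E T} {P : Measure Ω} [IsProbabilityMeasure P]
  [∀ p, IsProbabilityMeasure (K.γ p)] [NeZero K.ν] [IsFiniteMeasure K.ν]
  {C : ℝ} {Y : Ω → T → (Fin (k + 1) → E) → ℝ} {Ys : ι → Ω → T → (Fin (k + 1) → E) → ℝ}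
  {u : Filter ι} [u.IsCountablyGenerated]

lemma Regular.tendsto_integral_X (hK : K.Regular) (hC : 0 ≤ C)
    (hms : ∀ i, Measurable fun q : Ω × T × (Fin (k + 1) → E) => Ys i q.1 q.2.1 q.2.2)
    (hYs : ∀ᵐ ω ∂P, ∀ i, K.Nice C (Ys i ω)) (hY : ∀ᵐ ω ∂P, K.Nice C (Y ω))
    (hlim : ∀ᵐ ω ∂P, K.ExpTendsto (fun i => Ys i ω) u (Y ω)) {B : Ω → ℝ} (hB : Integrable B P)
    (h0 : ∀ᵐ ω ∂P, ∀ i, |K.X (Ys i ω) (k + 1) 0| ≤ B ω) {l : ℕ} (hl : 1 ≤ l) :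
    Tendsto (fun i => ∫ q, K.X (Ys i q.1) l q.2 ∂(P.prod K.law)) u
      (𝓝 (∫ q, K.X (Y q.1) l q.2 ∂(P.prod K.law))) := by
  obtain ⟨C', hC', H⟩ := hK.exists_abs_X_sub_le hC l hl
  have i1 : Integrable (fun q : Ω × (Fin (k + 1) → E) => B q.1) (P.prod K.law) := hB.comp_fst _
  have i2 : Integrable (fun z : Fin (k + 1) → E => C' * (1 + ‖z‖)) K.law := by
    refine (hK.integrable_exp_one_add C').mono' (by fun_prop) (ae_of_all _ fun z => ?_)
    rw [Real.norm_eq_abs, abs_of_nonneg (by positivity)]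
    linarith [Real.add_one_le_exp (C' * (1 + ‖z‖))]
  refine tendsto_integral_filter_of_dominated_convergence
    (fun q => B q.1 + C' * (1 + ‖q.2‖))
    (Eventually.of_forall fun i => (measurable_X (hms i) l hl).aestronglyMeasurable)
    (Eventually.of_forall fun i => ?_) (i1.add (i2.comp_snd P)) ?_
  · filter_upwards [ae_prod_of_ae_fst hYs, ae_prod_of_ae_fst h0] with q h1 h2
    have h3 := abs_le.1 (H _ (h1 i) q.2)
    have h4 := abs_le.1 (h2 i)
    rw [Real.norm_eq_abs, abs_le]
    constructor <;> linarith
  · filter_upwards [ae_prod_of_ae_fst hYs, ae_prod_of_ae_fst hY, ae_prod_of_ae_fst hlim]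
      with q h1 h2 h3
    exact hK.tendsto_X hC h1 h2 h3 l hl q.2

lemma Regular.tendsto_integral_prodW_mul (hK : K.Regular) (hC : 0 ≤ C)
    (hms : ∀ i, Measurable fun q : Ω × T × (Fin (k + 1) → E) => Ys i q.1 q.2.1 q.2.2)
    (hYs : ∀ᵐ ω ∂P, ∀ i, K.Nice C (Ys i ω)) (hY : ∀ᵐ ω ∂P, K.Nice C (Y ω))
    (hlim : ∀ᵐ ω ∂P, K.ExpTendsto (fun i => Ys i ω) u (Y ω)) (j : ℕ)
    {fs : ι → Ω × (Fin (k + 1) → E) → ℝ} {f : Ω × (Fin (k + 1) → E) → ℝ}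
    (hfs : ∀ i, Measurable (fs i)) {B : ℝ} (hB : ∀ᵐ ω ∂P, ∀ i z, |fs i (ω, z)| ≤ B)
    (hf : ∀ᵐ ω ∂P, ∀ z, Tendsto (fun i => fs i (ω, z)) u (𝓝 (f (ω, z)))) :
    Tendsto (fun i => ∫ q, K.prodW (Ys i q.1) j q.2 * fs i q ∂(P.prod K.law)) u
      (𝓝 (∫ q, K.prodW (Y q.1) j q.2 * f q ∂(P.prod K.law))) := by
  obtain ⟨C', hC', H⟩ := hK.exists_prodW_le hC j
  have hi : Integrable (fun q : Ω × (Fin (k + 1) → E) => B * Real.exp (C' * (1 + ‖q.2‖)))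
      (P.prod K.law) :=
    (integrable_const (μ := P) B).mul_prod (hK.integrable_exp_one_add C')
  refine tendsto_integral_filter_of_dominated_convergence
    (fun q => B * Real.exp (C' * (1 + ‖q.2‖)))
    (Eventually.of_forall fun i => ((measurable_prodW (hms i) j).mul (hfs i)).aestronglyMeasurable)
    (Eventually.of_forall fun i => ?_) hi ?_
  · filter_upwards [ae_prod_of_ae_fst hYs, ae_prod_of_ae_fst hB] with q h1 h2
    rw [Real.norm_eq_abs, abs_mul, abs_of_pos (prodW_pos j _), mul_comm]
    exact mul_le_mul (h2 i q.2) (H _ (h1 i) q.2) (prodW_pos j _).le ((abs_nonneg _).trans (h2 i q.2))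
  · filter_upwards [ae_prod_of_ae_fst hYs, ae_prod_of_ae_fst hY, ae_prod_of_ae_fst hlim,
      ae_prod_of_ae_fst hf] with q h1 h2 h3 h4
    exact (hK.tendsto_prodW hC h1 h2 h3 j q.2).mul (h4 q.2)

lemma Regular.tendsto_integral_prodW_mul_avg (hK : K.Regular) (hC : 0 ≤ C)
    (hms : ∀ i, Measurable fun q : Ω × T × (Fin (k + 1) → E) => Ys i q.1 q.2.1 q.2.2)
    (hYs : ∀ᵐ ω ∂P, ∀ i, K.Nice C (Ys i ω)) (hY : ∀ᵐ ω ∂P, K.Nice C (Y ω))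
    (hlim : ∀ᵐ ω ∂P, K.ExpTendsto (fun i => Ys i ω) u (Y ω)) (j : ℕ) {l : ℕ} (hl : 1 ≤ l)
    {fs : ι → T → ℝ} {f : T → ℝ} (hfs : ∀ i, Measurable (fs i)) {B : ℝ}
    (hfsB : ∀ i σ, |fs i σ| ≤ B)
    (hfl : ∀ σ, Tendsto (fun i => fs i σ) u (𝓝 (f σ))) :
    Tendsto (fun i => ∫ q, K.prodW (Ys i q.1) j q.2 * K.avg (Ys i q.1) l (fs i) q.2
      ∂(P.prod K.law)) u
      (𝓝 (∫ q, K.prodW (Y q.1) j q.2 * K.avg (Y q.1) l f q.2 ∂(P.prod K.law))) := by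
  refine hK.tendsto_integral_prodW_mul hC hms hYs hY hlim j (B := B)
    (fs := fun i q => K.avg (Ys i q.1) l (fs i) q.2) (f := fun q => K.avg (Y q.1) l f q.2)
    (fun i => measurable_avg (u := fun _ => fs i) (hms i) l hl ((hfs i).comp measurable_snd)) ?_ ?_
  · filter_upwards [hYs] with ω h1 i z
    exact hK.abs_avg_le hC (h1 i) hl (hfsB i) z
  · filter_upwards [hYs, hY, hlim] with ω h1 h2 h3 z
    exact hK.tendsto_avg hC h1 h2 h3 hl hfs hfsB hfl z

lemma Regular.tendsto_integral_pairDensity (hK : K.Regular) (hC : 0 ≤ C)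
    (hms : ∀ i, Measurable fun q : Ω × T × (Fin (k + 1) → E) => Ys i q.1 q.2.1 q.2.2)
    (hYs : ∀ᵐ ω ∂P, ∀ i, K.Nice C (Ys i ω)) (hY : ∀ᵐ ω ∂P, K.Nice C (Y ω))
    (hlim : ∀ᵐ ω ∂P, K.ExpTendsto (fun i => Ys i ω) u (Y ω)) {j l : ℕ} (hj : 1 ≤ j) (hl : 1 ≤ l)
    {fs : ι → T → T → ℝ} {f : T → T → ℝ} (hfs : ∀ i, Measurable fun q : T × T => fs i q.1 q.2)
    {B : ℝ} (hfsB : ∀ i σ ρ, |fs i σ ρ| ≤ B)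
    (hfl : ∀ σ ρ, Tendsto (fun i => fs i σ ρ) u (𝓝 (f σ ρ))) :
    Tendsto (fun i => ∫ q, K.pairDensity (Ys i q.1) j l (fs i) q.2 ∂(P.prod K.law)) u
      (𝓝 (∫ q, K.pairDensity (Y q.1) j l f q.2 ∂(P.prod K.law))) := by
  refine hK.tendsto_integral_prodW_mul hC hms hYs hY hlim j (B := B)
    (fs := fun i q => K.avg (Ys i q.1) j (fun σ => K.avg (Ys i q.1) l (fs i σ) q.2) q.2)
    (f := fun q => K.avg (Y q.1) j (fun σ => K.avg (Y q.1) l (f σ) q.2) q.2)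
    (fun i => measurable_avg_avg (hms i) hj hl (hfs i)) ?_ ?_
  · filter_upwards [hYs] with ω h1 i z
    exact hK.abs_avg_avg_le hC (h1 i) hj hl (hfsB i) z
  · filter_upwards [hYs, hY, hlim] with ω h1 h2 h3 z
    exact hK.tendsto_avg_avg hC h1 h2 h3 hj hl hfs hfsB hfl z

end Averaged

end Cascade

end

/-! ### Approximation of a measurable process in `L²` by finitely many of its members. -/

section

section SectionsInL2

variable {T Ω : Type*} [MeasurableSpace T] [MeasurableSpace Ω] {P : Measure Ω}
  [IsProbabilityMeasure P]

lemma norm_toLp_two_sub {f g : Ω → ℝ} (hf : MemLp f 2 P) (hg : MemLp g 2 P) :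
    ‖hf.toLp f - hg.toLp g‖ = √(∫ ω, (f ω - g ω) ^ 2 ∂P) := by
  rw [← MemLp.toLp_sub, Lp.norm_toLp, (hf.sub hg).eLpNorm_eq_integral_rpow_norm (by norm_num)
    (by norm_num), ENNReal.toReal_ofReal (by positivity), Real.sqrt_eq_rpow]
  simp

lemma tendsto_integral_sq_of_dominated {f : ℕ → Ω → ℝ} {g : Ω → ℝ} {B : Ω → ℝ}
    (hf : ∀ n, AEStronglyMeasurable (f n) P) (hg : AEStronglyMeasurable g P) (hB : MemLp B 2 P)
    (hfB : ∀ n ω, |f n ω| ≤ B ω)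
    (hl : ∀ ω, Tendsto (fun n => f n ω) atTop (𝓝 (g ω))) :
    Tendsto (fun n => ∫ ω, (f n ω - g ω) ^ 2 ∂P) atTop (𝓝 0) := by
  have hgB : ∀ ω, |g ω| ≤ B ω := fun ω => le_of_tendsto (hl ω).abs
    (Eventually.of_forall fun n => hfB n ω)
  have : Tendsto (fun n => ∫ ω, (f n ω - g ω) ^ 2 ∂P) atTop (𝓝 (∫ _, (0 : ℝ) ∂P)) := by
    refine tendsto_integral_of_dominated_convergence (fun ω => 4 * B ω ^ 2)
      (fun n => ((hf n).sub hg).pow 2) (hB.integrable_sq.const_mul 4)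
      (fun n => ae_of_all _ fun ω => ?_) (ae_of_all _ fun ω => ?_)
    · have h1 := (abs_sub (f n ω) (g ω)).trans (add_le_add (hfB n ω) (hgB ω))
      rw [Real.norm_eq_abs, abs_of_nonneg (sq_nonneg _), ← sq_abs]
      nlinarith [abs_nonneg (f n ω - g ω)]
    · have := ((hl ω).sub_const (g ω)).pow 2
      simpa using this
  simpa using this

/-- The map sending a point to the section at that point, as an element of `L²`, is strongly
measurable. -/
def MeasurableSections (P : Measure Ω) (f : T → Ω → ℝ) : Prop :=
  ∀ h : ∀ σ, MemLp (f σ) 2 P, StronglyMeasurable fun σ => (h σ).toLp (f σ)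

lemma MeasurableSections.add {f g : T → Ω → ℝ} (hf : MeasurableSections P f)
    (hg : MeasurableSections P g) (hf2 : ∀ σ, MemLp (f σ) 2 P) (hg2 : ∀ σ, MemLp (g σ) 2 P) :
    MeasurableSections P fun σ ω => f σ ω + g σ ω :=
  fun _ => (hf hf2).add (hg hg2)

lemma MeasurableSections.const_mul {f : T → Ω → ℝ} (hf : MeasurableSections P f)
    (hf2 : ∀ σ, MemLp (f σ) 2 P) (c : ℝ) : MeasurableSections P fun σ ω => c * f σ ω :=
  fun _ => (hf hf2).const_smul c

/-- Pointwise limits of strongly measurable maps are strongly measurable, and the assumed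
convergence is convergence in `L²` at each point. -/
lemma MeasurableSections.of_tendsto {f : ℕ → T → Ω → ℝ} {g : T → Ω → ℝ}
    (hf : ∀ n, MeasurableSections P (f n)) (hf2 : ∀ n σ, MemLp (f n σ) 2 P)
    (hl : (∀ σ, MemLp (g σ) 2 P) →
      ∀ σ, Tendsto (fun n => ∫ ω, (f n σ ω - g σ ω) ^ 2 ∂P) atTop (𝓝 0)) :
    MeasurableSections P g := by
  intro hg2
  refine stronglyMeasurable_of_tendsto atTop (fun n => hf n (hf2 n)) ?_
  rw [tendsto_pi_nhds]
  intro σ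
  rw [tendsto_iff_norm_sub_tendsto_zero]
  simp only [norm_toLp_two_sub]
  simpa using (hl hg2 σ).sqrt

lemma toLp_eq_zero {f : Ω → ℝ} (hf : MemLp f 2 P) (h : ∀ ω, f ω = 0) : hf.toLp f = 0 :=
  (MemLp.toLp_congr hf MemLp.zero (ae_of_all _ h)).trans (MemLp.toLp_zero _)

lemma memLp_indicator_section (S : Set (T × Ω)) (hS : MeasurableSet S) (σ : T) :
    MemLp (fun ω => S.indicator (fun _ => (1 : ℝ)) (σ, ω)) 2 P := by
  refine MemLp.of_bound ((measurable_const.indicator hS).comp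
    measurable_prodMk_left).aestronglyMeasurable 1 (ae_of_all _ fun ω => ?_)
  rw [Real.norm_eq_abs]
  by_cases h : (σ, ω) ∈ S <;> simp [h]

/-- A Dynkin argument from rectangles, whose sections take only two values in `L²`. Complements use
linearity, and disjoint unions use `L²` limits of partial sums. -/
lemma measurableSections_indicator (S : Set (T × Ω)) (hS : MeasurableSet S) :
    MeasurableSections P fun σ ω => S.indicator (fun _ => (1 : ℝ)) (σ, ω) := by
  induction S, hS using MeasurableSpace.induction_on_inter (s := image2 (· ×ˢ ·)
    {s : Set T | MeasurableSet s} {t : Set Ω | MeasurableSet t}) with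
  | h_eq => exact generateFrom_prod.symm
  | h_inter => exact isPiSystem_prod
  | empty =>
    intro h
    have : (fun σ => (h σ).toLp _) = fun _ : T => (0 : Lp ℝ 2 P) := by
      ext1 σ
      exact toLp_eq_zero _ fun ω => by simp
    rw [this]
    exact stronglyMeasurable_const
  | basic S hS =>
    obtain ⟨A, hA, B, hB, rfl⟩ := hS
    intro h
    have hBm : MemLp (B.indicator fun _ => (1 : ℝ)) 2 P :=
      memLp_indicator_const 2 hB 1 (Or.inr (measure_ne_top _ _))
    have : (fun σ => (h σ).toLp _) = A.indicator fun _ : T => hBm.toLp _ := by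
      ext1 σ
      by_cases hσ : σ ∈ A
      · rw [indicator_of_mem hσ]
        refine MemLp.toLp_congr _ _ (ae_of_all _ fun ω => ?_)
        by_cases hω : ω ∈ B <;> simp [hσ, hω]
      · rw [indicator_of_notMem hσ]
        exact toLp_eq_zero _ fun ω => by simp [hσ]
    rw [this]
    exact stronglyMeasurable_const.indicator hA
  | compl S hS ih =>
    have h1 : MeasurableSections P fun (_ : T) (_ : Ω) => (1 : ℝ) :=
      fun h => (stronglyMeasurable_const :
        StronglyMeasurable fun _ : T => (memLp_const (1 : ℝ) : MemLp _ 2 P).toLp fun _ : Ω => (1 : ℝ))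
    have := h1.add (ih.const_mul (memLp_indicator_section S hS) (-1)) (fun _ => memLp_const 1)
      (fun σ => (memLp_indicator_section S hS σ).const_mul (-1))
    convert this using 3 with σ ω
    by_cases hω : (σ, ω) ∈ S <;> simp [hω]
  | iUnion S hd hS ih =>
    refine MeasurableSections.of_tendsto (f := fun n σ ω => ∑ i ∈ Finset.range n,
      (S i).indicator (fun _ => (1 : ℝ)) (σ, ω)) ?_ ?_ ?_
    · intro n
      induction n with
      | zero => exact fun _ => by simpa using stronglyMeasurable_const
      | succ n ihn =>
        simp only [Finset.sum_range_succ]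
        exact ihn.add (ih n)
          (fun σ => memLp_finsetSum _ fun i _ => memLp_indicator_section (S i) (hS i) σ)
          (memLp_indicator_section (S n) (hS n))
    · exact fun n σ => memLp_finsetSum _ fun i _ => memLp_indicator_section (S i) (hS i) σ
    · intro hg σ
      have e : ∀ ω n, ∑ i ∈ Finset.range n, (S i).indicator (fun _ => (1 : ℝ)) (σ, ω) =
          (⋃ i ∈ Finset.range n, S i).indicator (fun _ => (1 : ℝ)) (σ, ω) := fun ω n =>
        (Finset.indicator_biUnion_apply (Finset.range n) S (fun i _ j _ hij => hd hij) _).symm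
      refine tendsto_integral_sq_of_dominated (B := fun _ => 1)
        (fun n => (memLp_finsetSum _ fun i _ => memLp_indicator_section (S i) (hS i) σ).1)
        (hg σ).1 (memLp_const 1) (fun n ω => ?_) (fun ω => ?_)
      · rw [e, abs_of_nonneg (indicator_nonneg (fun _ _ => zero_le_one) _)]
        exact indicator_le_self' (fun _ _ => zero_le_one) _
      · simp only [e]
        by_cases hω : (σ, ω) ∈ ⋃ i, S i
        · obtain ⟨i, hi⟩ := mem_iUnion.1 hω
          rw [indicator_of_mem hω]
          refine tendsto_const_nhds.congr' ?_
          filter_upwards [eventually_gt_atTop i] with n hn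
          rw [indicator_of_mem]
          exact mem_biUnion (Finset.mem_coe.2 (Finset.mem_range.2 hn)) hi
        · rw [indicator_of_notMem hω]
          refine tendsto_const_nhds.congr fun n => ?_
          rw [indicator_of_notMem]
          intro h
          obtain ⟨i, -, hi⟩ := mem_iUnion₂.1 h
          exact hω (mem_iUnion.2 ⟨i, hi⟩)

lemma memLp_simpleFunc_section (s : SimpleFunc (T × Ω) ℝ) (σ : T) :
    MemLp (fun ω => s (σ, ω)) 2 P := by
  obtain ⟨C, hC⟩ := s.exists_forall_norm_le
  exact MemLp.of_bound (s.measurable.comp measurable_prodMk_left).aestronglyMeasurable C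
    (ae_of_all _ fun ω => hC _)

lemma measurableSections_simpleFunc (s : SimpleFunc (T × Ω) ℝ) :
    MeasurableSections P fun σ ω => s (σ, ω) := by
  induction s using SimpleFunc.induction with
  | const c hS =>
    rename_i S
    have := (measurableSections_indicator (P := P) S hS).const_mul (memLp_indicator_section S hS) c
    convert this using 3 with σ ω
    by_cases h : (σ, ω) ∈ S <;> simp [SimpleFunc.coe_piecewise, h]
  | add _ hf hg =>
    exact hf.add hg (memLp_simpleFunc_section _) (memLp_simpleFunc_section _)

/-- Approximation by simple functions on the product, dominated on each section by `2 |f σ|`, which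
is square integrable. -/
lemma measurableSections_of_measurable {f : T → Ω → ℝ}
    (hf : Measurable fun q : T × Ω => f q.1 q.2) : MeasurableSections P f := by
  refine MeasurableSections.of_tendsto
    (f := fun n σ ω => SimpleFunc.approxOn (fun q : T × Ω => f q.1 q.2) hf univ 0 (mem_univ _) n (σ, ω))
    (fun n => measurableSections_simpleFunc _) (fun n => memLp_simpleFunc_section _) fun h2 σ => ?_
  refine tendsto_integral_sq_of_dominated (B := fun ω => ‖f σ ω‖ + ‖f σ ω‖)
    (fun n => (memLp_simpleFunc_section _ σ).1) (h2 σ).1 ((h2 σ).norm.add (h2 σ).norm)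
    (fun n ω => ?_) (fun ω => ?_)
  · exact SimpleFunc.norm_approxOn_zero_le hf (mem_univ _) (σ, ω) n
  · exact SimpleFunc.tendsto_approxOn hf (mem_univ _) (by simp)

/-- A jointly measurable square integrable family can be approximated in `L²` by its members in a
simple way. -/
theorem exists_simpleFunc_tendsto_integral_sq [Nonempty T] {f : T → Ω → ℝ}
    (hf : Measurable fun q : T × Ω => f q.1 q.2) (h2 : ∀ σ, MemLp (f σ) 2 P) :
    ∃ r : ℕ → SimpleFunc T T, ∀ σ,
      Tendsto (fun n => ∫ ω, (f (r n σ) ω - f σ ω) ^ 2 ∂P) atTop (𝓝 0) := by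
  have hs := measurableSections_of_measurable (P := P) hf h2
  set Φ : T → Lp ℝ 2 P := fun σ => (h2 σ).toLp (f σ) with hΦ
  let _ : MeasurableSpace (Lp ℝ 2 P) := borel _
  have : BorelSpace (Lp ℝ 2 P) := ⟨rfl⟩
  have : TopologicalSpace.SeparableSpace (range Φ) := hs.isSeparable_range.separableSpace
  set σ₀ := Classical.arbitrary T
  have h0 : Φ σ₀ ∈ range Φ := mem_range_self _
  set a := SimpleFunc.approxOn Φ hs.measurable (range Φ) (Φ σ₀) h0
  -- The approximants take their finitely many values in the range of `Φ`, so a preimage can be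
  -- chosen for each value. Composing a simple function with an arbitrary map keeps it simple, hence
  -- the choice need not be measurable.
  refine ⟨fun n => (a n).map (Function.invFun Φ), fun σ => ?_⟩
  have ha : ∀ n, Φ ((a n).map (Function.invFun Φ) σ) = a n σ := fun n =>
    Function.invFun_eq (SimpleFunc.approxOn_mem hs.measurable h0 n σ)
  have hl : Tendsto (fun n => a n σ) atTop (𝓝 (Φ σ)) :=
    SimpleFunc.tendsto_approxOn hs.measurable h0 (subset_closure (mem_range_self σ))
  rw [tendsto_iff_norm_sub_tendsto_zero] at hl
  have e : ∀ n, ‖a n σ - Φ σ‖ ^ 2 =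
      ∫ ω, (f ((a n).map (Function.invFun Φ) σ) ω - f σ ω) ^ 2 ∂P := fun n => by
    rw [← ha n, norm_toLp_two_sub, Real.sq_sqrt (integral_nonneg fun _ => sq_nonneg _)]
  have h3 := hl.pow 2
  simp only [e] at h3
  simpa using h3

end SectionsInL2

end

/-! ### Exponential moments of Gaussian processes with bounded variance. -/

section

lemma integral_mul_le_sqrt_mul_sqrt {α : Type*} [MeasurableSpace α] {μ : Measure α} {f g : α → ℝ}
    (hf : MemLp f 2 μ) (hg : MemLp g 2 μ) (hf0 : ∀ x, 0 ≤ f x) (hg0 : ∀ x, 0 ≤ g x) :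
    ∫ x, f x * g x ∂μ ≤ √(∫ x, f x ^ 2 ∂μ) * √(∫ x, g x ^ 2 ∂μ) := by
  have e : ENNReal.ofReal 2 = 2 := by simp
  have := integral_mul_le_Lp_mul_Lq_of_nonneg (μ := μ) (Real.HolderConjugate.two_two)
    (ae_of_all _ hf0) (ae_of_all _ hg0) (by rwa [e]) (by rwa [e])
  simpa [Real.sqrt_eq_rpow] using this

/-- A measure of the distance between two exponents. -/
def expDist {T : Type*} [MeasurableSpace T] (ν : Measure T) (f g : T → ℝ) : ℝ :=
  ∫ σ, |f σ - g σ| * (2 + Real.exp (f σ) + Real.exp (g σ)) ∂ν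

/-- A jointly measurable centered Gaussian process with bounded variance. -/
structure BoundedGaussian {T Ω : Type*} [MeasurableSpace T] [MeasurableSpace Ω] (P : Measure Ω)
    (G : T → Ω → ℝ) (V : ℝ) : Prop where
  process : IsGaussianProcess G P
  meas : Measurable fun q : T × Ω => G q.1 q.2
  mean : ∀ σ, ∫ ω, G σ ω ∂P = 0
  var_le : ∀ σ, ∫ ω, G σ ω ^ 2 ∂P ≤ V

namespace BoundedGaussian

variable {T Ω : Type*} [MeasurableSpace T] [MeasurableSpace Ω] {P : Measure Ω}
  [IsProbabilityMeasure P] {G : T → Ω → ℝ} {V : ℝ}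

lemma memLp_two (h : BoundedGaussian P G V) (σ : T) : MemLp (G σ) 2 P :=
  (h.process.hasGaussianLaw_eval σ).memLp_two

lemma measurable_eval (h : BoundedGaussian P G V) (σ : T) : Measurable (G σ) :=
  h.meas.comp measurable_prodMk_left

lemma integrable_exp (h : BoundedGaussian P G V) (σ : T) (c : ℝ) :
    Integrable (fun ω => Real.exp (c * G σ ω)) P := by
  have hl := (h.process.hasGaussianLaw_eval σ).map_eq_gaussianReal
  have hi := integrable_exp_mul_gaussianReal (μ := P[G σ]) (v := (Var[G σ; P]).toNNReal) c
  rw [← hl, integrable_map_measure (by fun_prop) (h.measurable_eval σ).aemeasurable] at hi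
  exact hi

lemma integral_exp_le (h : BoundedGaussian P G V) (σ : T) (c : ℝ) :
    ∫ ω, Real.exp (c * G σ ω) ∂P ≤ Real.exp (c ^ 2 * V / 2) := by
  have hl := (h.process.hasGaussianLaw_eval σ).map_eq_gaussianReal
  have := mgf_gaussianReal hl c
  rw [mgf] at this
  rw [this]
  refine Real.exp_le_exp.2 ?_
  rw [h.mean, zero_mul, zero_add, Real.coe_toNNReal _ (variance_nonneg _ _),
    variance_of_integral_eq_zero (h.measurable_eval σ).aemeasurable (h.mean σ), mul_comm]
  have := mul_le_mul_of_nonneg_left (h.var_le σ) (sq_nonneg c)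
  linarith

lemma memLp_exp (h : BoundedGaussian P G V) (σ : T) : MemLp (fun ω => Real.exp (G σ ω)) 2 P := by
  have hm : Measurable fun ω => Real.exp (G σ ω) := Real.measurable_exp.comp (h.measurable_eval σ)
  rw [memLp_two_iff_integrable_sq hm.aestronglyMeasurable]
  simp only [← Real.exp_nat_mul]
  exact_mod_cast h.integrable_exp σ 2

lemma integral_sq_sub_le (h : BoundedGaussian P G V) (σ ρ : T) :
    ∫ ω, (G σ ω - G ρ ω) ^ 2 ∂P ≤ 4 * V := by
  have i1 := (h.memLp_two σ).integrable_sq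
  have i2 := (h.memLp_two ρ).integrable_sq
  calc ∫ ω, (G σ ω - G ρ ω) ^ 2 ∂P ≤ ∫ ω, (2 * G σ ω ^ 2 + 2 * G ρ ω ^ 2) ∂P := by
        refine integral_mono ((h.memLp_two σ).sub (h.memLp_two ρ)).integrable_sq
          ((i1.const_mul 2).add (i2.const_mul 2)) fun ω => ?_
        change (G σ ω - G ρ ω) ^ 2 ≤ 2 * G σ ω ^ 2 + 2 * G ρ ω ^ 2
        nlinarith [sq_nonneg (G σ ω + G ρ ω)]
    _ ≤ 4 * V := by
        rw [integral_add (i1.const_mul 2) (i2.const_mul 2), integral_const_mul, integral_const_mul]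
        linarith [h.var_le σ, h.var_le ρ]

lemma memLp_weight (h : BoundedGaussian P G V) (σ ρ : T) :
    MemLp (fun ω => 2 + Real.exp (G σ ω) + Real.exp (G ρ ω)) 2 P :=
  have h1 : MemLp (fun _ : Ω => (2 : ℝ)) 2 P := memLp_const 2
  have h2 : MemLp (fun ω => 2 + Real.exp (G σ ω)) 2 P := h1.add (h.memLp_exp σ)
  h2.add (h.memLp_exp ρ)

/-- The square of a sum of three terms is at most three times the sum of the squares, and each
squared exponential has expectation at most `exp (2 V)`. -/
lemma integral_weight_sq_le (h : BoundedGaussian P G V) (σ ρ : T) :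
    ∫ ω, (2 + Real.exp (G σ ω) + Real.exp (G ρ ω)) ^ 2 ∂P ≤ 12 + 6 * Real.exp (2 * V) := by
  have i1 := h.integrable_exp σ 2
  have i2 := h.integrable_exp ρ 2
  have e : ∀ x : ℝ, Real.exp (2 * x) = Real.exp x ^ 2 := fun x => by
    rw [← Real.exp_nat_mul]; norm_num
  have hV : (2 : ℝ) ^ 2 * V / 2 = 2 * V := by ring
  have h1 := h.integral_exp_le σ 2
  have h2 := h.integral_exp_le ρ 2
  rw [hV] at h1 h2
  have i3 : Integrable (fun ω => 12 + 3 * Real.exp (2 * G σ ω) + 3 * Real.exp (2 * G ρ ω)) P :=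
    ((integrable_const 12).add (i1.const_mul 3)).add (i2.const_mul 3)
  calc _ ≤ ∫ ω, (12 + 3 * Real.exp (2 * G σ ω) + 3 * Real.exp (2 * G ρ ω)) ∂P := by
        refine integral_mono (h.memLp_weight σ ρ).integrable_sq i3 fun ω => ?_
        simp only [e]
        nlinarith [sq_nonneg (2 - Real.exp (G σ ω)), sq_nonneg (2 - Real.exp (G ρ ω)),
          sq_nonneg (Real.exp (G σ ω) - Real.exp (G ρ ω))]
    _ ≤ _ := by
        have i4 : Integrable (fun ω => 12 + 3 * Real.exp (2 * G σ ω)) P :=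
          (integrable_const 12).add (i1.const_mul 3)
        rw [integral_add i4 (i2.const_mul 3), integral_add (integrable_const _) (i1.const_mul 3),
          integral_const_mul, integral_const_mul]
        simp only [integral_const, probReal_univ, smul_eq_mul, one_mul]
        linarith

lemma integrable_abs_sub_mul (h : BoundedGaussian P G V) (σ ρ : T) :
    Integrable (fun ω => |G σ ω - G ρ ω| * (2 + Real.exp (G σ ω) + Real.exp (G ρ ω))) P :=
  (((h.memLp_two σ).sub (h.memLp_two ρ)).norm.integrable_mul (h.memLp_weight σ ρ))

lemma integral_abs_sub_mul_le (h : BoundedGaussian P G V) (σ ρ : T) :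
    ∫ ω, |G σ ω - G ρ ω| * (2 + Real.exp (G σ ω) + Real.exp (G ρ ω)) ∂P ≤
      √(∫ ω, (G σ ω - G ρ ω) ^ 2 ∂P) * √(12 + 6 * Real.exp (2 * V)) := by
  have := integral_mul_le_sqrt_mul_sqrt ((h.memLp_two σ).sub (h.memLp_two ρ)).norm
    (h.memLp_weight σ ρ) (fun _ => norm_nonneg _) (fun _ => by positivity)
  simp only [Pi.sub_apply, Real.norm_eq_abs, sq_abs] at this
  exact this.trans (mul_le_mul_of_nonneg_left (Real.sqrt_le_sqrt (h.integral_weight_sq_le σ ρ))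
    (Real.sqrt_nonneg _))

variable {ν : Measure T} [IsFiniteMeasure ν]

/-- By Tonelli, first moments bounded uniformly over the configurations suffice, because `ν` is
finite. -/
lemma integrable_prod_of_bound {f : T → Ω → ℝ} (hf : Measurable fun q : T × Ω => f q.1 q.2)
    (hi : ∀ σ, Integrable (f σ) P) {B : ℝ} (hB : ∀ σ, ∫ ω, |f σ ω| ∂P ≤ B) :
    Integrable (fun q : Ω × T => f q.2 q.1) (P.prod ν) := by
  have hm : Measurable fun q : Ω × T => f q.2 q.1 := hf.comp measurable_swap
  rw [integrable_prod_iff' hm.aestronglyMeasurable]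
  refine ⟨ae_of_all _ hi, Integrable.of_bound ?_ B (ae_of_all _ fun σ => ?_)⟩
  · exact (Cascade.measurable_integral_snd (f := fun σ ω => ‖f σ ω‖)
      hf.norm).aestronglyMeasurable
  · rw [Real.norm_eq_abs, abs_of_nonneg (integral_nonneg fun _ => norm_nonneg _)]
    exact hB σ

lemma integrable_prod_exp (h : BoundedGaussian P G V) :
    Integrable (fun q : Ω × T => Real.exp (G q.2 q.1)) (P.prod ν) := by
  refine integrable_prod_of_bound (f := fun σ ω => Real.exp (G σ ω)) (B := Real.exp (V / 2))
    (Real.measurable_exp.comp h.meas) (fun σ => by simpa using h.integrable_exp σ 1) fun σ => ?_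
  simpa using h.integral_exp_le σ 1

lemma integrable_prod_abs (h : BoundedGaussian P G V) :
    Integrable (fun q : Ω × T => |G q.2 q.1|) (P.prod ν) := by
  refine integrable_prod_of_bound (f := fun σ ω => |G σ ω|) (B := (1 + V) / 2)
    (measurable_abs.comp h.meas) (fun σ => ((h.memLp_two σ).integrable (by norm_num)).abs)
    fun σ => ?_
  have i2 := (h.memLp_two σ).integrable_sq
  simp only [abs_abs]
  calc ∫ ω, |G σ ω| ∂P ≤ ∫ ω, (1 + G σ ω ^ 2) / 2 ∂P := by
        refine integral_mono ((h.memLp_two σ).integrable (by norm_num)).abs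
          (((integrable_const 1).add i2).div_const 2) fun ω => ?_
        change |G σ ω| ≤ (1 + G σ ω ^ 2) / 2
        nlinarith [sq_nonneg (|G σ ω| - 1), sq_abs (G σ ω)]
    _ ≤ _ := by
        rw [integral_div, integral_add (integrable_const _) i2]
        simp only [integral_const, probReal_univ, smul_eq_mul, one_mul]
        linarith [h.var_le σ]

lemma measurable_expDist_integrand (h : BoundedGaussian P G V) {r : T → T} (hr : Measurable r) :
    Measurable fun q : T × Ω => |G (r q.1) q.2 - G q.1 q.2| *
      (2 + Real.exp (G (r q.1) q.2) + Real.exp (G q.1 q.2)) := by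
  have h1 : Measurable fun q : T × Ω => G (r q.1) q.2 :=
    h.meas.comp ((hr.comp measurable_fst).prodMk measurable_snd)
  exact (measurable_abs.comp (h1.sub h.meas)).mul
    ((measurable_const.add (Real.measurable_exp.comp h1)).add (Real.measurable_exp.comp h.meas))

lemma integrable_prod_expDist [Nonempty T] (h : BoundedGaussian P G V) {r : T → T}
    (hr : Measurable r) :
    Integrable (fun q : Ω × T => |G (r q.2) q.1 - G q.2 q.1| *
      (2 + Real.exp (G (r q.2) q.1) + Real.exp (G q.2 q.1))) (P.prod ν) := by
  refine integrable_prod_of_bound (B := √(4 * V) * √(12 + 6 * Real.exp (2 * V)))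
    (h.measurable_expDist_integrand hr) (fun σ => h.integrable_abs_sub_mul (r σ) σ) fun σ => ?_
  have e : ∀ ω, |(|G (r σ) ω - G σ ω| * (2 + Real.exp (G (r σ) ω) + Real.exp (G σ ω)))| =
      |G (r σ) ω - G σ ω| * (2 + Real.exp (G (r σ) ω) + Real.exp (G σ ω)) :=
    fun ω => abs_of_nonneg (by positivity)
  simp only [e]
  exact (h.integral_abs_sub_mul_le _ _).trans (mul_le_mul_of_nonneg_right
    (Real.sqrt_le_sqrt (h.integral_sq_sub_le _ _)) (Real.sqrt_nonneg _))

/-- After Fubini, Cauchy–Schwarz bounds the inner expectation by the `L²` distance times a constant.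
It therefore tends to `0` for each configuration, dominated by a constant. -/
lemma tendsto_integral_expDist [Nonempty T] (h : BoundedGaussian P G V) {r : ℕ → T → T}
    (hr : ∀ j, Measurable (r j))
    (hlim : ∀ σ, Tendsto (fun j => ∫ ω, (G (r j σ) ω - G σ ω) ^ 2 ∂P) atTop (𝓝 0)) :
    Tendsto (fun j => ∫ ω, expDist ν (fun σ => G (r j σ) ω) (fun σ => G σ ω) ∂P) atTop (𝓝 0) := by
  have e : ∀ j, ∫ ω, expDist ν (fun σ => G (r j σ) ω) (fun σ => G σ ω) ∂P =
      ∫ σ, ∫ ω, |G (r j σ) ω - G σ ω| * (2 + Real.exp (G (r j σ) ω) + Real.exp (G σ ω)) ∂P ∂ν :=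
    fun j => integral_integral_swap (h.integrable_prod_expDist (hr j))
  simp only [e]
  have : Tendsto (fun j => ∫ σ, ∫ ω, |G (r j σ) ω - G σ ω| *
      (2 + Real.exp (G (r j σ) ω) + Real.exp (G σ ω)) ∂P ∂ν) atTop (𝓝 (∫ _, (0 : ℝ) ∂ν)) := by
    refine tendsto_integral_of_dominated_convergence
      (fun _ => √(4 * V) * √(12 + 6 * Real.exp (2 * V)))
      (fun j => (Cascade.measurable_integral_snd
        (h.measurable_expDist_integrand (hr j))).aestronglyMeasurable)
      (integrable_const _) (fun j => ae_of_all _ fun σ => ?_) (ae_of_all _ fun σ => ?_)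
    · rw [Real.norm_eq_abs, abs_of_nonneg (integral_nonneg fun _ => by positivity)]
      exact (h.integral_abs_sub_mul_le _ _).trans (mul_le_mul_of_nonneg_right
        (Real.sqrt_le_sqrt (h.integral_sq_sub_le _ _)) (Real.sqrt_nonneg _))
    · refine squeeze_zero (fun j => integral_nonneg fun _ => by positivity)
        (fun j => h.integral_abs_sub_mul_le _ _) ?_
      simpa using (hlim σ).sqrt.mul_const (√(12 + 6 * Real.exp (2 * V)))
  simpa using this

end BoundedGaussian

/-- Along a subsequence with integrals below `2⁻ⁿ` the sum of the series is integrable. It dominates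
every term, and its finiteness almost everywhere forces the terms to `0`. -/
lemma exists_dominated_of_tendsto_integral {Ω : Type*} [MeasurableSpace Ω] {P : Measure Ω}
    {δ : ℕ → Ω → ℝ} (h0 : ∀ j ω, 0 ≤ δ j ω) (hi : ∀ j, Integrable (δ j) P)
    (hlim : Tendsto (fun j => ∫ ω, δ j ω ∂P) atTop (𝓝 0)) :
    ∃ (φ : ℕ → ℕ) (D : Ω → ℝ), StrictMono φ ∧ Integrable D P ∧
      ∀ᵐ ω ∂P, (∀ j, δ (φ j) ω ≤ D ω) ∧ Tendsto (fun j => δ (φ j) ω) atTop (𝓝 0) := by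
  obtain ⟨φ, hφ, hlt⟩ := extraction_forall_of_eventually
    (P := fun n j => ∫ ω, δ j ω ∂P < (1 / 2) ^ n)
    fun n => hlim.eventually (gt_mem_nhds (by positivity))
  have hm : ∀ j, AEMeasurable (fun ω => ENNReal.ofReal (δ (φ j) ω)) P :=
    fun j => (hi (φ j)).1.aemeasurable.ennreal_ofReal
  have hne : ∫⁻ ω, ∑' j, ENNReal.ofReal (δ (φ j) ω) ∂P ≠ ∞ := by
    rw [lintegral_tsum hm]
    refine ne_top_of_le_ne_top (b := ∑' j : ℕ, ENNReal.ofReal ((1 / 2) ^ j)) ?_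
      (ENNReal.tsum_le_tsum fun j => ?_)
    · rw [← ENNReal.ofReal_tsum_of_nonneg (fun _ => by positivity) summable_geometric_two]
      exact ENNReal.ofReal_ne_top
    · rw [← ofReal_integral_eq_lintegral_ofReal (hi (φ j)) (ae_of_all _ (h0 (φ j)))]
      exact ENNReal.ofReal_le_ofReal (hlt j).le
  have hme : AEMeasurable (fun ω => ∑' j, ENNReal.ofReal (δ (φ j) ω)) P := AEMeasurable.tsum hm
  refine ⟨φ, fun ω => (∑' j, ENNReal.ofReal (δ (φ j) ω)).toReal, hφ,
    integrable_toReal_of_lintegral_ne_top hme hne, ?_⟩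
  filter_upwards [ae_lt_top' hme hne] with ω hω
  have e : ∀ j, (ENNReal.ofReal (δ (φ j) ω)).toReal = δ (φ j) ω := fun j =>
    ENNReal.toReal_ofReal (h0 _ _)
  constructor
  · intro j
    rw [← e j]
    exact ENNReal.toReal_mono hω.ne (ENNReal.le_tsum j)
  · have := (ENNReal.tendsto_toReal ENNReal.zero_ne_top).comp
      (ENNReal.tendsto_atTop_zero_of_tsum_ne_top hω.ne)
    simpa [Function.comp_def, e] using this

end

/-! ### Continuity of the Gibbs weights in the process and in time, and transport of the disorder.
-/

section

lemma abs_exp_sub_exp_le (x y : ℝ) : |Real.exp x - Real.exp y| ≤ |x - y| * (Real.exp x + Real.exp y) := by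
  have key : ∀ x y : ℝ, Real.exp x - Real.exp y ≤ |x - y| * (Real.exp x + Real.exp y) := by
    intro x y
    have h1 := Real.add_one_le_exp (y - x)
    have h2 : Real.exp y = Real.exp x * Real.exp (y - x) := by rw [← Real.exp_add]; ring_nf
    have h3 : Real.exp x * (y - x + 1) ≤ Real.exp y := by
      rw [h2]; exact mul_le_mul_of_nonneg_left h1 (Real.exp_pos x).le
    nlinarith [mul_le_mul_of_nonneg_right (le_abs_self (x - y)) (Real.exp_pos x).le,
      mul_nonneg (abs_nonneg (x - y)) (Real.exp_pos y).le]
  rw [abs_le]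
  constructor
  · have := key y x
    rw [abs_sub_comm] at this
    linarith
  · exact key x y

lemma exp_sqrt_mul_le {t : ℝ} (ht : t ∈ Icc (0 : ℝ) 1) (x : ℝ) :
    Real.exp (√t * x) ≤ 1 + Real.exp x := by
  have h0 := Real.sqrt_nonneg t
  have h1 : √t ≤ 1 := Real.sqrt_le_one.2 ht.2
  rcases le_total 0 x with hx | hx
  · exact (Real.exp_le_exp.2 (mul_le_of_le_one_left hx h1)).trans (by linarith)
  · exact (Real.exp_le_one_iff.2 (mul_nonpos_of_nonneg_of_nonpos h0 hx)).trans
      (by linarith [Real.exp_pos x])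

/-- The factor `2 + exp x + exp y` bounds the exponentials of the scaled exponents for every `t` at
once. A single distance, and so a single subsequence, then serves the whole interval. -/
lemma abs_exp_sqrt_sub_le {t : ℝ} (ht : t ∈ Icc (0 : ℝ) 1) (x y : ℝ) :
    |Real.exp (√t * x) - Real.exp (√t * y)| ≤ |x - y| * (2 + Real.exp x + Real.exp y) := by
  refine (abs_exp_sub_exp_le _ _).trans (mul_le_mul ?_ ?_ (by positivity) (abs_nonneg _))
  · rw [← mul_sub, abs_mul, abs_of_nonneg (Real.sqrt_nonneg t)]
    exact mul_le_of_le_one_left (abs_nonneg _) (Real.sqrt_le_one.2 ht.2)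
  · linarith [exp_sqrt_mul_le ht x, exp_sqrt_mul_le ht y]

namespace Cascade

variable {k : ℕ} {E T ι : Type*} [NormedAddCommGroup E] [NormedSpace ℝ E] [MeasurableSpace E]
  [BorelSpace E] [SecondCountableTopology E] [CompleteSpace E] [MeasurableSpace T]
  {K : Cascade k E T} {b : T → ℝ} {L : T → StrongDual ℝ E} {M : ℝ}
  [∀ p, IsGaussian (K.γ p)] [NeZero K.ν] [IsFiniteMeasure K.ν]

lemma integrable_exp_sqrt_mul {ν : Measure T} [IsFiniteMeasure ν] {f : T → ℝ} (hf : Measurable f)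
    (hi : Integrable (fun σ => Real.exp (f σ)) ν) {t : ℝ} (ht : t ∈ Icc (0 : ℝ) 1) :
    Integrable (fun σ => Real.exp (√t * f σ)) ν := by
  refine ((integrable_const 1).add hi).mono'
    (Real.measurable_exp.comp (hf.const_mul _)).aestronglyMeasurable (ae_of_all _ fun σ => ?_)
  rw [Real.norm_eq_abs, Real.abs_exp]
  exact exp_sqrt_mul_le ht _

lemma Admissible.nice_of_integrable_exp (h : K.Admissible b L M) {f : T → ℝ} (hf : Measurable f)
    (hi : Integrable (fun σ => Real.exp (f σ)) K.ν) {t : ℝ} (ht : t ∈ Icc (0 : ℝ) 1) :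
    K.Nice ((k + 1) * M) (pathHam b L f t) :=
  h.nice hf ht.1 (integrable_exp_sqrt_mul hf hi ht)

lemma pathHam_eq (f : T → ℝ) (t : ℝ) (σ : T) (z : Fin (k + 1) → E) :
    pathHam b L f t σ z = √t * f σ + (b σ + √(1 - t) * fieldForm L (k + 1) σ z) :=
  add_assoc _ _ _

lemma Admissible.pathHam_rest_le (h : K.Admissible b L M) {t : ℝ} (ht : 0 ≤ t) (σ : T)
    (z : Fin (k + 1) → E) :
    |b σ + √(1 - t) * fieldForm L (k + 1) σ z| ≤ M + (k + 1) * M * ‖z‖ := by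
  refine (abs_add_le _ _).trans (add_le_add (h.b_le σ) ?_)
  rw [abs_mul, abs_of_nonneg (Real.sqrt_nonneg _)]
  exact (mul_le_of_le_one_left (abs_nonneg _) (Real.sqrt_le_one.2 (by linarith))).trans
    (abs_fieldForm_le h.L_le _ σ z)

lemma Admissible.measurable_pathHam_fix (h : K.Admissible b L M) {f : T → ℝ} (hf : Measurable f)
    (t : ℝ) (z : Fin (k + 1) → E) : Measurable fun σ => pathHam b L f t σ z := by
  simp only [pathHam_eq]
  exact (hf.const_mul _).add (h.b_meas.add
    (((measurable_fieldForm h.L_meas (k + 1)).comp measurable_prodMk_right).const_mul _))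

lemma Admissible.expTendsto_of_expDist (h : K.Admissible b L M) {u : Filter ι} {fs : ι → T → ℝ}
    {f : T → ℝ} {t : ℝ} (ht : t ∈ Icc (0 : ℝ) 1)
    (hi : ∀ i, Integrable (fun σ => |fs i σ - f σ| * (2 + Real.exp (fs i σ) + Real.exp (f σ))) K.ν)
    (hlim : Tendsto (fun i => expDist K.ν (fs i) f) u (𝓝 0)) :
    K.ExpTendsto (fun i => pathHam b L (fs i) t) u (pathHam b L f t) := by
  intro z
  refine squeeze_zero (fun i => integral_nonneg fun σ => abs_nonneg _) (fun i => ?_)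
    (by simpa using hlim.const_mul (Real.exp (M + (k + 1) * M * ‖z‖)))
  rw [expDist, ← integral_const_mul]
  refine integral_mono_of_nonneg (ae_of_all _ fun σ => abs_nonneg _) ((hi i).const_mul _)
    (ae_of_all _ fun σ => ?_)
  simp only [pathHam_eq, Real.exp_add (√t * _)]
  rw [← sub_mul, abs_mul, Real.abs_exp, mul_comm]
  exact mul_le_mul (Real.exp_le_exp.2 ((le_abs_self _).trans (h.pathHam_rest_le ht.1 σ z)))
    (abs_exp_sqrt_sub_le ht _ _) (abs_nonneg _) (Real.exp_pos _).le

lemma Admissible.expTendsto_time (h : K.Admissible b L M) {f : T → ℝ} (hf : Measurable f)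
    (hi : Integrable (fun σ => Real.exp (f σ)) K.ν) (t₀ : Icc (0 : ℝ) 1) :
    K.ExpTendsto (fun t : Icc (0 : ℝ) 1 => pathHam b L f t) (𝓝 t₀) (pathHam b L f t₀) := by
  intro z
  have hbd : ∀ (t : Icc (0 : ℝ) 1) σ, Real.exp (pathHam b L f t σ z) ≤
      (1 + Real.exp (f σ)) * Real.exp (M + (k + 1) * M * ‖z‖) := fun t σ => by
    rw [pathHam_eq, Real.exp_add]
    exact mul_le_mul (exp_sqrt_mul_le t.2 _) (Real.exp_le_exp.2 ((le_abs_self _).trans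
      (h.pathHam_rest_le t.2.1 σ z))) (Real.exp_pos _).le (by positivity)
  have : Tendsto (fun t : Icc (0 : ℝ) 1 => ∫ σ, |Real.exp (pathHam b L f t σ z) -
      Real.exp (pathHam b L f t₀ σ z)| ∂K.ν) (𝓝 t₀) (𝓝 (∫ _, (0 : ℝ) ∂K.ν)) := by
    refine tendsto_integral_filter_of_dominated_convergence
      (fun σ => 2 * ((1 + Real.exp (f σ)) * Real.exp (M + (k + 1) * M * ‖z‖)))
      (Eventually.of_forall fun t => ?_) (Eventually.of_forall fun t => ae_of_all _ fun σ => ?_)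
      ((((integrable_const 1).add hi).mul_const _).const_mul 2) (ae_of_all _ fun σ => ?_)
    · exact (measurable_abs.comp ((Real.measurable_exp.comp (h.measurable_pathHam_fix hf t z)).sub
        (Real.measurable_exp.comp (h.measurable_pathHam_fix hf t₀ z)))).aestronglyMeasurable
    · rw [Real.norm_eq_abs, abs_abs]
      refine (abs_sub _ _).trans ?_
      rw [Real.abs_exp, Real.abs_exp]
      linarith [hbd t σ, hbd t₀ σ]
    · have hc : Continuous fun t : Icc (0 : ℝ) 1 =>
          |Real.exp (pathHam b L f t σ z) - Real.exp (pathHam b L f t₀ σ z)| := by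
        simp only [pathHam]
        fun_prop
      have := hc.tendsto t₀
      simpa using this
  simpa using this

/-- `log Z ≤ Z - 1` gives the upper bound and Jensen's inequality the lower one. The result does not
depend on `t`, and it is integrable in the disorder because it is linear in the integrals of `exp f`
and `|f|`. -/
lemma Admissible.abs_X_top_le (h : K.Admissible b L M) {f : T → ℝ} (hf : Measurable f)
    (hi : Integrable (fun σ => Real.exp (f σ)) K.ν) (ha : Integrable (fun σ => |f σ|) K.ν)
    {t : ℝ} (ht : t ∈ Icc (0 : ℝ) 1) :
    |K.X (pathHam b L f t) (k + 1) 0| ≤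
      Real.exp M * (K.ν.real univ + ∫ σ, Real.exp (f σ) ∂K.ν) +
        ((K.ν.real univ)⁻¹ * ∫ σ, |f σ| ∂K.ν + |M| + |Real.log (K.ν.real univ)|) := by
  have hv : 0 < K.ν.real univ := by
    rw [Measure.real, ENNReal.toReal_pos_iff]
    exact ⟨Measure.measure_univ_pos.2 (NeZero.ne K.ν), measure_lt_top _ _⟩
  set v := K.ν.real univ
  have hn := h.nice_of_integrable_exp hf hi ht
  have hZ := hn.integral_exp_pos 0
  have hZi := hn.integrable_exp 0
  rw [X_top (Nat.lt_succ_self k)]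
  set Z := ∫ σ, Real.exp (pathHam b L f t σ 0) ∂K.ν with hZdef
  have hE : 0 ≤ ∫ σ, Real.exp (f σ) ∂K.ν := integral_nonneg fun _ => (Real.exp_pos _).le
  have hA : 0 ≤ ∫ σ, |f σ| ∂K.ν := integral_nonneg fun _ => abs_nonneg _
  have hup : Real.log Z ≤ Real.exp M * (v + ∫ σ, Real.exp (f σ) ∂K.ν) := by
    have h1 := Real.log_le_sub_one_of_pos hZ
    have h2 : Z ≤ ∫ σ, Real.exp M * (1 + Real.exp (f σ)) ∂K.ν := by
      refine integral_mono hZi (((integrable_const 1).add hi).const_mul _) fun σ => ?_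
      simp only [pathHam_zero, Real.exp_add]
      rw [mul_comm]
      exact mul_le_mul (Real.exp_le_exp.2 ((le_abs_self _).trans (h.b_le σ)))
        (exp_sqrt_mul_le ht _) (Real.exp_pos _).le (Real.exp_pos _).le
    rw [integral_const_mul, integral_add (integrable_const 1) hi] at h2
    simp only [integral_const, smul_eq_mul, mul_one] at h2
    change Z ≤ Real.exp M * (v + _) at h2
    linarith
  have hlow : -(v⁻¹ * ∫ σ, |f σ| ∂K.ν + |M| + |Real.log v|) ≤ Real.log Z := by
    -- The constant for which `c - |f| - |M|` has integral zero. With it, the tangent inequality `1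
    -- + x ≤ exp x` integrates to Jensen's inequality.
    set c := v⁻¹ * ∫ σ, |f σ| ∂K.ν + |M|
    have h1 : v * Real.exp (-c) ≤ Z := by
      have h2 : ∫ σ, Real.exp (-c) * (1 + (c - |f σ| - |M|)) ∂K.ν ≤ Z := by
        refine integral_mono (Integrable.const_mul ((integrable_const 1).add
          (((integrable_const c).sub ha).sub (integrable_const _))) _) hZi fun σ => ?_
        have h3 := Real.add_one_le_exp (c - |f σ| - |M|)
        have h4 : Real.exp (c - |f σ| - |M|) ≤ Real.exp (c + pathHam b L f t σ (0 : Fin (k + 1) → E)) := by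
          refine Real.exp_le_exp.2 ?_
          rw [pathHam_zero]
          have h5 : |√t * f σ| ≤ |f σ| := by
            rw [abs_mul, abs_of_nonneg (Real.sqrt_nonneg t)]
            exact mul_le_of_le_one_left (abs_nonneg _) (Real.sqrt_le_one.2 ht.2)
          linarith [neg_abs_le (√t * f σ), neg_abs_le (b σ), h.b_le σ, le_abs_self M]
        calc Real.exp (-c) * (1 + (c - |f σ| - |M|))
            ≤ Real.exp (-c) * Real.exp (c + pathHam b L f t σ (0 : Fin (k + 1) → E)) :=
              mul_le_mul_of_nonneg_left (by linarith) (Real.exp_pos _).le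
          _ = _ := by rw [← Real.exp_add]; ring_nf
      have j1 : Integrable (fun σ => c - |f σ|) K.ν := (integrable_const c).sub ha
      have j2 : Integrable (fun σ => c - |f σ| - |M|) K.ν := j1.sub (integrable_const _)
      rw [integral_const_mul, integral_add (integrable_const 1) j2,
        integral_sub j1 (integrable_const _), integral_sub (integrable_const c) ha] at h2
      simp only [integral_const, smul_eq_mul, mul_one] at h2
      have h6 : v + (v * c - ∫ σ, |f σ| ∂K.ν - v * |M|) = v := by
        simp only [c]
        field_simp
        ring
      change Real.exp (-c) * (v + (v * c - ∫ σ, |f σ| ∂K.ν - v * |M|)) ≤ Z at h2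
      rw [h6, mul_comm] at h2
      exact h2
    have h7 := Real.log_le_log (by positivity) h1
    rw [Real.log_mul hv.ne' (Real.exp_pos _).ne', Real.log_exp] at h7
    linarith [neg_abs_le (Real.log v)]
  have hp1 : 0 ≤ Real.exp M * (v + ∫ σ, Real.exp (f σ) ∂K.ν) := by positivity
  have hp2 : 0 ≤ v⁻¹ * ∫ σ, |f σ| ∂K.ν + |M| + |Real.log v| := by positivity
  rw [abs_le]
  constructor <;> linarith

section Map

variable {Ω F : Type*} [MeasurableSpace Ω] [MeasurableSpace F] {P : Measure Ω}
  [IsProbabilityMeasure P] {Θ : Ω → F} {G : T → F → ℝ}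

/-- Only the law of the relevant energies matters. This allows the disorder to be replaced by a
Gaussian vector of finite dimension. -/
lemma integral_map_prod_law (hΘ : Measurable Θ) {f : F × (Fin (k + 1) → E) → ℝ}
    (hf : Measurable f) :
    ∫ q, f q ∂((P.map Θ).prod K.law) = ∫ q, f (Θ q.1, q.2) ∂(P.prod K.law) := by
  have e : (P.map Θ).prod K.law = (P.prod K.law).map (Prod.map Θ id) := by
    rw [← Measure.map_prod_map _ _ hΘ measurable_id, Measure.map_id]
  rw [e, integral_map (hΘ.prodMap measurable_id).aemeasurable hf.aestronglyMeasurable]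
  rfl

lemma Admissible.measurable_pathHam_process (h : K.Admissible b L M)
    (hG : Measurable fun q : T × F => G q.1 q.2) (t : ℝ) :
    Measurable fun q : F × T × (Fin (k + 1) → E) => pathHam b L (fun σ => G σ q.1) t q.2.1 q.2.2 :=
  measurable_pathHam h.L_meas h.b_meas (A := F) (G := fun y σ => G σ y) (hG.comp measurable_swap) t

lemma Admissible.pathEnergy_map (h : K.Admissible b L M) (hΘ : Measurable Θ)
    (hG : Measurable fun q : T × F => G q.1 q.2) (t : ℝ) :
    K.pathEnergy b L (P.map Θ) G t = K.pathEnergy b L P (fun σ ω => G σ (Θ ω)) t := by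
  have hm := measurable_X (K := K) (Y := fun y => pathHam b L (fun σ => G σ y) t)
    (h.measurable_pathHam_process hG t) 1 le_rfl
  exact integral_map_prod_law hΘ hm

lemma kernel_map (hΘ : Measurable Θ) (hG : Measurable fun q : T × F => G q.1 q.2) (l : ℕ) :
    K.kernel L (P.map Θ) G l = K.kernel L P (fun σ ω => G σ (Θ ω)) l := by
  ext σ ρ
  rw [kernel, kernel, integral_map hΘ.aemeasurable]
  exact ((hG.comp measurable_prodMk_left).mul (hG.comp measurable_prodMk_left)).aestronglyMeasurable

lemma Admissible.pathDeriv_map (h : K.Admissible b L M) (hΘ : Measurable Θ)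
    (hG : Measurable fun q : T × F => G q.1 q.2) (t : ℝ) :
    K.pathDeriv b L (P.map Θ) G t = K.pathDeriv b L P (fun σ ω => G σ (Θ ω)) t := by
  have hm := h.measurable_pathHam_process hG t
  have hk : ∀ l, Measurable fun q : T × T => K.kernel L P (fun σ ω => G σ (Θ ω)) l q.1 q.2 :=
    fun l => measurable_kernel (G := fun σ ω => G σ (Θ ω)) h.L_meas
      (hG.comp (measurable_fst.prodMk (hΘ.comp measurable_snd))) l
  have h1 := (measurable_prodW (K := K) (Y := fun y => pathHam b L (fun σ => G σ y) t) hm (k + 1)).mul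
    (measurable_avg (K := K) (Y := fun y => pathHam b L (fun σ => G σ y) t)
      (u := fun _ σ => K.kernel L P (fun σ ω => G σ (Θ ω)) (k + 1) σ σ) hm _ (Nat.le_add_left 1 k)
      (((hk (k + 1)).comp (measurable_id.prodMk measurable_id)).comp measurable_snd))
  have h2 := fun l (hl : l ∈ Finset.Icc 1 k) =>
    measurable_pairDensity (K := K) (Y := fun y => pathHam b L (fun σ => G σ y) t) hm
      (Finset.mem_Icc.1 hl).1 (Finset.mem_Icc.1 hl).1 (hk l)
  have e1 := integral_map_prod_law (K := K) (P := P) hΘ h1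
  have e2 := fun l hl => integral_map_prod_law (K := K) (P := P) hΘ (h2 l hl)
  simp only [pathDeriv, kernel_map hΘ hG]
  congr 2
  exact Finset.sum_congr rfl fun l hl => congrArg _ (e2 l hl)

end Map

end Cascade

end

/-! ### The derivative of the free energy for a general measurable Gaussian process. -/

section

namespace BoundedGaussian

variable {T Ω : Type*} [MeasurableSpace T] [MeasurableSpace Ω] {P : Measure Ω}
  [IsProbabilityMeasure P] {G : T → Ω → ℝ} {V : ℝ} {ν : Measure T} [IsFiniteMeasure ν]

lemma comp (h : BoundedGaussian P G V) {r : T → T} (hr : Measurable r) :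
    BoundedGaussian P (fun σ => G (r σ)) V where
  process := h.process.comp_right r
  meas := h.meas.comp ((hr.comp measurable_fst).prodMk measurable_snd)
  mean σ := h.mean (r σ)
  var_le σ := h.var_le (r σ)

lemma ae_integrable_exp (h : BoundedGaussian P G V) :
    ∀ᵐ ω ∂P, Integrable (fun σ => Real.exp (G σ ω)) ν :=
  (h.integrable_prod_exp (ν := ν)).prod_right_ae

lemma ae_integrable_abs (h : BoundedGaussian P G V) :
    ∀ᵐ ω ∂P, Integrable (fun σ => |G σ ω|) ν :=
  (h.integrable_prod_abs (ν := ν)).prod_right_ae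

lemma measurable_right (h : BoundedGaussian P G V) (ω : Ω) : Measurable fun σ => G σ ω :=
  h.meas.comp measurable_prodMk_right

/-- The difference of the products is a sum of two products, each with one factor tending to `0` in
`L²` and the other bounded there. -/
lemma tendsto_integral_mul (h : BoundedGaussian P G V) {r : ℕ → T → T}
    (hlim : ∀ σ, Tendsto (fun j => ∫ ω, (G (r j σ) ω - G σ ω) ^ 2 ∂P) atTop (𝓝 0)) (σ ρ : T) :
    Tendsto (fun j => ∫ ω, G (r j σ) ω * G (r j ρ) ω ∂P) atTop (𝓝 (∫ ω, G σ ω * G ρ ω ∂P)) := by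
  have key : ∀ (f : ℕ → Ω → ℝ) (g : ℕ → Ω → ℝ) (d : ℕ → ℝ), (∀ j, MemLp (f j) 2 P) →
      (∀ j, MemLp (g j) 2 P) → (∀ j, ∫ ω, g j ω ^ 2 ∂P ≤ V) →
      Tendsto (fun j => ∫ ω, f j ω ^ 2 ∂P) atTop (𝓝 0) →
      Tendsto (fun j => ∫ ω, f j ω * g j ω ∂P) atTop (𝓝 0) := by
    intro f g d hf hg hV hl
    refine squeeze_zero_norm (a := fun j => √(∫ ω, f j ω ^ 2 ∂P) * √V) (fun j => ?_)
      (by simpa using hl.sqrt.mul_const (√V))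
    have h1 := integral_mul_le_sqrt_mul_sqrt (hf j).norm (hg j).norm (fun _ => norm_nonneg _)
      (fun _ => norm_nonneg _)
    simp only [Real.norm_eq_abs, sq_abs] at h1
    refine (norm_integral_le_integral_norm _).trans ?_
    simp only [norm_mul, Real.norm_eq_abs]
    exact h1.trans (mul_le_mul_of_nonneg_left (Real.sqrt_le_sqrt (hV j)) (Real.sqrt_nonneg _))
  have k1 := key (fun j ω => G (r j σ) ω - G σ ω) (fun j => G (r j ρ)) (fun _ => 0)
    (fun j => (h.memLp_two _).sub (h.memLp_two _)) (fun j => h.memLp_two _)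
    (fun j => h.var_le _) (hlim σ)
  have k2 := key (fun j ω => G (r j ρ) ω - G ρ ω) (fun _ => G σ) (fun _ => 0)
    (fun j => (h.memLp_two _).sub (h.memLp_two _)) (fun j => h.memLp_two _)
    (fun j => h.var_le _) (hlim ρ)
  have k3 := (k1.add k2).add_const (∫ ω, G σ ω * G ρ ω ∂P)
  rw [add_zero, zero_add] at k3
  refine k3.congr fun j => ?_
  have i1 : Integrable (fun ω => (G (r j σ) ω - G σ ω) * G (r j ρ) ω) P :=
    ((h.memLp_two _).sub (h.memLp_two _)).integrable_mul (h.memLp_two _)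
  have i2 : Integrable (fun ω => (G (r j ρ) ω - G ρ ω) * G σ ω) P :=
    ((h.memLp_two _).sub (h.memLp_two _)).integrable_mul (h.memLp_two _)
  have i3 : Integrable (fun ω => G σ ω * G ρ ω) P := (h.memLp_two _).integrable_mul (h.memLp_two _)
  have i4 : Integrable (fun ω => (G (r j σ) ω - G σ ω) * G (r j ρ) ω +
    (G (r j ρ) ω - G ρ ω) * G σ ω) P := i1.add i2
  rw [← integral_add i1 i2, ← integral_add i4 i3]
  congr 1
  ext ω
  ring

end BoundedGaussian

namespace Cascade

variable {k : ℕ} {E T Ω ι : Type*} [NormedAddCommGroup E] [NormedSpace ℝ E] [MeasurableSpace E]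
  [BorelSpace E] [SecondCountableTopology E] [CompleteSpace E] [MeasurableSpace T]
  [MeasurableSpace Ω] {P : Measure Ω} [IsProbabilityMeasure P]
  {K : Cascade k E T} {b : T → ℝ} {L : T → StrongDual ℝ E} {M V : ℝ} {G : T → Ω → ℝ}
  [∀ p, IsGaussian (K.γ p)] [NeZero K.ν] [IsFiniteMeasure K.ν]

lemma nonempty_of_neZero (K : Cascade k E T) [NeZero K.ν] : Nonempty T := by
  by_contra hT
  rw [not_nonempty_iff] at hT
  exact NeZero.ne K.ν (Measure.eq_zero_of_isEmpty K.ν)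

lemma Admissible.ae_nice (h : K.Admissible b L M) (hG : BoundedGaussian P G V) :
    ∀ᵐ ω ∂P, ∀ t ∈ Icc (0 : ℝ) 1, K.Nice ((k + 1) * M) (pathHam b L (fun σ => G σ ω) t) := by
  filter_upwards [hG.ae_integrable_exp (ν := K.ν)] with ω hω t ht
  exact h.nice_of_integrable_exp (hG.measurable_right ω) hω ht

/-- A bound for the logarithm of the partition function. -/
def logBound (K : Cascade k E T) (M : ℝ) (f : T → ℝ) : ℝ :=
  Real.exp M * (K.ν.real univ + ∫ σ, Real.exp (f σ) ∂K.ν) +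
    ((K.ν.real univ)⁻¹ * ∫ σ, |f σ| ∂K.ν + |M| + |Real.log (K.ν.real univ)|)

lemma integrable_logBound (hG : BoundedGaussian P G V) :
    Integrable (fun ω => K.logBound M fun σ => G σ ω) P := by
  have i1 : Integrable (fun ω => ∫ σ, Real.exp (G σ ω) ∂K.ν) P :=
    (hG.integrable_prod_exp (ν := K.ν)).integral_prod_left
  have i2 : Integrable (fun ω => ∫ σ, |G σ ω| ∂K.ν) P :=
    (hG.integrable_prod_abs (ν := K.ν)).integral_prod_left
  exact (((integrable_const _).add i1).const_mul _).add
    (((i2.const_mul _).add (integrable_const _)).add (integrable_const _))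

lemma Admissible.ae_abs_X_top_le (h : K.Admissible b L M) (hG : BoundedGaussian P G V) :
    ∀ᵐ ω ∂P, ∀ t ∈ Icc (0 : ℝ) 1,
      |K.X (pathHam b L (fun σ => G σ ω) t) (k + 1) 0| ≤ K.logBound M fun σ => G σ ω := by
  filter_upwards [hG.ae_integrable_exp (ν := K.ν), hG.ae_integrable_abs (ν := K.ν)] with ω h1 h2 t ht
  exact h.abs_X_top_le (hG.measurable_right ω) h1 h2 ht

lemma Admissible.exists_abs_kernel_process_le (h : K.Admissible b L M) (P : Measure Ω)
    [IsProbabilityMeasure P] (V : ℝ) :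
    ∃ B, 0 ≤ B ∧ ∀ G : T → Ω → ℝ, BoundedGaussian P G V → ∀ l σ ρ, |K.kernel L P G l σ ρ| ≤ B := by
  obtain ⟨c, hc⟩ := h.exists_abs_kernel_le
  refine ⟨|V + c|, abs_nonneg _, fun G hG l σ ρ => (hc l σ ρ P G V (hG.memLp_two σ) (hG.memLp_two ρ)
    (hG.var_le σ) (hG.var_le ρ)).trans (le_abs_self _)⟩

lemma Admissible.exists_abs_pathDeriv_le (h : K.Admissible b L M) (P : Measure Ω)
    [IsProbabilityMeasure P] (V : ℝ) :
    ∃ B, ∀ G : T → Ω → ℝ, BoundedGaussian P G V → ∀ t ∈ Icc (0 : ℝ) 1,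
      |K.pathDeriv b L P G t| ≤ B := by
  obtain ⟨B, hB0, hB⟩ := h.exists_abs_kernel_process_le P V
  have : Nonempty T := K.nonempty_of_neZero
  have hC : 0 ≤ (k + 1) * M := mul_nonneg (by positivity) h.M_nonneg
  refine ⟨1 / 2 * (B + ∑ l ∈ Finset.Icc 1 k, |K.m l - K.m (l - 1)| * B), fun G hG t ht => ?_⟩
  have hm := h.measurable_pathHam_process hG.meas t
  have hn := (h.ae_nice hG).mono fun ω hω => hω t ht
  rw [pathDeriv, abs_mul, abs_of_pos (by norm_num : (0 : ℝ) < 1 / 2)]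
  refine mul_le_mul_of_nonneg_left ((abs_sub _ _).trans (add_le_add ?_
    ((Finset.abs_sum_le_sum_abs _ _).trans (Finset.sum_le_sum fun l hl => ?_)))) (by norm_num)
  · exact h.regular.abs_integral_prodW_mul_le hC hm hn (Nat.le_add_left 1 k) le_rfl
      (f := fun q => K.avg (pathHam b L (fun σ => G σ q.1) t) (k + 1)
        (fun σ => K.kernel L P G (k + 1) σ σ) q.2)
      (hn.mono fun ω hω z => h.regular.abs_avg_le hC hω (Nat.le_add_left 1 k)
        (fun σ => hB G hG _ σ σ) z)
  · rw [abs_mul]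
    have hl' := Finset.mem_Icc.1 hl
    exact mul_le_mul_of_nonneg_left (h.regular.abs_integral_prodW_mul_le hC hm hn hl'.1 (by omega)
      (f := fun q => K.avg (pathHam b L (fun σ => G σ q.1) t) l
        (fun σ => K.avg (pathHam b L (fun σ => G σ q.1) t) l (K.kernel L P G l σ) q.2) q.2)
      (hn.mono fun ω hω z => h.regular.abs_avg_avg_le hC hω hl'.1 hl'.1
        (hB G hG l) z)) (abs_nonneg _)

/-- Process and time may both vary, since the statement is needed twice: for a fixed process as time
varies, and at a fixed time along the approximating processes. -/
lemma Admissible.tendsto_path (h : K.Admissible b L M) {u : Filter ι} [u.IsCountablyGenerated]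
    {Gs : ι → T → Ω → ℝ} {ts : ι → ℝ} {t : ℝ} (hG : BoundedGaussian P G V)
    (hGs : ∀ i, BoundedGaussian P (Gs i) V) (ht : t ∈ Icc (0 : ℝ) 1)
    (hn : ∀ᵐ ω ∂P, ∀ i, K.Nice ((k + 1) * M) (pathHam b L (fun σ => Gs i σ ω) (ts i)))
    (hlim : ∀ᵐ ω ∂P, K.ExpTendsto (fun i => pathHam b L (fun σ => Gs i σ ω) (ts i)) u
      (pathHam b L (fun σ => G σ ω) t)) {D : Ω → ℝ} (hD : Integrable D P)
    (hX : ∀ᵐ ω ∂P, ∀ i, |K.X (pathHam b L (fun σ => Gs i σ ω) (ts i)) (k + 1) 0| ≤ D ω)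
    (hcov : ∀ σ ρ, Tendsto (fun i => ∫ ω, Gs i σ ω * Gs i ρ ω ∂P) u (𝓝 (∫ ω, G σ ω * G ρ ω ∂P))) :
    Tendsto (fun i => K.pathEnergy b L P (Gs i) (ts i)) u (𝓝 (K.pathEnergy b L P G t)) ∧
      Tendsto (fun i => K.pathDeriv b L P (Gs i) (ts i)) u (𝓝 (K.pathDeriv b L P G t)) := by
  have : Nonempty T := K.nonempty_of_neZero
  have hC : 0 ≤ (k + 1) * M := mul_nonneg (by positivity) h.M_nonneg
  obtain ⟨B, hB0, hB⟩ := h.exists_abs_kernel_process_le P V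
  have hms := fun i => h.measurable_pathHam_process (hGs i).meas (ts i)
  have hnG := (h.ae_nice hG).mono fun ω hω => hω t ht
  have hkm := fun i l => measurable_kernel (K := K) (P := P) h.L_meas (hGs i).meas l
  have hkl : ∀ l σ ρ, Tendsto (fun i => K.kernel L P (Gs i) l σ ρ) u (𝓝 (K.kernel L P G l σ ρ)) :=
    fun l σ ρ => (hcov σ ρ).sub_const _
  refine ⟨h.regular.tendsto_integral_X (Ys := fun i ω => pathHam b L (fun σ => Gs i σ ω) (ts i))
    (Y := fun ω => pathHam b L (fun σ => G σ ω) t) hC hms hn hnG hlim hD hX le_rfl, ?_⟩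
  refine Tendsto.const_mul _ (Tendsto.sub ?_ (tendsto_finsetSum _ fun l hl =>
    Tendsto.const_mul _ ?_))
  · exact h.regular.tendsto_integral_prodW_mul_avg
      (Ys := fun i ω => pathHam b L (fun σ => Gs i σ ω) (ts i))
      (Y := fun ω => pathHam b L (fun σ => G σ ω) t) hC hms hn hnG hlim (k + 1)
      (Nat.le_add_left 1 k) (fs := fun i σ => K.kernel L P (Gs i) (k + 1) σ σ)
      (fun i => (hkm i (k + 1)).comp (measurable_id.prodMk measurable_id))
      (fun i σ => hB _ (hGs i) _ σ σ) (fun σ => hkl _ σ σ)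
  · have hl' := Finset.mem_Icc.1 hl
    exact h.regular.tendsto_integral_pairDensity
      (Ys := fun i ω => pathHam b L (fun σ => Gs i σ ω) (ts i))
      (Y := fun ω => pathHam b L (fun σ => G σ ω) t) hC hms hn hnG hlim hl'.1 hl'.1
      (fs := fun i => K.kernel L P (Gs i) l) (fun i => hkm i l) (fun i => hB _ (hGs i) l) (hkl l)

lemma Admissible.continuousOn_path (h : K.Admissible b L M) (hG : BoundedGaussian P G V) :
    ContinuousOn (K.pathEnergy b L P G) (Icc 0 1) ∧ ContinuousOn (K.pathDeriv b L P G) (Icc 0 1) := by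
  have key : ∀ t₀ : Icc (0 : ℝ) 1,
      Tendsto (fun t : Icc (0 : ℝ) 1 => K.pathEnergy b L P G t) (𝓝 t₀)
        (𝓝 (K.pathEnergy b L P G t₀)) ∧
      Tendsto (fun t : Icc (0 : ℝ) 1 => K.pathDeriv b L P G t) (𝓝 t₀)
        (𝓝 (K.pathDeriv b L P G t₀)) := by
    intro t₀
    refine h.tendsto_path (Gs := fun _ => G) (ts := fun t : Icc (0 : ℝ) 1 => (t : ℝ)) hG
      (fun _ => hG) t₀.2 ?_ ?_ (integrable_logBound (K := K) (M := M) hG) ?_ fun _ _ => tendsto_const_nhds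
    · filter_upwards [h.ae_nice hG] with ω hω t
      exact hω t t.2
    · filter_upwards [hG.ae_integrable_exp (ν := K.ν)] with ω hω
      exact h.expTendsto_time (hG.measurable_right ω) hω t₀
    · filter_upwards [h.ae_abs_X_top_le hG] with ω hω t
      exact hω t t.2
  constructor
  · rw [continuousOn_iff_continuous_domRestrict, continuous_iff_continuousAt]
    exact fun t₀ => (key t₀).1
  · rw [continuousOn_iff_continuous_domRestrict, continuous_iff_continuousAt]
    exact fun t₀ => (key t₀).2

/-- Only the finitely many energies indexed by the range of `r` occur. They form a Gaussian vector,
and the process is read off it by coordinate forms, to which the computation with linear forms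
applies. -/
lemma Admissible.hasDerivAt_pathEnergy_simple (h : K.Admissible b L M) (hk : 1 ≤ k)
    (hG : BoundedGaussian P G V) (r : SimpleFunc T T) {t : ℝ} (h0 : 0 < t) (h1 : t < 1) :
    HasDerivAt (K.pathEnergy b L P fun σ => G (r σ)) (K.pathDeriv b L P (fun σ => G (r σ)) t) t := by
  classical
  have : Nonempty T := K.nonempty_of_neZero
  set Θ : Ω → (r.range → ℝ) := fun ω => r.range.restrict (G · ω) with hΘdef
  have hΘ : Measurable Θ := measurable_pi_lambda _ fun i => hG.measurable_eval i
  have hμ : IsGaussian (P.map Θ) := (hG.process.hasGaussianLaw r.range).isGaussian_map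
  set g : T → StrongDual ℝ (r.range → ℝ) := fun σ =>
    ContinuousLinearMap.proj (R := ℝ) (φ := fun _ : r.range => ℝ) ⟨r σ, r.mem_range_self σ⟩
  have hgm : Measurable fun q : T × (r.range → ℝ) => g q.1 q.2 := by
    -- The coordinate selected by `g` varies with the configuration; writing it as a finite sum over
    -- the fibres of `r` makes joint measurability visible.
    have e : (fun q : T × (r.range → ℝ) => g q.1 q.2) = fun q =>
        ∑ i : r.range, if r q.1 = i then q.2 i else 0 := by
      ext q
      rw [Finset.sum_eq_single (⟨r q.1, r.mem_range_self q.1⟩ : r.range)]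
      · simp [g]
      · intro i _ hi
        rw [if_neg]
        exact fun he => hi (Subtype.ext he.symm)
      · simp
    rw [e]
    refine Finset.measurable_fun_sum _ fun i _ => Measurable.ite ?_
      ((measurable_pi_apply i).comp measurable_snd) measurable_const
    exact measurable_fst (r.measurableSet_fiber i)
  have hg1 : ∀ σ, ‖g σ‖ ≤ 1 := fun σ => ContinuousLinearMap.opNorm_le_bound _ zero_le_one fun y => by
    rw [one_mul]
    exact norm_le_pi_norm y _
  have hmean : ∫ y, y ∂(P.map Θ) = 0 := by
    ext i
    have hi : Integrable (fun y : r.range → ℝ => y) (P.map Θ) := IsGaussian.integrable_id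
    have := (ContinuousLinearMap.proj (R := ℝ) (φ := fun _ : r.range => ℝ) i).integral_comp_comm hi
    simp only [ContinuousLinearMap.proj_apply] at this
    rw [← this, integral_map hΘ.aemeasurable (measurable_pi_apply i).aestronglyMeasurable]
    exact hG.mean i
  have main := h.hasDerivAt_pathEnergy_form hk hmean hgm hg1 zero_le_one h.M_nonneg h0 h1
  rw [h.pathDeriv_map hΘ hgm] at main
  have e : K.pathEnergy b L (P.map Θ) (fun σ y => g σ y) = K.pathEnergy b L P fun σ => G (r σ) :=
    funext fun t => h.pathEnergy_map hΘ hgm t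
  rw [e] at main
  exact main

/-- The derivative of the interpolated free energy. -/
theorem Admissible.hasDerivWithinAt_pathEnergy (h : K.Admissible b L M) (hk : 1 ≤ k)
    (hG : BoundedGaussian P G V) {t : ℝ} (ht : t ∈ Icc (0 : ℝ) 1) :
    HasDerivWithinAt (K.pathEnergy b L P G) (K.pathDeriv b L P G t) (Icc 0 1) t := by
  have : Nonempty T := K.nonempty_of_neZero
  obtain ⟨r₀, hr₀⟩ := exists_simpleFunc_tendsto_integral_sq hG.meas hG.memLp_two
  have hδi : ∀ j, Integrable (fun ω => expDist K.ν (fun σ => G (r₀ j σ) ω) (fun σ => G σ ω)) P :=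
    fun j => (hG.integrable_prod_expDist (ν := K.ν) (r₀ j).measurable).integral_prod_left
  have hδ0 : ∀ j ω, 0 ≤ expDist K.ν (fun σ => G (r₀ j σ) ω) (fun σ => G σ ω) := fun j ω =>
    integral_nonneg fun σ => by positivity
  obtain ⟨φ, D, hφ, hD, hDae⟩ := exists_dominated_of_tendsto_integral hδ0 hδi
    (hG.tendsto_integral_expDist (fun j => (r₀ j).measurable) hr₀)
  set r : ℕ → SimpleFunc T T := fun j => r₀ (φ j)
  have hr : ∀ σ, Tendsto (fun n => ∫ ω, (G (r n σ) ω - G σ ω) ^ 2 ∂P) atTop (𝓝 0) :=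
    fun σ => (hr₀ σ).comp hφ.tendsto_atTop
  have hGr : ∀ j, BoundedGaussian P (fun σ => G (r j σ)) V := fun j => hG.comp (r j).measurable
  have hint : ∀ᵐ ω ∂P, ∀ j, Integrable (fun σ => |G (r j σ) ω - G σ ω| *
      (2 + Real.exp (G (r j σ) ω) + Real.exp (G σ ω))) K.ν :=
    ae_all_iff.2 fun j => (hG.integrable_prod_expDist (ν := K.ν) (r j).measurable).prod_right_ae
  -- The integrals of `exp` and of the absolute value of the approximating energies exceed those of
  -- the limit by at most the distance `expDist`, which `D` dominates along the subsequence.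
  have hdom : ∀ᵐ ω ∂P, ∀ j, K.logBound M (fun σ => G (r j σ) ω) ≤
      K.logBound M (fun σ => G σ ω) + (Real.exp M + (K.ν.real univ)⁻¹) * D ω := by
    filter_upwards [hDae, hint, hG.ae_integrable_exp (ν := K.ν), hG.ae_integrable_abs (ν := K.ν),
      ae_all_iff.2 fun j => (hGr j).ae_integrable_exp (ν := K.ν),
      ae_all_iff.2 fun j => (hGr j).ae_integrable_abs (ν := K.ν)] with ω h1 h2 h3 h4 h5 h6 j
    have a1 : ∫ σ, Real.exp (G (r j σ) ω) ∂K.ν ≤ ∫ σ, Real.exp (G σ ω) ∂K.ν + D ω := by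
      refine le_trans ?_ (add_le_add_right (h1.1 j) _)
      rw [expDist, ← integral_add h3 (h2 j)]
      refine integral_mono (h5 j) (h3.add (h2 j)) fun σ => ?_
      have := (le_abs_self _).trans (abs_exp_sub_exp_le (G (r j σ) ω) (G σ ω))
      nlinarith [abs_nonneg (G (r j σ) ω - G σ ω)]
    have a2 : ∫ σ, |G (r j σ) ω| ∂K.ν ≤ ∫ σ, |G σ ω| ∂K.ν + D ω := by
      refine le_trans ?_ (add_le_add_right (h1.1 j) _)
      rw [expDist, ← integral_add h4 (h2 j)]
      refine integral_mono (h6 j) (h4.add (h2 j)) fun σ => ?_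
      have b1 := abs_add_le (G (r j σ) ω - G σ ω) (G σ ω)
      rw [sub_add_cancel] at b1
      have b2 : |G (r j σ) ω - G σ ω| ≤ |G (r j σ) ω - G σ ω| *
          (2 + Real.exp (G (r j σ) ω) + Real.exp (G σ ω)) :=
        le_mul_of_one_le_right (abs_nonneg _)
          (by linarith [Real.exp_pos (G (r j σ) ω), Real.exp_pos (G σ ω)])
      linarith
    have c1 := mul_le_mul_of_nonneg_left a1 (Real.exp_pos M).le
    have c2 := mul_le_mul_of_nonneg_left a2
      (inv_nonneg.2 (measureReal_nonneg (μ := K.ν) (s := univ)))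
    simp only [logBound]
    linarith
  have hlimt : ∀ t ∈ Icc (0 : ℝ) 1,
      Tendsto (fun j => K.pathEnergy b L P (fun σ => G (r j σ)) t) atTop
        (𝓝 (K.pathEnergy b L P G t)) ∧
      Tendsto (fun j => K.pathDeriv b L P (fun σ => G (r j σ)) t) atTop
        (𝓝 (K.pathDeriv b L P G t)) := by
    intro t ht
    refine h.tendsto_path (Gs := fun j σ => G (r j σ)) (ts := fun _ => t) hG hGr ht
      (ae_all_iff.2 fun j => (h.ae_nice (hGr j)).mono fun ω hω => hω t ht) ?_
      ((integrable_logBound (M := M) (K := K) hG).add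
        (hD.const_mul (Real.exp M + (K.ν.real univ)⁻¹))) ?_
      (hG.tendsto_integral_mul hr)
    · filter_upwards [hDae, hint] with ω h1 h2
      exact h.expTendsto_of_expDist ht h2 h1.2
    · filter_upwards [hdom, ae_all_iff.2 fun j => h.ae_abs_X_top_le (hGr j)] with ω h1 h2 j
      exact (h2 j t ht).trans (h1 j)
  obtain ⟨B, hB⟩ := h.exists_abs_pathDeriv_le P V
  have hcont := h.continuousOn_path hG
  -- Derivatives do not pass to pointwise limits, but the integrated identity does: the
  -- approximating derivatives converge and are bounded by one constant `B`.
  have hFTC : ∀ s ∈ Icc (0 : ℝ) 1, K.pathEnergy b L P G s - K.pathEnergy b L P G 0 =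
      ∫ x in (0 : ℝ)..s, K.pathDeriv b L P G x := by
    intro s hs
    have hsub : Icc 0 s ⊆ Icc (0 : ℝ) 1 := Icc_subset_Icc le_rfl hs.2
    have hj : ∀ j, ∫ x in (0 : ℝ)..s, K.pathDeriv b L P (fun σ => G (r j σ)) x =
        K.pathEnergy b L P (fun σ => G (r j σ)) s - K.pathEnergy b L P (fun σ => G (r j σ)) 0 := by
      intro j
      have hc := h.continuousOn_path (hGr j)
      refine intervalIntegral.integral_eq_sub_of_hasDerivAt_of_le hs.1 (hc.1.mono hsub)
        (fun x hx => h.hasDerivAt_pathEnergy_simple hk hG (r j) hx.1 (hx.2.trans_le hs.2)) ?_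
      exact (hc.2.mono (by rwa [uIcc_of_le hs.1])).intervalIntegrable
    have l1 : Tendsto (fun j => ∫ x in (0 : ℝ)..s, K.pathDeriv b L P (fun σ => G (r j σ)) x) atTop
        (𝓝 (∫ x in (0 : ℝ)..s, K.pathDeriv b L P G x)) := by
      have hsub' : ∀ x ∈ uIoc 0 s, x ∈ Icc (0 : ℝ) 1 := fun x hx => by
        rw [uIoc_of_le hs.1] at hx
        exact ⟨hx.1.le, hx.2.trans hs.2⟩
      refine intervalIntegral.tendsto_integral_filter_of_dominated_convergence (fun _ => B)
        (Eventually.of_forall fun j => ?_)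
        (Eventually.of_forall fun j => ae_of_all _ fun x hx => hB _ (hGr j) x (hsub' x hx))
        intervalIntegrable_const (ae_of_all _ fun x hx => (hlimt x (hsub' x hx)).2)
      exact (((h.continuousOn_path (hGr j)).2.mono (s := Icc (0 : ℝ) 1) (t := uIoc 0 s)
        hsub').aestronglyMeasurable measurableSet_uIoc)
    have l2 := (hlimt s hs).1.sub (hlimt 0 ⟨le_rfl, zero_le_one⟩).1
    exact tendsto_nhds_unique l2 (l1.congr hj)
  -- The continuous extension by constants outside the interval has a primitive differentiable on
  -- the whole line. The one-sided derivatives at `0` and `1` follow by restriction.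
  set Ψ : ℝ → ℝ := IccExtend (zero_le_one (α := ℝ)) ((Icc 0 1).domRestrict (K.pathDeriv b L P G))
  have hΨc : Continuous Ψ := (continuousOn_iff_continuous_domRestrict.1 hcont.2).Icc_extend'
  have hΨ : ∀ x ∈ Icc (0 : ℝ) 1, Ψ x = K.pathDeriv b L P G x := fun x hx =>
    IccExtend_of_mem _ _ hx
  have hd : HasDerivAt (fun s => K.pathEnergy b L P G 0 + ∫ x in (0 : ℝ)..s, Ψ x) (Ψ t) t :=
    (hΨc.integral_hasStrictDerivAt 0 t).hasDerivAt.const_add _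
  rw [← hΨ t ht]
  refine hd.hasDerivWithinAt.congr (fun s hs => ?_) ?_
  · have e : ∫ x in (0 : ℝ)..s, Ψ x = ∫ x in (0 : ℝ)..s, K.pathDeriv b L P G x := by
      refine intervalIntegral.integral_congr fun x hx => hΨ x ?_
      rw [uIcc_of_le hs.1] at hx
      exact ⟨hx.1, hx.2.trans hs.2⟩
    rw [e, ← hFTC s hs]
    ring
  · have e : ∫ x in (0 : ℝ)..t, Ψ x = ∫ x in (0 : ℝ)..t, K.pathDeriv b L P G x := by
      refine intervalIntegral.integral_congr fun x hx => hΨ x ?_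
      rw [uIcc_of_le ht.1] at hx
      exact ⟨hx.1, hx.2.trans ht.2⟩
    rw [e, ← hFTC t ht]
    ring

end Cascade

end

/-! ### Overlaps, the uniform measure on the sphere, and the mass of the constraint set. -/

section

section Overlap

variable {N : ℕ}

lemma sum_mul_eq_inner (σ τ : EuclideanSpace ℝ (Fin N)) : ∑ i, σ i * τ i = inner ℝ σ τ := by
  simp [PiLp.inner_apply, mul_comm]

lemma overlap_eq_inner (σ τ : EuclideanSpace ℝ (Fin N)) :
    overlap σ τ = (1 / (N : ℝ)) * inner ℝ σ τ := by
  rw [overlap, sum_mul_eq_inner]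

lemma mul_overlap (σ τ : EuclideanSpace ℝ (Fin N)) :
    (N : ℝ) * overlap σ τ = ∑ i, σ i * τ i := by
  rcases Nat.eq_zero_or_pos N with rfl | h
  · simp
  · have : (N : ℝ) ≠ 0 := by positivity
    rw [overlap, ← mul_assoc, mul_one_div_cancel this, one_mul]

lemma continuous_overlap :
    Continuous fun p : EuclideanSpace ℝ (Fin N) × EuclideanSpace ℝ (Fin N) =>
      overlap p.1 p.2 := by
  simp only [overlap_eq_inner]
  fun_prop

lemma continuous_overlap_apply {n : ℕ} (j j' : Fin n) :
    Continuous fun σ : Fin n → EuclideanSpace ℝ (Fin N) => overlap (σ j) (σ j') :=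
  continuous_overlap.comp (f := fun σ : Fin n → EuclideanSpace ℝ (Fin N) => (σ j, σ j'))
    ((continuous_apply j).prodMk (continuous_apply j'))

lemma abs_overlap_le_one {σ τ : EuclideanSpace ℝ (Fin N)}
    (hσ : σ ∈ Metric.sphere (0 : EuclideanSpace ℝ (Fin N)) (Real.sqrt N))
    (hτ : τ ∈ Metric.sphere (0 : EuclideanSpace ℝ (Fin N)) (Real.sqrt N)) :
    |overlap σ τ| ≤ 1 := by
  rw [mem_sphere_zero_iff_norm] at hσ hτ
  rw [overlap_eq_inner, abs_mul, abs_of_nonneg (by positivity)]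
  have h := abs_real_inner_le_norm σ τ
  rw [hσ, hτ, Real.mul_self_sqrt (Nat.cast_nonneg N)] at h
  calc 1 / (N : ℝ) * |inner ℝ σ τ| ≤ 1 / N * N := by gcongr
    _ ≤ 1 := by rw [one_div]; exact inv_mul_le_one

lemma abs_apply_le_of_mem_sphere {σ : EuclideanSpace ℝ (Fin N)} {r : ℝ}
    (hσ : σ ∈ Metric.sphere (0 : EuclideanSpace ℝ (Fin N)) r) (i : Fin N) : |σ i| ≤ r := by
  rw [mem_sphere_zero_iff_norm] at hσ
  rw [← hσ]
  exact PiLp.norm_apply_le σ i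

open scoped MatrixOrder Matrix.Norms.L2Operator in
/-- A positive semidefinite matrix is the Gram matrix of vectors of any dimension at least its
size. -/
lemma Matrix.PosSemidef.exists_gram {n : ℕ} {Q : Matrix (Fin n) (Fin n) ℝ} (hQ : Q.PosSemidef)
    (hN : n ≤ N) :
    ∃ v : Fin n → EuclideanSpace ℝ (Fin N), ∀ j j', inner ℝ (v j) (v j') = Q j j' := by
  obtain ⟨B, hB⟩ := CStarAlgebra.nonneg_iff_eq_star_mul_self.1 hQ.nonneg
  -- The columns of the factor `B` with `Q = star B * B`, padded with zeros to length `N`; this is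
  -- where `n ≤ N` is needed.
  refine ⟨fun j => WithLp.toLp 2 (Function.extend (Fin.castLE hN) (fun i => B i j) 0),
    fun j j' => ?_⟩
  have hinj := Fin.castLE_injective hN
  rw [← sum_mul_eq_inner, hB, Matrix.star_eq_conjTranspose, Matrix.mul_apply]
  symm
  refine Finset.sum_of_injOn (Fin.castLE hN) hinj.injOn (fun _ _ => Finset.mem_coe.2 (Finset.mem_univ _))
    (fun i _ hi => ?_) fun i _ => ?_
  · have : ¬∃ a, Fin.castLE hN a = i := fun ⟨a, ha⟩ => hi ⟨a, by simp, ha⟩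
    simp [Function.extend_apply' _ _ _ this]
  · simp [hinj.extend_apply]

end Overlap

section UniformSphere

variable {N : ℕ}

lemma continuous_sqrt_smul_sphere : Continuous
    fun x : Metric.sphere (0 : EuclideanSpace ℝ (Fin N)) 1 =>
      Real.sqrt N • (x : EuclideanSpace ℝ (Fin N)) := by
  fun_prop

instance isFiniteMeasure_uniformSphere : IsFiniteMeasure (uniformSphere N) := by
  set μ := (volume : Measure (EuclideanSpace ℝ (Fin N))).toSphere
  have : IsFiniteMeasure ((μ univ)⁻¹ • μ) := by
    refine ⟨?_⟩
    rw [Measure.smul_apply, smul_eq_mul]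
    exact ENNReal.inv_mul_le_one _ |>.trans_lt ENNReal.one_lt_top
  exact Measure.isFiniteMeasure_map _ _

instance isFiniteMeasure_uniformSpheres {n : ℕ} : IsFiniteMeasure (uniformSpheres n N) := by
  unfold uniformSpheres
  infer_instance

/-- Scaling reduces this to the positivity of surface measure on nonempty open subsets of the unit
sphere. -/
lemma uniformSphere_inter_pos {x : EuclideanSpace ℝ (Fin N)} (hN : 1 ≤ N)
    (hx : x ∈ Metric.sphere (0 : EuclideanSpace ℝ (Fin N)) (Real.sqrt N))
    {U : Set (EuclideanSpace ℝ (Fin N))} (hU : IsOpen U) (hxU : x ∈ U) :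
    0 < uniformSphere N (Metric.sphere 0 (Real.sqrt N) ∩ U) := by
  have hN' : 0 < Real.sqrt N := Real.sqrt_pos.2 (by exact_mod_cast hN)
  set f := fun y : Metric.sphere (0 : EuclideanSpace ℝ (Fin N)) 1 =>
    Real.sqrt N • (y : EuclideanSpace ℝ (Fin N)) with hf
  have hfc : Continuous f := continuous_sqrt_smul_sphere
  have hms : MeasurableSet (Metric.sphere (0 : EuclideanSpace ℝ (Fin N)) (Real.sqrt N) ∩ U) :=
    Metric.isClosed_sphere.measurableSet.inter hU.measurableSet
  rw [uniformSphere, Measure.map_apply hfc.measurable hms, Measure.smul_apply, smul_eq_mul]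
  have e : f ⁻¹' (Metric.sphere 0 (Real.sqrt N) ∩ U) = f ⁻¹' U := by
    ext y
    simp only [mem_preimage, mem_inter_iff, and_iff_right_iff_imp]
    intro _
    rw [mem_sphere_zero_iff_norm, hf]
    simp [norm_smul, hN'.le]
  rw [e]
  refine ENNReal.mul_pos (ENNReal.inv_ne_zero.2 (measure_ne_top _ _))
    ((hU.preimage hfc).measure_pos _ ?_).ne'
  rw [mem_sphere_zero_iff_norm] at hx
  refine ⟨⟨(Real.sqrt N)⁻¹ • x, ?_⟩, ?_⟩
  · rw [mem_sphere_zero_iff_norm, norm_smul, hx, norm_inv, Real.norm_of_nonneg hN'.le,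
      inv_mul_cancel₀ hN'.ne']
  · rw [mem_preimage, hf]
    simpa [smul_smul, mul_inv_cancel₀ hN'.ne'] using hxU

end UniformSphere

namespace CoupledSystem

variable {n k : ℕ} {Ω : Type*} {S : CoupledSystem n k Ω} {N : ℕ} {ε : ℝ}

lemma measurableSet_constraintSet : MeasurableSet (S.constraintSet N ε) := by
  refine IsClosed.measurableSet ?_
  have e : S.constraintSet N ε = (⋂ j, {σ | σ j ∈ Metric.sphere (0 : EuclideanSpace ℝ (Fin N)) (Real.sqrt N)}) ∩
      ⋂ j, ⋂ j', {σ | overlap (σ j) (σ j') ∈ Icc (S.Q j j' - ε) (S.Q j j' + ε)} := by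
    ext σ
    simp [constraintSet]
  rw [e]
  refine (isClosed_iInter fun j => Metric.isClosed_sphere.preimage (continuous_apply j)).inter
    (isClosed_iInter fun j => isClosed_iInter fun j' => isClosed_Icc.preimage
      (continuous_overlap_apply j j'))

/-- Gram vectors of `Q`, scaled by `√N`, lie on the sphere because `Q` has unit diagonal, and have
overlaps exactly `Q`. As `ε > 0`, an open box around them satisfies the constraints, and each of its
sides has positive mass. -/
lemma uniformSpheres_constraintSet_pos (hQ : S.Q.PosSemidef) (hQ1 : ∀ j, S.Q j j = 1)
    (hε : 0 < ε) (hN : n ≤ N) : 0 < uniformSpheres n N (S.constraintSet N ε) := by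
  obtain ⟨v, hv⟩ := hQ.exists_gram hN
  set x : Fin n → EuclideanSpace ℝ (Fin N) := fun j => Real.sqrt N • v j
  have hnorm : ∀ j, x j ∈ Metric.sphere (0 : EuclideanSpace ℝ (Fin N)) (Real.sqrt N) := fun j => by
    have h1 : ‖v j‖ = 1 := by
      have := hv j j
      rw [hQ1, real_inner_self_eq_norm_sq] at this
      nlinarith [norm_nonneg (v j)]
    rw [mem_sphere_zero_iff_norm, norm_smul, h1, mul_one, Real.norm_of_nonneg (Real.sqrt_nonneg _)]
  have hpos : ∀ _ : Fin n, 0 < (N : ℝ) := fun j => by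
    have := j.pos
    exact_mod_cast this.trans_le hN
  have hov : ∀ j j', overlap (x j) (x j') = S.Q j j' := fun j j' => by
    have := (hpos j).ne'
    rw [overlap_eq_inner, real_inner_smul_left, real_inner_smul_right, hv, ← mul_assoc (√(N : ℝ)),
      Real.mul_self_sqrt (hpos j).le]
    field_simp
  have hopen : IsOpen (⋂ j, ⋂ j', {σ : Fin n → EuclideanSpace ℝ (Fin N) |
      overlap (σ j) (σ j') ∈ Ioo (S.Q j j' - ε) (S.Q j j' + ε)}) :=
    isOpen_iInter_of_finite fun j => isOpen_iInter_of_finite fun j' => isOpen_Ioo.preimage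
      (continuous_overlap_apply j j')
  have hx : x ∈ ⋂ j, ⋂ j', {σ : Fin n → EuclideanSpace ℝ (Fin N) |
      overlap (σ j) (σ j') ∈ Ioo (S.Q j j' - ε) (S.Q j j' + ε)} := by
    simp [hov, hε]
  obtain ⟨u, hu, hsub⟩ := isOpen_pi_iff'.1 hopen x hx
  refine lt_of_lt_of_le ?_ (measure_mono (s := Set.pi univ fun j =>
    Metric.sphere (0 : EuclideanSpace ℝ (Fin N)) (Real.sqrt N) ∩ u j) fun σ hσ => ?_)
  · rw [uniformSpheres, Measure.pi_pi, pos_iff_ne_zero, Finset.prod_ne_zero_iff]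
    exact fun j _ => (uniformSphere_inter_pos (by exact_mod_cast hpos j) (hnorm j) (hu j).1
      (hu j).2).ne'
  · refine ⟨fun j => (hσ j (mem_univ j)).1, fun j j' => ?_⟩
    have := hsub fun j hj => (hσ j hj).2
    simp only [mem_iInter, mem_ofPred_eq] at this
    exact Ioo_subset_Icc_self (this j j')

end CoupledSystem

end

/-! ### The coupled system as an instance of the abstract recursion, on the subtype of the
constraint set. -/

section

namespace CoupledSystem

variable {n k : ℕ} {Ω : Type*} (S : CoupledSystem n k Ω) (N : ℕ) (ε : ℝ)

/-- The recursion of exponential averages of a coupled system. -/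
def cascade : Cascade k (Fin N → EuclideanSpace ℝ (Fin n)) (S.constraintSet N ε) where
  ν := (uniformSpheres n N).comap Subtype.val
  γ l := Measure.pi fun _ => multivariateGaussian 0 (S.Delta l)
  m := S.m

/-- The energy of `n` coupled configurations. -/
def energy (σ : S.constraintSet N ε) (ω : Ω) : ℝ := ∑ j, S.β j * S.H N (σ.1 j) ω

/-- The interaction of `n` coupled configurations with the external fields. -/
def external (σ : S.constraintSet N ε) : ℝ := ∑ j, ∑ i, σ.1 j i * S.h j

/-- The interaction of `n` coupled configurations with the random fields of one level. -/
def interaction (σ : S.constraintSet N ε) : StrongDual ℝ (Fin N → EuclideanSpace ℝ (Fin n)) :=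
  ∑ j, ∑ i, σ.1 j i • (EuclideanSpace.proj j ∘L ContinuousLinearMap.proj i)

/-- The interpolating Hamiltonian on the constraint set. -/
def path (t : ℝ) (ω : Ω) (σ : S.constraintSet N ε) (z : Fields n k N) : ℝ :=
  Cascade.pathHam (S.external N ε) (S.interaction N ε) (fun σ => S.energy N ε σ ω) t σ z

variable {S N ε}

lemma interaction_apply (σ : S.constraintSet N ε) (x : Fin N → EuclideanSpace ℝ (Fin n)) :
    S.interaction N ε σ x = ∑ j, ∑ i, σ.1 j i * x i j := by
  simp [interaction]

lemma hamiltonian_eq_path (t : ℝ) (ω : Ω) (σ : S.constraintSet N ε) (z : Fields n k N) :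
    S.hamiltonian N t ω z σ = S.path N ε t ω σ z := by
  simp only [hamiltonian, path, Cascade.pathHam, Cascade.fieldForm, interaction_apply, energy,
    external, Fin.is_lt, if_true, add_assoc]
  congr 1
  have h : ∑ p, ∑ j, ∑ i, σ.1 j i * z p i j = ∑ j, ∑ i, σ.1 j i * ∑ p, z p i j := by
    simp only [Finset.mul_sum]
    rw [Finset.sum_comm]
    exact Finset.sum_congr rfl fun j _ => Finset.sum_comm
  rw [h, Finset.mul_sum, ← Finset.sum_add_distrib]
  refine Finset.sum_congr rfl fun j _ => ?_
  rw [Finset.mul_sum, ← Finset.sum_add_distrib]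
  exact Finset.sum_congr rfl fun i _ => by ring

lemma X_eq (t : ℝ) {l : ℕ} (hl : 1 ≤ l) (ω : Ω) (z : Fields n k N) :
    S.X N ε t l ω z = (S.cascade N ε).X (S.path N ε t ω) l z := by
  revert z
  refine Cascade.level_induction (k := k) (p := fun l => ∀ z, S.X N ε t l ω z =
    (S.cascade N ε).X (S.path N ε t ω) l z) (fun l hl z => ?_) (fun l _ hl ih z => ?_) l hl
  · rw [X, if_neg (by omega), Cascade.X_top hl]
    congr 1
    rw [← integral_subtype_comap measurableSet_constraintSet]
    simp only [hamiltonian_eq_path]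
    rfl
  · rw [X, if_pos hl, Cascade.X_of_le hl]
    simp only [ih]
    rfl

lemma W_eq (t : ℝ) {l : ℕ} (hl : 1 ≤ l) (ω : Ω) (z : Fields n k N) :
    S.W N ε t l ω z = (S.cascade N ε).W (S.path N ε t ω) l z := by
  rw [W, Cascade.W, X_eq t hl, X_eq t (Nat.le_add_left 1 l)]
  rfl

lemma D_eq (t : ℝ) (σ : S.constraintSet N ε) {l : ℕ} (hl : 1 ≤ l) (ω : Ω) (z : Fields n k N) :
    S.D N ε t σ l ω z = (S.cascade N ε).D (S.path N ε t ω) σ l z := by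
  revert z
  refine Cascade.level_induction (k := k) (p := fun l => ∀ z, S.D N ε t σ l ω z =
    (S.cascade N ε).D (S.path N ε t ω) σ l z) (fun l hl z => ?_) (fun l h1 hl ih z => ?_) l hl
  · rw [D, if_neg (by omega), Cascade.D_top hl, hamiltonian_eq_path]
    congr 1
    rw [← integral_subtype_comap measurableSet_constraintSet]
    simp only [hamiltonian_eq_path]
    rfl
  · rw [D, if_pos hl, Cascade.D_of_le hl]
    simp only [ih, W_eq t h1]
    rfl

variable [MeasurableSpace Ω] {P : Measure Ω}

lemma phi_eq (t : ℝ) : S.phi P N ε t = (1 / (N : ℝ)) *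
    (S.cascade N ε).pathEnergy (S.external N ε) (S.interaction N ε) P (S.energy N ε) t := by
  simp only [phi, X_eq t le_rfl]
  rfl

lemma pairAverage_eq (t : ℝ) {l : ℕ} (hl : 1 ≤ l)
    (f : (Fin n → EuclideanSpace ℝ (Fin N)) → (Fin n → EuclideanSpace ℝ (Fin N)) → ℝ) :
    S.pairAverage P N ε t l f =
      (S.cascade N ε).pathPair (S.external N ε) (S.interaction N ε) P (S.energy N ε) l
        (fun σ ρ => f σ ρ) t := by
  refine integral_congr_ae (ae_of_all _ fun p => ?_)
  have hW : ∏ i ∈ Finset.Ico 1 l, S.W N ε t i p.1 p.2 =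
      (S.cascade N ε).prodW (S.path N ε t p.1) l p.2 :=
    Finset.prod_congr rfl fun i hi => W_eq t (Finset.mem_Ico.1 hi).1 p.1 p.2
  simp only [← integral_subtype_comap measurableSet_constraintSet, D_eq t _ hl, hW]
  refine congrArg₂ _ rfl (integral_congr_ae (ae_of_all _ fun σ => ?_))
  refine Eq.trans ?_ (integral_mul_const _ _)
  exact integral_congr_ae (ae_of_all _ fun ρ => mul_right_comm _ _ _)

end CoupledSystem

end

/-! ### Covariances and standing assumptions of the coupled system. -/

section

section Fields

variable {n N : ℕ} {Δ : Matrix (Fin n) (Fin n) ℝ}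

lemma integral_eval_mul_eval_pi_multivariateGaussian (hΔ : Δ.PosSemidef) (i i' : Fin N)
    (j j' : Fin n) :
    ∫ x, x i j * x i' j' ∂(Measure.pi fun _ : Fin N => multivariateGaussian 0 Δ) =
      if i = i' then Δ j j' else 0 := by
  have h0 : ∫ x, x ∂(multivariateGaussian 0 Δ) = 0 := integral_id_multivariateGaussian
  have h := integral_dual_mul_dual_pi (fun _ : Fin N => multivariateGaussian 0 Δ) (fun _ => h0)
    (EuclideanSpace.proj j) (EuclideanSpace.proj j') i i'
  refine h.trans ?_
  have hm : ∀ j, MemLp (fun x : EuclideanSpace ℝ (Fin n) => x j) 2 (multivariateGaussian 0 Δ) :=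
    fun j => IsGaussian.memLp_dual _ (EuclideanSpace.proj j) 2 (by simp)
  have hz : ∫ x : EuclideanSpace ℝ (Fin n), x j ∂(multivariateGaussian 0 Δ) = 0 := by
    have := IsGaussian.integral_dual (μ := multivariateGaussian 0 Δ) (EuclideanSpace.proj j)
    rw [h0, map_zero] at this
    exact this
  have hc := covariance_eval_multivariateGaussian (μ := 0) hΔ j j'
  rw [covariance_eq_sub (hm j) (hm j'), hz, zero_mul, sub_zero] at hc
  split_ifs
  · exact hc
  · rfl

end Fields

namespace CoupledSystem

variable {n k : ℕ} {Ω : Type*} {S : CoupledSystem n k Ω} {N : ℕ} {ε : ℝ}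

instance isGaussian_cascade (p : Fin (k + 1)) : IsGaussian ((S.cascade N ε).γ p) :=
  isGaussian_pi _

instance isFiniteMeasure_cascade : IsFiniteMeasure (S.cascade N ε).ν := by
  refine ⟨?_⟩
  rw [cascade, (MeasurableEmbedding.subtype_coe measurableSet_constraintSet).comap_apply]
  exact measure_lt_top _ _

/-- The interaction covariance of the random fields of one level. -/
lemma integral_interaction_mul (p : Fin (k + 1)) (h : (S.Delta p).PosSemidef)
    (σ ρ : S.constraintSet N ε) :
    ∫ x, S.interaction N ε σ x * S.interaction N ε ρ x ∂((S.cascade N ε).γ p) =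
      N * ∑ j, ∑ j', overlap (σ.1 j) (ρ.1 j') * S.Delta p j j' := by
  set γ := (S.cascade N ε).γ p with hγ
  have hm : ∀ (i : Fin N) (j : Fin n),
      MemLp (fun x : Fin N → EuclideanSpace ℝ (Fin n) => x i j) 2 γ :=
    fun i j => IsGaussian.memLp_dual _ ((EuclideanSpace.proj j : EuclideanSpace ℝ (Fin n) →L[ℝ] ℝ) ∘L
      ContinuousLinearMap.proj (R := ℝ) (φ := fun _ : Fin N => EuclideanSpace ℝ (Fin n)) i)
      2 (by simp)
  have hi : ∀ i j i' j', Integrable (fun x : Fin N → EuclideanSpace ℝ (Fin n) =>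
      σ.1 j i * ρ.1 j' i' * (x i j * x i' j')) γ := fun i j i' j' =>
    ((hm i j).integrable_mul (hm i' j')).const_mul _
  have e : ∀ x, S.interaction N ε σ x * S.interaction N ε ρ x = ∑ j, ∑ i, ∑ j', ∑ i',
      σ.1 j i * ρ.1 j' i' * (x i j * x i' j') := fun x => by
    rw [interaction_apply, interaction_apply, Finset.sum_mul]
    refine Finset.sum_congr rfl fun j _ => ?_
    rw [Finset.sum_mul]
    refine Finset.sum_congr rfl fun i _ => ?_
    rw [Finset.mul_sum]
    refine Finset.sum_congr rfl fun j' _ => ?_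
    rw [Finset.mul_sum]
    exact Finset.sum_congr rfl fun i' _ => by ring
  have er : (N : ℝ) * ∑ j, ∑ j', overlap (σ.1 j) (ρ.1 j') * S.Delta p j j' =
      ∑ j, ∑ i, ∑ j', σ.1 j i * ρ.1 j' i * S.Delta p j j' := by
    rw [Finset.mul_sum]
    refine Finset.sum_congr rfl fun j _ => ?_
    rw [Finset.mul_sum, Finset.sum_comm]
    refine Finset.sum_congr rfl fun j' _ => ?_
    rw [← mul_assoc, mul_overlap, Finset.sum_mul]
  rw [er]
  simp only [e]
  rw [integral_finsetSum _ fun j _ => integrable_finsetSum _ fun i _ =>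
    integrable_finsetSum _ fun j' _ => integrable_finsetSum _ fun i' _ => hi i j i' j']
  refine Finset.sum_congr rfl fun j _ => ?_
  rw [integral_finsetSum _ fun i _ =>
    integrable_finsetSum _ fun j' _ => integrable_finsetSum _ fun i' _ => hi i j i' j']
  refine Finset.sum_congr rfl fun i _ => ?_
  rw [integral_finsetSum _ fun j' _ => integrable_finsetSum _ fun i' _ => hi i j i' j']
  refine Finset.sum_congr rfl fun j' _ => ?_
  rw [integral_finsetSum _ fun i' _ => hi i j i' j', Finset.sum_eq_single i]
  · rw [integral_const_mul, hγ]
    exact congrArg₂ _ rfl ((integral_eval_mul_eval_pi_multivariateGaussian h i i j j').trans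
      (if_pos rfl))
  · intro i' _ hne
    rw [integral_const_mul, hγ]
    exact mul_eq_zero_of_right _ ((integral_eval_mul_eval_pi_multivariateGaussian h i i' j j').trans
      (if_neg hne.symm))
  · simp

/-- Each `Δ_p` is an increment of `Qhat`, so the covariances of the levels below `l` telescope. -/
lemma sum_Delta {l : ℕ} (hl : l ≤ k + 1) (j j' : Fin n) :
    ∑ p : Fin (k + 1), (if (p : ℕ) < l then S.Delta p j j' else 0) =
      S.Qhat l j j' - S.Qhat 0 j j' := by
  rw [Fin.sum_univ_eq_sum_range (fun p => if p < l then S.Delta p j j' else 0),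
    ← Finset.sum_filter, ← Finset.sum_range_sub (fun p => S.Qhat p j j') l]
  refine Finset.sum_congr ?_ fun p _ => rfl
  ext p
  simp only [Finset.mem_filter, Finset.mem_range]
  omega

lemma measurable_euclidean_apply (i : Fin N) : Measurable fun x : EuclideanSpace ℝ (Fin N) => x i :=
  (EuclideanSpace.proj i : EuclideanSpace ℝ (Fin N) →L[ℝ] ℝ).measurable

lemma measurable_config (j : Fin n) : Measurable fun σ : S.constraintSet N ε => σ.1 j :=
  (measurable_pi_apply j).comp measurable_subtype_coe

lemma measurable_config_apply (j : Fin n) (i : Fin N) :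
    Measurable fun σ : S.constraintSet N ε => σ.1 j i :=
  (measurable_euclidean_apply i).comp (measurable_config j)

lemma deriv_zero_of_even {f : ℝ → ℝ} (h : ∀ x, f (-x) = f x) : deriv f 0 = 0 := by
  have := deriv_comp_neg f 0
  simp only [h, neg_zero] at this
  linarith

variable [MeasurableSpace Ω]

/-- The assumptions on a coupled system. -/
structure Standing (S : CoupledSystem n k Ω) (P : Measure Ω) (c : ℕ → ℝ) : Prop where
  diff : Differentiable ℝ S.ξ
  conv : ConvexOn ℝ univ S.ξ
  even : ∀ x, S.ξ (-x) = S.ξ x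
  gauss : ∀ N, IsGaussianProcess (S.H N) P
  meas : ∀ N, Measurable fun p : EuclideanSpace ℝ (Fin N) × Ω => S.H N p.1 p.2
  mean : ∀ N σ, ∫ ω, S.H N σ ω ∂P = 0
  cov : ∀ N, ∀ σ ∈ Metric.sphere (0 : EuclideanSpace ℝ (Fin N)) (Real.sqrt N),
      ∀ τ ∈ Metric.sphere (0 : EuclideanSpace ℝ (Fin N)) (Real.sqrt N),
        |(1 / (N : ℝ)) * ∫ ω, S.H N σ ω * S.H N τ ω ∂P - S.ξ (overlap σ τ)| ≤ c N
  β_pos : ∀ j, 0 < S.β j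
  Q_psd : S.Q.PosSemidef
  Q_diag : ∀ j, S.Q j j = 1
  m_zero : S.m 0 = 0
  m_lt : ∀ l < k, S.m l < S.m (l + 1)
  m_last : S.m k = 1
  Qs_zero : S.Qs 0 = 0
  Delta_psd : ∀ l ≤ k, (S.Delta l).PosSemidef

namespace Standing

variable {P : Measure Ω} {c : ℕ → ℝ}

lemma neZero (h : S.Standing P c) (hε : 0 < ε) (hN : n ≤ N) : NeZero (S.cascade N ε).ν := by
  refine ⟨fun h0 => ?_⟩
  have := uniformSpheres_constraintSet_pos h.Q_psd h.Q_diag hε hN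
  have e := congrArg (fun μ => μ univ) h0
  simp only [cascade, (MeasurableEmbedding.subtype_coe measurableSet_constraintSet).comap_apply,
    image_univ, Subtype.range_coe] at e
  rw [e] at this
  exact lt_irrefl _ this

lemma m_pos (h : S.Standing P c) : ∀ l, 1 ≤ l → l ≤ k → 0 < S.m l := by
  intro l h1
  induction l, h1 using Nat.le_induction with
  | base => exact fun hk => h.m_zero ▸ h.m_lt 0 hk
  | succ l _ ih => exact fun hk => (ih (by omega)).trans (h.m_lt l hk)

lemma admissible (h : S.Standing P c) :
    ∃ M, (S.cascade N ε).Admissible (S.external N ε) (S.interaction N ε) M := by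
  -- Coordinates of points of the sphere are at most `√N`. The summand `1` controls the linear forms
  -- and `|h j|` the external field, so one constant serves both.
  refine ⟨∑ j, ∑ _i : Fin N, √N * (1 + |S.h j|), h.m_zero, h.m_last, h.m_pos,
    fun p => integral_id_pi_eq_zero _ fun _ => integral_id_multivariateGaussian, ?_, ?_, ?_, ?_⟩
  · exact Finset.measurable_fun_sum _ fun j _ => Finset.measurable_fun_sum _ fun i _ =>
      (measurable_config_apply j i).mul_const _
  · simp only [interaction_apply]
    refine Finset.measurable_fun_sum _ fun j _ => Finset.measurable_fun_sum _ fun i _ =>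
      ((measurable_config_apply j i).comp measurable_fst).mul ?_
    exact (measurable_euclidean_apply j).comp ((measurable_pi_apply i).comp measurable_snd)
  · intro σ
    refine (Finset.abs_sum_le_sum_abs _ _).trans (Finset.sum_le_sum fun j _ =>
      (Finset.abs_sum_le_sum_abs _ _).trans (Finset.sum_le_sum fun i _ => ?_))
    rw [abs_mul]
    exact mul_le_mul (abs_apply_le_of_mem_sphere (σ.2.1 j) i) (by linarith) (abs_nonneg _)
      (Real.sqrt_nonneg _)
  · intro σ
    refine ContinuousLinearMap.opNorm_le_bound _ (by positivity) fun x => ?_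
    rw [interaction_apply, Real.norm_eq_abs, Finset.sum_mul]
    refine (Finset.abs_sum_le_sum_abs _ _).trans (Finset.sum_le_sum fun j _ => ?_)
    rw [Finset.sum_mul]
    refine (Finset.abs_sum_le_sum_abs _ _).trans (Finset.sum_le_sum fun i _ => ?_)
    rw [abs_mul]
    have h1 := abs_apply_le_of_mem_sphere (σ.2.1 j) i
    have h2 : |x i j| ≤ ‖x‖ := (PiLp.norm_apply_le (x i) j).trans (norm_le_pi_norm x i)
    refine mul_le_mul (h1.trans ?_) h2 (abs_nonneg _) (by positivity)
    exact le_mul_of_one_le_right (Real.sqrt_nonneg _) (by linarith [abs_nonneg (S.h j)])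

variable [IsProbabilityMeasure P]

lemma memLp_H (h : S.Standing P c) (σ : EuclideanSpace ℝ (Fin N)) : MemLp (S.H N σ) 2 P :=
  ((h.gauss N).hasGaussianLaw_eval σ).memLp_two

lemma integral_energy_mul (h : S.Standing P c) (σ ρ : S.constraintSet N ε) :
    ∫ ω, S.energy N ε σ ω * S.energy N ε ρ ω ∂P =
      ∑ j, ∑ j', S.β j * S.β j' * ∫ ω, S.H N (σ.1 j) ω * S.H N (ρ.1 j') ω ∂P := by
  have hi : ∀ j j', Integrable (fun ω =>
      S.β j * S.β j' * (S.H N (σ.1 j) ω * S.H N (ρ.1 j') ω)) P := fun j j' =>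
    ((h.memLp_H (σ.1 j)).integrable_mul (h.memLp_H (ρ.1 j'))).const_mul _
  have e : ∀ ω, S.energy N ε σ ω * S.energy N ε ρ ω = ∑ j, ∑ j',
      S.β j * S.β j' * (S.H N (σ.1 j) ω * S.H N (ρ.1 j') ω) := fun ω => by
    rw [energy, energy, Finset.sum_mul]
    refine Finset.sum_congr rfl fun j _ => ?_
    rw [Finset.mul_sum]
    exact Finset.sum_congr rfl fun j' _ => by ring
  simp only [e]
  rw [integral_finsetSum _ fun j _ => integrable_finsetSum _ fun j' _ => hi j j']
  refine Finset.sum_congr rfl fun j _ => ?_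
  rw [integral_finsetSum _ fun j' _ => hi j j']
  exact Finset.sum_congr rfl fun j' _ => integral_const_mul _ _

lemma exists_abs_ξ_le (h : S.Standing P c) : ∃ B, ∀ x : ℝ, |x| ≤ 1 → |S.ξ x| ≤ B := by
  obtain ⟨B, hB⟩ := (isCompact_Icc (a := (-1 : ℝ)) (b := 1)).exists_bound_of_continuousOn
    h.diff.continuous.continuousOn
  exact ⟨B, fun x hx => hB x (abs_le.1 hx)⟩

/-- Finite families of energies are linear images of finite families of values of `H`, hence
Gaussian. The variance bound comes from the covariance hypothesis and the boundedness of `ξ` on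
`[-1, 1]`; `n ≤ N` allows division by `N` as soon as some copy exists. -/
lemma boundedGaussian (h : S.Standing P c) (hN : n ≤ N) :
    ∃ V, BoundedGaussian P (S.energy N ε) V := by
  obtain ⟨B, hB⟩ := h.exists_abs_ξ_le
  refine ⟨∑ j, ∑ j', S.β j * S.β j' * (N * (B + c N)),
    ⟨fun I => ?_⟩, ?_, fun σ => ?_, fun σ => ?_⟩
  · classical
    set J := I.biUnion fun σ => Finset.univ.image σ.1
    have hJ : ∀ (σ : I) j, σ.1.1 j ∈ J := fun σ j =>
      Finset.mem_biUnion.2 ⟨σ.1, σ.2, Finset.mem_image_of_mem _ (Finset.mem_univ j)⟩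
    let K : (J → ℝ) →L[ℝ] (I → ℝ) := ContinuousLinearMap.pi fun σ =>
      ∑ j, S.β j • ContinuousLinearMap.proj (⟨σ.1.1 j, hJ σ j⟩ : J)
    have e : (fun ω => I.restrict (S.energy N ε · ω)) =
        K ∘ fun ω => J.restrict (S.H N · ω) := by
      ext ω σ
      simp [energy, K]
    rw [e]
    exact ((h.gauss N).hasGaussianLaw J).map K
  · unfold energy
    refine Finset.measurable_fun_sum _ fun j _ => Measurable.const_mul ?_ _
    exact (h.meas N).comp (f := fun q : S.constraintSet N ε × Ω => (q.1.1 j, q.2))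
      (((measurable_config j).comp measurable_fst).prodMk measurable_snd)
  · unfold energy
    rw [integral_finsetSum _ fun j _ => ((h.memLp_H (σ.1 j)).integrable (by simp)).const_mul _]
    simp [integral_const_mul, h.mean]
  · simp only [pow_two, h.integral_energy_mul]
    refine Finset.sum_le_sum fun j _ => Finset.sum_le_sum fun j' _ =>
      mul_le_mul_of_nonneg_left ?_ (mul_pos (h.β_pos j) (h.β_pos j')).le
    have hN' : (0 : ℝ) < N := by exact_mod_cast j.pos.trans_le hN
    have h1 := (abs_le.1 (h.cov N _ (σ.2.1 j) _ (σ.2.1 j'))).2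
    have h2 := (abs_le.1 (hB _ (abs_overlap_le_one (σ.2.1 j) (σ.2.1 j')))).2
    rw [one_div] at h1
    rw [← inv_mul_le_iff₀ hN']
    linarith

/-- The covariance structure of the interpolation. -/
lemma abs_kernel_sub_le (h : S.Standing P c) (hN : 1 ≤ N) {l : ℕ} (hl : l ≤ k + 1)
    (σ ρ : S.constraintSet N ε) :
    |(1 / (N : ℝ)) * (S.cascade N ε).kernel (S.interaction N ε) P (S.energy N ε) l σ ρ -
      ∑ j, ∑ j', S.β j * S.β j' * (S.ξ (overlap (σ.1 j) (ρ.1 j')) -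
        overlap (σ.1 j) (ρ.1 j') * deriv S.ξ (S.Qs l j j'))| ≤
      c N * ∑ j, ∑ j', S.β j * S.β j' := by
  have hN' : (N : ℝ) ≠ 0 := by positivity
  have e : (1 / (N : ℝ)) * (S.cascade N ε).kernel (S.interaction N ε) P (S.energy N ε) l σ ρ -
      ∑ j, ∑ j', S.β j * S.β j' * (S.ξ (overlap (σ.1 j) (ρ.1 j')) -
        overlap (σ.1 j) (ρ.1 j') * deriv S.ξ (S.Qs l j j')) =
      ∑ j, ∑ j', S.β j * S.β j' * ((1 / (N : ℝ)) * ∫ ω, S.H N (σ.1 j) ω * S.H N (ρ.1 j') ω ∂P -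
        S.ξ (overlap (σ.1 j) (ρ.1 j'))) := by
    have hs : ∑ p : Fin (k + 1), (if (p : ℕ) < l then
        ∫ x, S.interaction N ε σ x * S.interaction N ε ρ x ∂((S.cascade N ε).γ p) else 0) =
        N * ∑ j, ∑ j', overlap (σ.1 j) (ρ.1 j') * (S.β j * S.β j' * deriv S.ξ (S.Qs l j j')) := by
      have : ∀ p : Fin (k + 1), (if (p : ℕ) < l then
          ∫ x, S.interaction N ε σ x * S.interaction N ε ρ x ∂((S.cascade N ε).γ p) else 0) =
          N * ∑ j, ∑ j', overlap (σ.1 j) (ρ.1 j') * (if (p : ℕ) < l then S.Delta p j j' else 0) := by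
        intro p
        split_ifs
        · exact integral_interaction_mul p (h.Delta_psd p (by omega)) σ ρ
        · simp
      rw [Finset.sum_congr rfl fun p _ => this p, ← Finset.mul_sum, Finset.sum_comm]
      congr 1
      refine Finset.sum_congr rfl fun j _ => ?_
      rw [Finset.sum_comm]
      refine Finset.sum_congr rfl fun j' _ => ?_
      rw [← Finset.mul_sum, sum_Delta hl]
      -- The lower end of the telescoping sum vanishes because `Q^0 = 0` and an even function has
      -- derivative zero at the origin.
      simp [Qhat, h.Qs_zero, deriv_zero_of_even h.even]
    rw [Cascade.kernel, hs, h.integral_energy_mul, mul_sub, ← mul_assoc, one_div_mul_cancel hN',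
      one_mul, Finset.mul_sum, ← Finset.sum_sub_distrib, ← Finset.sum_sub_distrib]
    refine Finset.sum_congr rfl fun j _ => ?_
    rw [Finset.mul_sum, ← Finset.sum_sub_distrib, ← Finset.sum_sub_distrib]
    exact Finset.sum_congr rfl fun j' _ => by ring
  rw [e, Finset.mul_sum]
  refine (Finset.abs_sum_le_sum_abs _ _).trans (Finset.sum_le_sum fun j _ => ?_)
  rw [Finset.mul_sum]
  refine (Finset.abs_sum_le_sum_abs _ _).trans (Finset.sum_le_sum fun j' _ => ?_)
  have hb := mul_pos (h.β_pos j) (h.β_pos j')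
  rw [abs_mul, abs_of_pos hb, mul_comm]
  exact mul_le_mul_of_nonneg_right (h.cov N _ (σ.2.1 j) _ (ρ.2.1 j')) hb.le

end Standing

end CoupledSystem

end

/-! ### Abel summation, the tangent inequality, and perturbation of averages. -/

section

lemma isVanishing_of_eventually_le {r : ℝ → ℕ → ℝ → ℝ}
    (h : ∀ η > 0, ∀ᶠ ε in 𝓝[>] (0 : ℝ), ∀ᶠ N in atTop, ∀ t ∈ Icc (0 : ℝ) 1, |r ε N t| ≤ η) :
    IsVanishing r := by
  refine nonpos_iff_eq_zero.1 (ENNReal.le_of_forall_pos_le_add fun η hη _ => ?_)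
  rw [zero_add]
  refine limsup_le_of_le (by isBoundedDefault) ((h η hη).mono fun ε hε => ?_)
  refine limsup_le_of_le (by isBoundedDefault) (hε.mono fun N hN => iSup₂_le fun t ht => ?_)
  rw [← ENNReal.ofReal_coe_nnreal]
  exact ENNReal.ofReal_le_ofReal (hN t ht)

/-- Abel summation. It converts the `θ` terms that complete the squares of the pair averages,
weighted by increments of `m`, into those of the main expression, weighted by `m` itself. -/
lemma sum_sub_mul_add_sum_mul_sub {m : ℕ → ℝ} (h0 : m 0 = 0) (Θ : ℕ → ℝ) (k : ℕ) :
    ∑ l ∈ Finset.Icc 1 k, (m l - m (l - 1)) * Θ l +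
      ∑ l ∈ Finset.Icc 1 k, m l * (Θ (l + 1) - Θ l) = m k * Θ (k + 1) := by
  induction k with
  | zero => simp [h0]
  | succ k ih =>
    rw [Finset.sum_Icc_succ_top (by omega), Finset.sum_Icc_succ_top (by omega), Nat.add_sub_cancel]
    linarith

lemma sum_Icc_sub {m : ℕ → ℝ} (h0 : m 0 = 0) (k : ℕ) :
    ∑ l ∈ Finset.Icc 1 k, (m l - m (l - 1)) = m k := by
  have := sum_sub_mul_add_sum_mul_sub h0 (fun _ => 1) k
  simpa using this

/-- By definition of `θ` the quantity equals `ξ(x) - ξ(q) - (x - q) ξ'(q)`, the height of the graph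
above its tangent at `q`. -/
lemma ConvexOn.zero_le_sub_add_theta {ξ : ℝ → ℝ} (hc : ConvexOn ℝ univ ξ) (hd : Differentiable ℝ ξ)
    (x q : ℝ) : 0 ≤ ξ x - x * deriv ξ q + theta ξ q := by
  rw [theta]
  rcases lt_trichotomy x q with h | rfl | h
  · have := hc.slope_le_deriv (mem_univ x) (mem_univ q) h (hd q)
    rw [slope_def_field, div_le_iff₀ (sub_pos.2 h)] at this
    linarith
  · linarith
  · have := hc.deriv_le_slope (mem_univ q) (mem_univ x) h (hd q)
    rw [slope_def_field, le_div_iff₀ (sub_pos.2 h)] at this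
    linarith

namespace Cascade

variable {k : ℕ} {E T Ω : Type*} [NormedAddCommGroup E] [NormedSpace ℝ E] [MeasurableSpace E]
  [BorelSpace E] [SecondCountableTopology E] [CompleteSpace E] [MeasurableSpace T]
  [MeasurableSpace Ω] {K : Cascade k E T} {b : T → ℝ} {L : T → StrongDual ℝ E} {M V : ℝ} {P : Measure Ω}
  {G : T → Ω → ℝ} {C : ℝ} {Y : T → (Fin (k + 1) → E) → ℝ}

lemma pathAvg_const_mul (a : ℝ) (f : T → ℝ) (t : ℝ) :
    K.pathAvg b L P G (fun σ => a * f σ) t = a * K.pathAvg b L P G f t := by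
  simp only [pathAvg, avg, mul_assoc, integral_const_mul, mul_left_comm _ a]

lemma pathPair_const_mul (a : ℝ) (l : ℕ) (f : T → T → ℝ) (t : ℝ) :
    K.pathPair b L P G l (fun σ ρ => a * f σ ρ) t = a * K.pathPair b L P G l f t := by
  simp only [pathPair, pairDensity, avg, mul_assoc, integral_const_mul, mul_left_comm _ a]

lemma pathPair_nonneg {l : ℕ} (hl : 1 ≤ l) {f : T → T → ℝ} (hf : ∀ σ ρ, 0 ≤ f σ ρ) (t : ℝ) :
    0 ≤ K.pathPair b L P G l f t :=
  integral_nonneg fun _ => mul_nonneg (prodW_pos _ _).le (integral_nonneg fun σ =>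
    mul_nonneg (integral_nonneg fun ρ => mul_nonneg (hf σ ρ) (D_nonneg _ _ hl _))
      (D_nonneg _ _ hl _))

variable [IsProbabilityMeasure P] [∀ p, IsGaussian (K.γ p)] [NeZero K.ν] [IsFiniteMeasure K.ν]

lemma Regular.avg_sub_sub (hK : K.Regular) (hC : 0 ≤ C) (hY : K.Nice C Y) {l : ℕ} (hl : 1 ≤ l)
    {u v : T → ℝ} (hu : Measurable u) (hv : Measurable v) {B B' : ℝ} (hB : ∀ σ, |u σ| ≤ B)
    (hB' : ∀ σ, |v σ| ≤ B') (a : ℝ) (z : Fin (k + 1) → E) :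
    K.avg Y l u z - K.avg Y l v z - a = K.avg Y l (fun σ => u σ - v σ - a) z := by
  have h1 := hK.integrable_mul_D hC hY hl z hu hB
  have h2 := hK.integrable_mul_D hC hY hl z hv hB'
  have h3 : Integrable (fun σ => a * K.D Y σ l z) K.ν := (hK.integrable_D hC hY hl z).const_mul a
  have h4 : Integrable (fun σ => u σ * K.D Y σ l z - v σ * K.D Y σ l z) K.ν := h1.sub h2
  simp only [avg, sub_mul]
  rw [integral_sub h4 h3, integral_sub h1 h2, integral_const_mul, hK.integral_D hC hY hl, mul_one]

lemma Admissible.abs_pathAvg_sub_le (h : K.Admissible b L M) (hG : BoundedGaussian P G V) {t : ℝ}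
    (ht : t ∈ Icc (0 : ℝ) 1) {f : T → ℝ} (hf : Measurable f) {a δ : ℝ}
    (hδ : ∀ σ, |f σ - a| ≤ δ) : |K.pathAvg b L P G f t - a| ≤ δ := by
  have : Nonempty T := K.nonempty_of_neZero
  have hC : 0 ≤ (k + 1) * M := mul_nonneg (by positivity) h.M_nonneg
  have hn := (h.ae_nice hG).mono fun ω hω => hω t ht
  have hm := h.measurable_pathHam_process hG.meas t
  have hB : ∀ σ, |f σ| ≤ δ + |a| := fun σ => by
    have := abs_add_le (f σ - a) a
    rw [sub_add_cancel] at this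
    linarith [hδ σ]
  have i1 := h.regular.integrable_prodW_mul_avg hC hm hn (k + 1) (Nat.le_add_left 1 k) hf hB
  have i2 := h.regular.integrable_prodW_mul hC hm hn (k + 1) (f := fun _ => a) measurable_const
    (B := |a|) (by simp)
  have e : K.pathAvg b L P G f t - a = ∫ q, K.prodW (pathHam b L (fun σ => G σ q.1) t) (k + 1) q.2 *
      (K.avg (pathHam b L (fun σ => G σ q.1) t) (k + 1) f q.2 - a) ∂(P.prod K.law) := by
    simp only [mul_sub]
    rw [integral_sub i1 i2, integral_mul_const,
      h.regular.integral_prodW_prod hC hm hn (Nat.le_add_left 1 k) le_rfl, one_mul]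
    rfl
  rw [e]
  refine h.regular.abs_integral_prodW_mul_le hC hm hn (Nat.le_add_left 1 k) le_rfl
    (f := fun q => K.avg (pathHam b L (fun σ => G σ q.1) t) (k + 1) f q.2 - a)
    (hn.mono fun ω hω z => ?_)
  have := h.regular.avg_sub_sub hC hω (Nat.le_add_left 1 k) hf (v := fun _ => 0) measurable_const hB
    (B' := 0) (by simp) a z
  simp only [sub_zero] at this
  have h0 : K.avg (pathHam b L (fun σ => G σ ω) t) (k + 1) (fun _ => 0) z = 0 := by simp [avg]
  rw [h0, sub_zero] at this
  simp only [this]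
  exact h.regular.abs_avg_le hC hω (Nat.le_add_left 1 k) hδ z

/-- Pair averages are integrals against a probability, so a pointwise comparison up to the constant
`a` survives averaging with the same error. -/
lemma Admissible.abs_pathPair_sub_sub_le (h : K.Admissible b L M) (hG : BoundedGaussian P G V)
    {t : ℝ} (ht : t ∈ Icc (0 : ℝ) 1) {l : ℕ} (h1 : 1 ≤ l) (hl : l ≤ k + 1) {f g : T → T → ℝ}
    (hf : Measurable fun q : T × T => f q.1 q.2) (hg : Measurable fun q : T × T => g q.1 q.2)
    {B a δ : ℝ} (hB : ∀ σ ρ, |f σ ρ| ≤ B) (hδ : ∀ σ ρ, |f σ ρ - g σ ρ - a| ≤ δ) :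
    |K.pathPair b L P G l f t - K.pathPair b L P G l g t - a| ≤ δ := by
  have : Nonempty T := K.nonempty_of_neZero
  have hC : 0 ≤ (k + 1) * M := mul_nonneg (by positivity) h.M_nonneg
  have hn := (h.ae_nice hG).mono fun ω hω => hω t ht
  have hm := h.measurable_pathHam_process hG.meas t
  have hB' : ∀ σ ρ, |g σ ρ| ≤ B + |a| + δ := fun σ ρ => by
    have e1 := abs_le.1 (hδ σ ρ)
    have e2 := abs_le.1 (hB σ ρ)
    have e3 := abs_le.1 (le_refl |a|)
    exact abs_le.2 ⟨by linarith, by linarith⟩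
  have i1 := h.regular.integrable_pairDensity hC hm hn h1 h1 hf hB
  have i2 := h.regular.integrable_pairDensity hC hm hn h1 h1 hg hB'
  have i3 := h.regular.integrable_prodW_mul hC hm hn l (f := fun _ => a) measurable_const
    (B := |a|) (by simp)
  have i4 : Integrable (fun q : Ω × (Fin (k + 1) → E) =>
      K.pairDensity (pathHam b L (fun σ => G σ q.1) t) l l f q.2 -
        K.pairDensity (pathHam b L (fun σ => G σ q.1) t) l l g q.2) (P.prod K.law) := i1.sub i2
  have e : K.pathPair b L P G l f t - K.pathPair b L P G l g t - a =
      ∫ q, K.prodW (pathHam b L (fun σ => G σ q.1) t) l q.2 *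
      (K.avg (pathHam b L (fun σ => G σ q.1) t) l
          (fun σ => K.avg (pathHam b L (fun σ => G σ q.1) t) l (f σ) q.2) q.2 -
        K.avg (pathHam b L (fun σ => G σ q.1) t) l
          (fun σ => K.avg (pathHam b L (fun σ => G σ q.1) t) l (g σ) q.2) q.2 - a)
        ∂(P.prod K.law) := by
    simp only [mul_sub]
    refine Eq.trans ?_ (integral_sub i4 i3).symm
    rw [integral_sub i1 i2, integral_mul_const, h.regular.integral_prodW_prod hC hm hn h1 hl,
      one_mul]
    rfl
  rw [e]
  refine h.regular.abs_integral_prodW_mul_le hC hm hn h1 hl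
    (f := fun q => K.avg (pathHam b L (fun σ => G σ q.1) t) l
          (fun σ => K.avg (pathHam b L (fun σ => G σ q.1) t) l (f σ) q.2) q.2 -
        K.avg (pathHam b L (fun σ => G σ q.1) t) l
          (fun σ => K.avg (pathHam b L (fun σ => G σ q.1) t) l (g σ) q.2) q.2 - a)
    (hn.mono fun ω hω z => ?_)
  have hf' : ∀ σ, Measurable (f σ) := fun σ => hf.comp (measurable_const.prodMk measurable_id)
  have hg' : ∀ σ, Measurable (g σ) := fun σ => hg.comp (measurable_const.prodMk measurable_id)
  simp only
  rw [h.regular.avg_sub_sub hC hω h1 (h.regular.measurable_avg_left hω h1 hf z)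
    (h.regular.measurable_avg_left hω h1 hg z)
    (fun σ => h.regular.abs_avg_le hC hω h1 (hB σ) z)
    (fun σ => h.regular.abs_avg_le hC hω h1 (hB' σ) z)]
  refine h.regular.abs_avg_le hC hω h1 (fun σ => ?_) z
  rw [h.regular.avg_sub_sub hC hω h1 (hf' σ) (hg' σ) (hB σ) (hB' σ)]
  exact h.regular.abs_avg_le hC hω h1 (hδ σ) z

end Cascade

end

/-! ### The derivative for the coupled system and its error. -/

section

namespace CoupledSystem

variable {n k : ℕ} {Ω : Type*} [MeasurableSpace Ω]

/-- The derivative of the constrained interpolated free energy. -/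
def phiDeriv (S : CoupledSystem n k Ω) (P : Measure Ω) (ε : ℝ) (N : ℕ) (t : ℝ) : ℝ :=
  (1 / (N : ℝ)) *
    (S.cascade N ε).pathDeriv (S.external N ε) (S.interaction N ε) P (S.energy N ε) t

/-- The main term of the derivative of the constrained interpolated free energy. -/
def mainTerm (S : CoupledSystem n k Ω) : ℝ :=
  (1 / 2) * ∑ j, ∑ j', S.β j * S.β j' *
      (S.ξ (S.Q j j') - S.Q j j' * deriv S.ξ (S.Qs (k + 1) j j') + theta S.ξ (S.Qs (k + 1) j j'))
    - (1 / 2) * ∑ l ∈ Finset.Icc 1 k, S.m l * ∑ j, ∑ j', S.β j * S.β j' *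
      (theta S.ξ (S.Qs (l + 1) j j') - theta S.ξ (S.Qs l j j'))

/-- The weighted sum of the values of a function of two indices. -/
def weightedSum (S : CoupledSystem n k Ω) (f : Fin n → Fin n → ℝ) : ℝ :=
  ∑ j, ∑ j', S.β j * S.β j' * f j j'

variable {S : CoupledSystem n k Ω} {N : ℕ} {ε : ℝ}

lemma weightedSum_add (f g : Fin n → Fin n → ℝ) :
    S.weightedSum (fun j j' => f j j' + g j j') = S.weightedSum f + S.weightedSum g := by
  simp only [weightedSum, mul_add, Finset.sum_add_distrib]

lemma weightedSum_sub (f g : Fin n → Fin n → ℝ) :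
    S.weightedSum (fun j j' => f j j' - g j j') = S.weightedSum f - S.weightedSum g := by
  simp only [weightedSum, mul_sub, Finset.sum_sub_distrib]

lemma weightedSum_const_mul (a : ℝ) (f : Fin n → Fin n → ℝ) :
    S.weightedSum (fun j j' => a * f j j') = a * S.weightedSum f := by
  simp only [weightedSum, Finset.mul_sum, mul_left_comm _ a]

namespace Standing

variable {P : Measure Ω} {c : ℕ → ℝ}

lemma abs_weightedSum_le (h : S.Standing P c) {f g : Fin n → Fin n → ℝ}
    (hfg : ∀ j j', |f j j'| ≤ g j j') : |S.weightedSum f| ≤ S.weightedSum g := by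
  refine (Finset.abs_sum_le_sum_abs _ _).trans (Finset.sum_le_sum fun j _ =>
    (Finset.abs_sum_le_sum_abs _ _).trans (Finset.sum_le_sum fun j' _ => ?_))
  have hb := mul_pos (h.β_pos j) (h.β_pos j')
  rw [abs_mul, abs_of_pos hb]
  exact mul_le_mul_of_nonneg_left (hfg j j') hb.le

lemma weightedSum_nonneg (h : S.Standing P c) {f : Fin n → Fin n → ℝ}
    (hf : ∀ j j', 0 ≤ f j j') : 0 ≤ S.weightedSum f :=
  Finset.sum_nonneg fun j _ => Finset.sum_nonneg fun j' _ =>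
    mul_nonneg (mul_pos (h.β_pos j) (h.β_pos j')).le (hf j j')

lemma m_sub_nonneg (h : S.Standing P c) {l : ℕ} (hl : l ∈ Finset.Icc 1 k) :
    0 ≤ S.m l - S.m (l - 1) := by
  obtain ⟨h1, h2⟩ := Finset.mem_Icc.1 hl
  have := h.m_lt (l - 1) (by omega)
  rw [Nat.sub_add_cancel h1] at this
  linarith

lemma remainder_nonneg (h : S.Standing P c) (t : ℝ) : 0 ≤ S.remainder P N ε t := by
  refine mul_nonneg (by norm_num) (Finset.sum_nonneg fun l hl =>
    mul_nonneg (h.m_sub_nonneg hl) ?_)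
  rw [pairAverage_eq t (Finset.mem_Icc.1 hl).1]
  exact Cascade.pathPair_nonneg (Finset.mem_Icc.1 hl).1 (fun σ ρ => h.weightedSum_nonneg
    fun j j' => h.conv.zero_le_sub_add_theta h.diff _ _) t

variable [IsProbabilityMeasure P]

lemma hasDerivWithinAt_phi (h : S.Standing P c) (hk : 1 ≤ k) (hε : 0 < ε) (hN : n ≤ N) {t : ℝ}
    (ht : t ∈ Icc (0 : ℝ) 1) :
    HasDerivWithinAt (fun s => S.phi P N ε s) (S.phiDeriv P ε N t) (Icc 0 1) t := by
  have := h.neZero hε hN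
  obtain ⟨M, hM⟩ := h.admissible (N := N) (ε := ε)
  obtain ⟨V, hV⟩ := h.boundedGaussian (ε := ε) hN
  have e : (fun s => S.phi P N ε s) = fun s => (1 / (N : ℝ)) *
      (S.cascade N ε).pathEnergy (S.external N ε) (S.interaction N ε) P (S.energy N ε) s :=
    funext fun s => phi_eq s
  rw [e]
  exact (hM.hasDerivWithinAt_pathEnergy hk hV ht).const_mul _

lemma measurable_remainder_integrand (h : S.Standing P c) (l : ℕ) :
    Measurable fun q : S.constraintSet N ε × S.constraintSet N ε =>
      S.weightedSum fun j j' => S.ξ (overlap (q.1.1 j) (q.2.1 j')) -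
        overlap (q.1.1 j) (q.2.1 j') * deriv S.ξ (S.Qs l j j') + theta S.ξ (S.Qs l j j') := by
  refine Finset.measurable_fun_sum _ fun j _ => Finset.measurable_fun_sum _ fun j' _ =>
    Measurable.const_mul ?_ _
  have ho : Measurable fun q : S.constraintSet N ε × S.constraintSet N ε =>
      overlap (q.1.1 j) (q.2.1 j') :=
    continuous_overlap.measurable.comp
      (f := fun q : S.constraintSet N ε × S.constraintSet N ε => (q.1.1 j, q.2.1 j'))
      (((measurable_config j).comp measurable_fst).prodMk
        ((measurable_config j').comp measurable_snd))
  exact ((h.diff.continuous.measurable.comp ho).sub (ho.mul_const _)).add_const _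

/-- The kernels are replaced by their limits at cost `c N`, once on the diagonal and once in the
pair averages, whose weights `m l - m (l - 1)` sum to `1`. On the diagonal the overlaps are then
moved to `Q`, at a cost given by `η` and `ε`. The bound does not depend on `t`. -/
lemma abs_phiDeriv_sub_le (h : S.Standing P c) (hε : 0 < ε) (hN : n ≤ N) (hN1 : 1 ≤ N) {t : ℝ}
    (ht : t ∈ Icc (0 : ℝ) 1) {η : ℝ}
    (hη : ∀ j j', ∀ x, |x - S.Q j j'| ≤ ε → |S.ξ x - S.ξ (S.Q j j')| ≤ η) :
    |S.phiDeriv P ε N t - (S.mainTerm - S.remainder P N ε t)| ≤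
      c N * S.weightedSum (fun _ _ => 1) + (1 / 2) * (η * S.weightedSum (fun _ _ => 1) +
        ε * S.weightedSum fun j j' => |deriv S.ξ (S.Qs (k + 1) j j')|) := by
  have := h.neZero hε hN
  obtain ⟨M, hM⟩ := h.admissible (N := N) (ε := ε)
  obtain ⟨V, hV⟩ := h.boundedGaussian (ε := ε) hN
  obtain ⟨B, -, hB⟩ := hM.exists_abs_kernel_process_le P V
  set β₁ := S.weightedSum fun _ _ => 1 with hβ₁
  set Θ : ℕ → ℝ := fun l => S.weightedSum fun j j' => theta S.ξ (S.Qs l j j') with hΘ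
  set ker := (S.cascade N ε).kernel (S.interaction N ε) P (S.energy N ε) with hker
  set a : ℝ := S.weightedSum fun j j' => S.ξ (S.Q j j') - S.Q j j' * deriv S.ξ (S.Qs (k + 1) j j')
    with ha
  set A := (S.cascade N ε).pathAvg (S.external N ε) (S.interaction N ε) P (S.energy N ε)
    (fun σ => (1 / (N : ℝ)) * ker (k + 1) σ σ) t with hA
  set F : ℕ → ℝ := fun l => (S.cascade N ε).pathPair (S.external N ε) (S.interaction N ε) P
    (S.energy N ε) l (fun σ ρ => (1 / (N : ℝ)) * ker l σ ρ) t with hF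
  set g : ℕ → S.constraintSet N ε → S.constraintSet N ε → ℝ := fun l σ ρ =>
    S.weightedSum fun j j' => S.ξ (overlap (σ.1 j) (ρ.1 j')) -
        overlap (σ.1 j) (ρ.1 j') * deriv S.ξ (S.Qs l j j') + theta S.ξ (S.Qs l j j') with hg
  set Gs : ℕ → ℝ := fun l => (S.cascade N ε).pathPair (S.external N ε) (S.interaction N ε) P
    (S.energy N ε) l (g l) t with hGs
  have hkm : ∀ l, Measurable fun q : S.constraintSet N ε × S.constraintSet N ε =>
      ker l q.1 q.2 := fun l =>
    Cascade.measurable_kernel (K := S.cascade N ε) (P := P) hM.L_meas hV.meas l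
  have hkc : ∀ l ≤ k + 1, ∀ σ ρ : S.constraintSet N ε, |(1 / (N : ℝ)) * ker l σ ρ -
      S.weightedSum fun j j' => S.ξ (overlap (σ.1 j) (ρ.1 j')) -
        overlap (σ.1 j) (ρ.1 j') * deriv S.ξ (S.Qs l j j')| ≤ c N * β₁ := by
    intro l hl σ ρ
    have := h.abs_kernel_sub_le hN1 hl σ ρ
    simpa only [hβ₁, weightedSum, mul_one] using this
  have e1 : S.phiDeriv P ε N t =
      (1 / 2) * (A - ∑ l ∈ Finset.Icc 1 k, (S.m l - S.m (l - 1)) * F l) := by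
    simp only [phiDeriv, Cascade.pathDeriv, hA, hF, Cascade.pathAvg_const_mul,
      Cascade.pathPair_const_mul, mul_left_comm _ (1 / (N : ℝ)), ← Finset.mul_sum, ← mul_sub]
    rfl
  have e2 : S.remainder P N ε t =
      (1 / 2) * ∑ l ∈ Finset.Icc 1 k, (S.m l - S.m (l - 1)) * Gs l := by
    rw [remainder]
    congr 1
    refine Finset.sum_congr rfl fun l hl => ?_
    rw [pairAverage_eq t (Finset.mem_Icc.1 hl).1]
    rfl
  have e3 : S.mainTerm = (1 / 2) * (a + Θ (k + 1)) -
      (1 / 2) * ∑ l ∈ Finset.Icc 1 k, S.m l * (Θ (l + 1) - Θ l) := by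
    simp only [ha, hΘ, ← weightedSum_add, ← weightedSum_sub]
    rfl
  have e4 := sum_sub_mul_add_sum_mul_sub h.m_zero Θ k
  rw [h.m_last, one_mul] at e4
  have hA' : |A - a| ≤ c N * β₁ + (η * β₁ +
      ε * S.weightedSum fun j j' => |deriv S.ξ (S.Qs (k + 1) j j')|) := by
    refine hM.abs_pathAvg_sub_le hV ht
      (((hkm (k + 1)).comp (measurable_id.prodMk measurable_id)).const_mul _) fun σ => ?_
    have h1 := hkc (k + 1) le_rfl σ σ
    have h2 : |(S.weightedSum fun j j' => S.ξ (overlap (σ.1 j) (σ.1 j')) -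
        overlap (σ.1 j) (σ.1 j') * deriv S.ξ (S.Qs (k + 1) j j')) - a| ≤ η * β₁ +
      ε * S.weightedSum fun j j' => |deriv S.ξ (S.Qs (k + 1) j j')| := by
      rw [ha, hβ₁, ← weightedSum_sub, ← weightedSum_const_mul, ← weightedSum_const_mul,
        ← weightedSum_add]
      refine h.abs_weightedSum_le fun j j' => ?_
      have hj := σ.2.2 j j'
      have hq : |overlap (σ.1 j) (σ.1 j') - S.Q j j'| ≤ ε :=
        abs_le.2 ⟨by linarith [hj.1], by linarith [hj.2]⟩
      have hx := hη j j' _ hq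
      have hy := mul_le_mul_of_nonneg_right hq (abs_nonneg (deriv S.ξ (S.Qs (k + 1) j j')))
      rw [← abs_mul] at hy
      have e : S.ξ (overlap (σ.1 j) (σ.1 j')) - overlap (σ.1 j) (σ.1 j') *
          deriv S.ξ (S.Qs (k + 1) j j') - (S.ξ (S.Q j j') - S.Q j j' *
          deriv S.ξ (S.Qs (k + 1) j j')) = (S.ξ (overlap (σ.1 j) (σ.1 j')) - S.ξ (S.Q j j')) -
          (overlap (σ.1 j) (σ.1 j') - S.Q j j') * deriv S.ξ (S.Qs (k + 1) j j') := by ring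
      rw [e, mul_one]
      exact (abs_sub _ _).trans (add_le_add hx hy)
    exact (abs_sub_le _ _ _).trans (add_le_add h1 h2)
  have hFG : ∀ l ∈ Finset.Icc 1 k, |F l - Gs l + Θ l| ≤ c N * β₁ := by
    intro l hl
    obtain ⟨h1, h2⟩ := Finset.mem_Icc.1 hl
    rw [← sub_neg_eq_add]
    refine hM.abs_pathPair_sub_sub_le hV ht h1 (by omega) ((hkm l).const_mul _)
      (h.measurable_remainder_integrand l) (B := |1 / (N : ℝ)| * B) (fun σ ρ => ?_) fun σ ρ => ?_
    · rw [abs_mul]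
      exact mul_le_mul_of_nonneg_left (hB _ hV l σ ρ) (abs_nonneg _)
    · have := hkc l (by omega) σ ρ
      have e : g l σ ρ = (S.weightedSum fun j j' => S.ξ (overlap (σ.1 j) (ρ.1 j')) -
        overlap (σ.1 j) (ρ.1 j') * deriv S.ξ (S.Qs l j j')) + Θ l := weightedSum_add _ _
      rw [e]
      convert this using 2
      ring
  have hsum : |∑ l ∈ Finset.Icc 1 k, (S.m l - S.m (l - 1)) * (F l - Gs l + Θ l)| ≤ c N * β₁ := by
    calc |∑ l ∈ Finset.Icc 1 k, (S.m l - S.m (l - 1)) * (F l - Gs l + Θ l)|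
        ≤ ∑ l ∈ Finset.Icc 1 k, (S.m l - S.m (l - 1)) * (c N * β₁) := by
          refine (Finset.abs_sum_le_sum_abs _ _).trans (Finset.sum_le_sum fun l hl => ?_)
          rw [abs_mul, abs_of_nonneg (h.m_sub_nonneg hl)]
          exact mul_le_mul_of_nonneg_left (hFG l hl) (h.m_sub_nonneg hl)
      _ = c N * β₁ := by rw [← Finset.sum_mul, sum_Icc_sub h.m_zero, h.m_last, one_mul]
  have e5 : S.phiDeriv P ε N t - (S.mainTerm - S.remainder P N ε t) = (1 / 2) * ((A - a) -
      ∑ l ∈ Finset.Icc 1 k, (S.m l - S.m (l - 1)) * (F l - Gs l + Θ l)) := by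
    simp only [mul_add, mul_sub, Finset.sum_add_distrib, Finset.sum_sub_distrib] at e4 ⊢
    rw [e1, e2, e3]
    simp only [mul_sub, Finset.sum_sub_distrib] at e4 ⊢
    linarith
  rw [e5, abs_mul, abs_of_pos (by norm_num : (0 : ℝ) < 1 / 2)]
  have := (abs_sub (A - a) (∑ l ∈ Finset.Icc 1 k, (S.m l - S.m (l - 1)) * (F l - Gs l + Θ l))).trans
    (add_le_add hA' hsum)
  linarith

/-- For small `ε`, continuity of `ξ` at the finitely many entries of `Q` makes the diagonal cost
small; for `N` large depending on `ε`, the cost `c N` is small as well. -/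
lemma isVanishing_error (h : S.Standing P c) (hc : Tendsto c atTop (𝓝 0)) :
    IsVanishing fun ε N t => S.phiDeriv P ε N t - (S.mainTerm - S.remainder P N ε t) := by
  refine isVanishing_of_eventually_le fun η hη => ?_
  set β₁ := S.weightedSum fun _ _ => 1 with hβ₁
  set β₂ := S.weightedSum fun j j' => |deriv S.ξ (S.Qs (k + 1) j j')|
  have hβ₁0 : 0 ≤ β₁ := h.weightedSum_nonneg fun _ _ => zero_le_one
  have hη' : 0 < η / (2 * (β₁ + 1)) := by positivity
  have hcont : ∀ᶠ ε in 𝓝[>] (0 : ℝ), ∀ j j', ∀ x, |x - S.Q j j'| ≤ ε →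
      |S.ξ x - S.ξ (S.Q j j')| ≤ η / (2 * (β₁ + 1)) := by
    refine eventually_all.2 fun j => eventually_all.2 fun j' => ?_
    obtain ⟨δ, hδ, hd⟩ := Metric.continuous_iff.1 h.diff.continuous (S.Q j j') _ hη'
    filter_upwards [Ioo_mem_nhdsGT hδ] with ε hε x hx
    exact (hd x (hx.trans_lt hε.2)).le
  have hε₂ : Tendsto (fun ε : ℝ => ε * β₂) (𝓝[>] 0) (𝓝 0) := by
    have : Tendsto (fun ε : ℝ => ε * β₂) (𝓝 0) (𝓝 (0 * β₂)) := tendsto_id.mul_const _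
    rw [zero_mul] at this
    exact this.mono_left nhdsWithin_le_nhds
  have hcβ : Tendsto (fun N => c N * β₁) atTop (𝓝 0) := by
    have := hc.mul_const β₁
    rwa [zero_mul] at this
  filter_upwards [hcont, hε₂.eventually_le_const (u := η / 2) (by linarith), self_mem_nhdsWithin]
    with ε h1 h2 h3
  filter_upwards [hcβ.eventually_le_const (u := η / 2) (by linarith), eventually_ge_atTop n,
    eventually_ge_atTop 1] with N h4 h5 h6 t ht
  refine (h.abs_phiDeriv_sub_le h3 h5 h6 ht h1).trans ?_
  have h7 : η / (2 * (β₁ + 1)) * β₁ ≤ η / 2 := by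
    rw [div_mul_eq_mul_div, div_le_div_iff₀ (by positivity) two_pos]
    nlinarith
  linarith

end Standing

end CoupledSystem

end

end

theorem theorem5 {n k : ℕ} (hk : 1 ≤ k) {Ω : Type*} [MeasurableSpace Ω] (P : Measure Ω)
    [IsProbabilityMeasure P] (S : CoupledSystem n k Ω)
    -- `ξ` is differentiable, convex and even, with `ξ(0) = 0`
    (hξ_diff : Differentiable ℝ S.ξ) (hξ_conv : ConvexOn ℝ univ S.ξ)
    (hξ_even : ∀ x, S.ξ (-x) = S.ξ x) (hξ_zero : S.ξ 0 = 0)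
    -- `H N` is a centered, jointly measurable Gaussian process on `ℝ^N`
    (hH_gauss : ∀ N, IsGaussianProcess (S.H N) P)
    (hH_meas : ∀ N, Measurable fun p : EuclideanSpace ℝ (Fin N) × Ω => S.H N p.1 p.2)
    (hH_mean : ∀ N σ, ∫ ω, S.H N σ ω ∂P = 0)
    -- whose covariance is asymptotically `N ξ(overlap)` on the sphere of radius `√N`
    (c : ℕ → ℝ) (hc : Tendsto c atTop (𝓝 0))
    (hH_cov : ∀ N, ∀ σ ∈ Metric.sphere (0 : EuclideanSpace ℝ (Fin N)) (Real.sqrt N),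
      ∀ τ ∈ Metric.sphere (0 : EuclideanSpace ℝ (Fin N)) (Real.sqrt N),
        |(1 / (N : ℝ)) * ∫ ω, S.H N σ ω * S.H N τ ω ∂P - S.ξ (overlap σ τ)| ≤ c N)
    -- the temperatures and the overlap constraint
    (hβ : ∀ j, 0 < S.β j)
    (hQ_psd : S.Q.PosSemidef) (hQ_diag : ∀ j, S.Q j j = 1)
    -- `0 = m_0 < m_1 < ⋯ < m_k = 1`
    (hm_zero : S.m 0 = 0) (hm_lt : ∀ l < k, S.m l < S.m (l + 1)) (hm_last : S.m k = 1)
    -- `Q^0 = 0`, the `Q^l` are symmetric and the `Δ_l` are nonnegative definite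
    (hQs_zero : S.Qs 0 = 0) (hQs_symm : ∀ l ≤ k + 1, (S.Qs l).IsSymm)
    (hDelta : ∀ l ≤ k, (S.Delta l).PosSemidef) :
    ∃ err : ℝ → ℕ → ℝ → ℝ, IsVanishing err ∧
      ∀ ε : ℝ, 0 < ε → ∀ N : ℕ, n ≤ N → ∀ t ∈ Icc (0 : ℝ) 1,
        0 ≤ S.remainder P N ε t ∧
        HasDerivWithinAt (fun s => S.phi P N ε s)
          ((1 / 2) * ∑ j, ∑ j', S.β j * S.β j' *
              (S.ξ (S.Q j j') - S.Q j j' * deriv S.ξ (S.Qs (k + 1) j j')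
                + theta S.ξ (S.Qs (k + 1) j j'))
            - (1 / 2) * ∑ l ∈ Finset.Icc 1 k, S.m l * ∑ j, ∑ j', S.β j * S.β j' *
              (theta S.ξ (S.Qs (l + 1) j j') - theta S.ξ (S.Qs l j j'))
            - S.remainder P N ε t + err ε N t)
          (Icc (0 : ℝ) 1) t := by
  have h : S.Standing P c := ⟨hξ_diff, hξ_conv, hξ_even, hH_gauss, hH_meas, hH_mean, hH_cov, hβ,
    hQ_psd, hQ_diag, hm_zero, hm_lt, hm_last, hQs_zero, hDelta⟩
  -- The error is by definition the exact derivative minus the claimed expression, so the formula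
  -- holds identically for every `N ≥ n`; the estimates enter only in showing that it vanishes.
  refine ⟨_, h.isVanishing_error hc, fun ε hε N hN t ht => ⟨h.remainder_nonneg t, ?_⟩⟩
  refine (h.hasDerivWithinAt_phi hk hε hN ht).congr_deriv ?_
  change _ = S.mainTerm - S.remainder P N ε t + _
  ring
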